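/- A *triangulation quiver* is a pair $(Q,f)$, where $Q=(Q_0,Q_1,s,t)$ is a finite connected quiver and $f$ is a permutation of the set $Q_1$ of arrows such that every vertex is the source of exactly two arrows and the target of exactly two arrows, $s(f(\alpha))=t(\alpha)$ for every arrow $\alpha$, and $f^3$ is the identity. A *surface* is a connected compact (Hausdorff, non-empty) $2$-dimensional real topological manifold $S$, orientable or not, with boundary $\partial S$ possibly empty. A *triangulation* $T$ of $S$ is given by a finite cell structure: finite families of continuous characteristic maps from the point, the interval $D^1=[0,1]$ and the closed disk $D^2$ (taken to be a triangle) into $S$, each restricting to a homeomorphism from the interior of its domain onto its image (an open cell), such that the open cells are pairwise disjoint and cover $S$, the ends of $D^1$ are sent to $0$-cells, and each of the three sides of $D^2$ runs homeomorphically along one edge, where the edges are the images of $D^1$ under its characteristic maps. The three sides of a triangle run along three different edges $a,b,c$, or along two edges $a,a,b$ with $a\neq b$ (a *self-folded* triangle); different corners of a triangle may coincide in $S$. It is required that $T$ has at least three pairwise different edges. A *directed triangulated surface* $(S,\vec T)$ is a surface with such a triangulation $T$ and an arbitrary choice $\vec T$ of an orientation $(a\,b\,c)$ or $(c\,b\,a)$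 of each triangle of $T$ (for a self-folded triangle there is only one, $(a\,a\,b)$). Let $Q(S,\vec T)$ be the quiver with a permutation $f$ of its arrows whose vertices are the edges of $T$ and whose arrows are: for each oriented triangle $(a\,b\,c)$ in $\vec T$ (including $(a\,a\,b)$), arrows $a\to b$, $b\to c$, $c\to a$, permuted cyclically in this order by $f$; and for each edge $a$ of $T$ contained in $\partial S$, a loop at $a$ fixed by $f$. **Theorem.** Let $(Q,f)$ be a triangulation quiver with at least three vertices. 1. There is a directed triangulated surface $(S,\vec T)$ such that $(Q,f)\cong Q(S,\vec T)$ (an isomorphism of quivers compatible with the permutations). 2. $Q$ contains a loop $\alpha$ with $f(\alpha)=\alpha$ if and only if there is a directed triangulated surface $(S,\vec T)$ with $(Q,f)\cong Q(S,\vec T)$ and $\partial S\neq\emptyset$. Moreover, for every directed triangulated surface $(S,\vec T)$ with $(Q,f)\cong Q(S,\vec T)$, the quiver $Q$ contains a loop $\alpha$ with $f(\alpha)=\alpha$ if and only if $\partial S\neq\emptyset$. -/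

import Mathlib

open scoped Manifold

universe u v w u' v'

/-! ### Quivers with a permutation of the arrows -/

/-- A pair `(Q, f)`: a quiver `Q = (V, A, s, t)` together with a permutation `f` of its arrows. -/
structure QuiverPerm where
  /-- the vertices -/
  V : Type u
  /-- the arrows -/
  A : Type v
  /-- the source of an arrow -/
  s : A → V
  /-- the target of an arrow -/
  t : A → V
  /-- the permutation of the arrows -/
  f : Equiv.Perm A

namespace QuiverPerm

/-- `(Q, f)` is a triangulation quiver: `Q` is a finite connected quiver, every vertex is the source
of exactly two arrows and the target of exactly two arrows, `s (f α) = t α` for all arrows `α`,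
and `f³` is the identity. -/
structure IsTriangulationQuiver (Q : QuiverPerm.{u, v}) : Prop where
  finite_vertices : Finite Q.V
  finite_arrows : Finite Q.A
  nonempty : Nonempty Q.V
  connected : ∀ v w : Q.V, Relation.EqvGen (fun x y => ∃ α : Q.A, Q.s α = x ∧ Q.t α = y) v w
  two_outgoing : ∀ v : Q.V, {α : Q.A | Q.s α = v}.ncard = 2
  two_incoming : ∀ v : Q.V, {α : Q.A | Q.t α = v}.ncard = 2
  s_f : ∀ α : Q.A, Q.s (Q.f α) = Q.t α
  f_cubed : ∀ α : Q.A, Q.f (Q.f (Q.f α)) = α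

/-- `Q` has a loop `α` with `f α = α`. -/
def HasFixedLoop (Q : QuiverPerm.{u, v}) : Prop :=
  ∃ α : Q.A, Q.s α = Q.t α ∧ Q.f α = α

/-- An isomorphism `(Q, f) ≅ (Q', f')`: an isomorphism of quivers carrying `f` to `f'`. -/
structure Iso (Q : QuiverPerm.{u, v}) (Q' : QuiverPerm.{u', v'}) where
  onV : Q.V ≃ Q'.V
  onA : Q.A ≃ Q'.A
  map_s : ∀ α, onV (Q.s α) = Q'.s (onA α)
  map_t : ∀ α, onV (Q.t α) = Q'.t (onA α)
  map_f : ∀ α, onA (Q.f α) = Q'.f (onA α)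

end QuiverPerm

/-! ### Surfaces -/

/-- A surface: a connected (in particular non-empty) compact Hausdorff 2-dimensional topological
manifold, orientable or not, with or without boundary. -/
structure Surface where
  /-- the underlying space -/
  carrier : Type w
  [top : TopologicalSpace carrier]
  [charts : ChartedSpace (EuclideanHalfSpace 2) carrier]
  [hausdorff : T2Space carrier]
  [compact : CompactSpace carrier]
  [conn : ConnectedSpace carrier]

attribute [instance] Surface.top Surface.charts Surface.hausdorff Surface.compact Surface.conn

namespace Surface

/-- The manifold boundary `∂S`. -/
def boundary (S : Surface.{w}) : Set S.carrier := (𝓡∂ 2).boundary S.carrier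

end Surface

/-! ### Triangular cell structures -/

/-- The closed triangle, used as the closed 2-disk `D²`. -/
abbrev Triangle : Type := stdSimplex ℝ (Fin 3)

/-- The affine parametrization `[0, 1] → Triangle` of the side opposite to the corner `i`. -/
def Triangle.side (i : Fin 3) (x : unitInterval) : Triangle :=
  ⟨fun j => if j = i then 0 else if j = i + 1 then 1 - (x : ℝ) else (x : ℝ), by
    obtain ⟨x, hx0, hx1⟩ := x
    constructor
    · intro j
      dsimp only
      split_ifs <;> linarith
    · fin_cases i <;> simp [Fin.sum_univ_three]⟩

/-- The interior of the closed triangle. -/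
def Triangle.interior : Set Triangle := {p | ∀ j : Fin 3, 0 < p.1 j}

/-- The (characteristic) maps of a finite 2-dimensional cell structure: points, continuous maps
from the interval `D¹ = [0, 1]` and continuous maps from the closed triangle `D²`. -/
structure CellMaps (X : Type w) [TopologicalSpace X] where
  /-- the index set of the 0-cells -/
  V : Type
  /-- the index set of the 1-cells -/
  E : Type
  /-- the index set of the 2-cells -/
  F : Type
  [finite_V : Finite V]
  [finite_E : Finite E]
  [finite_F : Finite F]
  pointMap : V → X
  edgeMap : E → C(unitInterval, X)
  faceMap : F → C(Triangle, X)

namespace CellMaps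

variable {X : Type w} [TopologicalSpace X]

/-- The open cells. -/
def cell (K : CellMaps X) : K.V ⊕ K.E ⊕ K.F → Set X
  | .inl v => {K.pointMap v}
  | .inr (.inl e) => K.edgeMap e '' Set.Ioo 0 1
  | .inr (.inr T) => K.faceMap T '' Triangle.interior

end CellMaps

/-- A finite 2-dimensional triangular cell structure (a triangulation in the generalized sense) on a
space `X`. Each characteristic map restricts to a homeomorphism from the open disk onto its cell,
the cells are pairwise disjoint and cover `X`, both ends of an edge are 0-cells, and each of the
three sides of a triangle runs homeomorphically (in either direction) along one edge. The three
sides of a triangle may be three different edges, or two of them may be the same edge (a self-folded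
triangle), but not all three. Different corners of a triangle may be the same point of `X`. -/
structure TriangularCellStructure (X : Type w) [TopologicalSpace X] extends CellMaps X where
  edge_isEmbedding : ∀ e, Topology.IsEmbedding
    (fun x : Set.Ioo (0 : unitInterval) 1 => edgeMap e x)
  face_isEmbedding : ∀ T, Topology.IsEmbedding
    (fun p : Triangle.interior => faceMap T p)
  existsUnique_cell : ∀ x : X, ∃! c, x ∈ toCellMaps.cell c
  edge_zero : ∀ e, edgeMap e 0 ∈ Set.range pointMap
  edge_one : ∀ e, edgeMap e 1 ∈ Set.range pointMap
  /-- the edge along which the `i`-th side of the triangle `T` runs -/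
  sideEdge : F → Fin 3 → E
  side_eq : ∀ T i, ∃ h : unitInterval ≃ₜ unitInterval,
    ∀ x, faceMap T (Triangle.side i x) = edgeMap (sideEdge T i) (h x)
  sides_not_all_equal : ∀ T, ∃ i j, sideEdge T i ≠ sideEdge T j

/-- A directed triangulated surface: a surface with a triangulation having at least three
edges, and an orientation of each triangle. An orientation of a triangle is given by one
of the two cyclic orders of its sides, that is, by a 3-cycle `next T` sending each side to the side
that follows it. (For a self-folded triangle both cyclic orders are the order `(a a b)`.) -/
structure DirectedTriangulatedSurface where
  surface : Surface.{w}
  cells : TriangularCellStructure surface.carrier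
  three_le_edges : 3 ≤ Nat.card cells.E
  next : cells.F → Equiv.Perm (Fin 3)
  next_isThreeCycle : ∀ T, (next T).IsThreeCycle

namespace DirectedTriangulatedSurface

/-- The manifold boundary of the underlying surface. -/
def boundary (D : DirectedTriangulatedSurface.{w}) : Set D.surface.carrier := D.surface.boundary

/-- `e` is a boundary edge: the (closed) edge lies on the boundary of the surface. -/
def IsBoundaryEdge (D : DirectedTriangulatedSurface.{w}) (e : D.cells.E) : Prop :=
  Set.range (D.cells.edgeMap e) ⊆ D.boundary

/-- The arrows of the associated quiver: one for each side of each triangle, and one for each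
boundary edge. -/
abbrev Arrow (D : DirectedTriangulatedSurface.{w}) : Type :=
  (D.cells.F × Fin 3) ⊕ {e : D.cells.E // D.IsBoundaryEdge e}

/-- The quiver `Q(S, T⃗)` with its permutation `f`. Its vertices are the edges of the triangulation.
An oriented triangle with sides `a, b, c` in this cyclic order gives arrows
`a → b`, `b → c`, `c → a` (so a self-folded triangle `(a a b)` gives a loop `a → a` and arrows
`a → b`, `b → a`), permuted cyclically by `f`; a boundary edge `a` gives a loop at `a`, fixed
by `f`. -/
def quiver (D : DirectedTriangulatedSurface.{w}) : QuiverPerm.{0, 0} where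
  V := D.cells.E
  A := D.Arrow
  s := Sum.elim (fun p => D.cells.sideEdge p.1 p.2) (fun e => e.1)
  t := Sum.elim (fun p => D.cells.sideEdge p.1 (D.next p.1 p.2)) (fun e => e.1)
  f := Equiv.sumCongr (Equiv.prodShear (Equiv.refl _) D.next) (Equiv.refl _)

end DirectedTriangulatedSurface

/-! Construction. An orbit of `f` is a fixed arrow, necessarily a loop, or has three elements. Take
one triangle for every orbit of length three, with the arrows of the orbit as its sides, and let the
side of an arrow run along the edge given by the source of that arrow. Each vertex of `Q` is the
source of two arrows, which are not both fixed: otherwise the vertex would be a connected component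
by itself (`not_two_fixed`). If neither is fixed, the two sides are glued; if one is fixed, the
other side stays free. The result is a compact connected space of triangles in which every edge has
one or two sides, and the fixed arrows correspond to the edges with one side (`exists_gluing`).

To see that this space is a surface, it is realized inside a finite-dimensional real vector space by
coordinates whose signs tell which open cell a point lies in; so it is Hausdorff without further
work. All charts come from one principle (`exists_halfPlane_chart`): two continuous maps from a
compact space, one to the surface and one to the half plane, which have the same fibres induce a
homeomorphism between their images. It is applied to a shrunken triangle, to strips along the sides
at an edge, and to the sectors around a vertex. Glued sides run in opposite directions, so turning
around a vertex is a permutation `rot` of all corners. The corners at a vertex thus form a cycle,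
giving a disc, or a chain between two free sides, giving a half disc (`nonempty_cornerOrder`,
`sectors_eq_iff`, `polarSector_eq_iff`).

Boundary. The charts are merely topological, so invariance of the boundary has to be proved
(`halfPlane_boundary_invariance`): a small circle around an interior point contracts in a half disc
punctured at a boundary point of its diameter, but does not contract in the punctured plane. Hence
the boundary edges of the glued surface are exactly the free edges.

For an arbitrary directed triangulated surface, the arrows coming from triangles are moved by
3-cycles, so the fixed loops are exactly the loops at boundary edges. If there is no boundary edge,
each edge has exactly two adjacent sides, and all points other than the finitely many 0-cells have
interior charts. A boundary point would have further boundary points near it that are not 0-cells,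
so the boundary is empty (`boundary_eq_empty`). This gives the equivalence for every surface
realizing `Q`. -/

/-! ### The half plane as a subset of `ℂ` -/

/-- The half plane as the closed upper half plane of `ℂ`. -/
def EuclideanHalfSpace.toComplex (x : EuclideanHalfSpace 2) : ℂ := ⟨x.1 1, x.1 0⟩

/-- The retraction of `ℂ` onto the half plane. -/
noncomputable def EuclideanHalfSpace.ofComplex (z : ℂ) : EuclideanHalfSpace 2 :=
  ⟨!₂[max z.im 0, z.re], by simp⟩

namespace EuclideanHalfSpace

theorem continuous_coord (i : Fin 2) : Continuous fun x : EuclideanHalfSpace 2 => x.1 i :=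
  (PiLp.continuous_apply 2 _ i).comp continuous_subtype_val

theorem continuous_toComplex : Continuous toComplex := by
  have h : toComplex = fun x : EuclideanHalfSpace 2 => ((x.1 1 : ℝ) : ℂ) + (x.1 0 : ℝ) * Complex.I := by
    funext x
    apply Complex.ext <;> simp [toComplex]
  rw [h]
  have h0 := continuous_coord 0
  have h1 := continuous_coord 1
  fun_prop

theorem continuous_ofComplex : Continuous ofComplex := by
  refine Continuous.subtype_mk ?_ _
  refine (PiLp.continuous_toLp 2 _).comp (continuous_pi fun i => ?_)
  fin_cases i
  · exact Complex.continuous_im.max continuous_const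
  · exact Complex.continuous_re

theorem im_toComplex_nonneg (x : EuclideanHalfSpace 2) : 0 ≤ x.toComplex.im := x.2

@[simp] theorem im_toComplex (x : EuclideanHalfSpace 2) : x.toComplex.im = x.1 0 := rfl

@[simp] theorem ofComplex_toComplex (x : EuclideanHalfSpace 2) : ofComplex x.toComplex = x := by
  apply EuclideanHalfSpace.ext
  ext i
  have := x.2
  fin_cases i <;> simp [ofComplex, toComplex, this]

theorem toComplex_ofComplex {z : ℂ} (hz : 0 ≤ z.im) : (ofComplex z).toComplex = z := by
  apply Complex.ext <;> simp [ofComplex, toComplex, hz]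

theorem toComplex_injective : Function.Injective toComplex := fun x y h => by
  rw [← ofComplex_toComplex x, h, ofComplex_toComplex]

end EuclideanHalfSpace

/-! ### Topological invariance of the boundary in dimension two -/

/-- Uniqueness of lifts along the covering `exp`, applied to a constant path. -/
theorem eq_of_continuous_of_exp_eq {h : ℝ → ℂ} (hc : Continuous h)
    (he : ∀ t, Complex.exp (h t) = Complex.exp (h 0)) (t : ℝ) : h t = h 0 := by
  have := Complex.isCoveringMap_exp.eq_of_comp_eq (g₁ := h) (g₂ := fun _ => h 0) hc
    continuous_const (by funext t; exact Subtype.ext (he t)) 0 rfl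
  exact congrFun this t

/-- A circle around the origin is not null-homotopic in the punctured plane. -/
theorem not_nullhomotopic_circle {G : ℝ × ℝ → ℂ} (hG : Continuous G) (hG0 : ∀ x, G x ≠ 0)
    (hconst : ∀ t, G (0, t) = G (0, 0)) (hper : ∀ s, G (s, 1) = G (s, 0)) {c : ℂ}
    (hcirc : ∀ t : ℝ, G (1, t) = c * Complex.exp (t * (2 * Real.pi * Complex.I))) : False := by
  have hU : IsSimplyConnected (Set.univ : Set (ℝ × ℝ)) := by
    have : ContractibleSpace (Set.univ : Set (ℝ × ℝ)) :=
      (Homeomorph.Set.univ (ℝ × ℝ)).contractibleSpace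
    exact (inferInstance : SimplyConnectedSpace (Set.univ : Set (ℝ × ℝ)))
  obtain ⟨f, hfc, hf⟩ := Complex.exists_continuousOn_eqOn_exp_comp hU isOpen_univ
    hG.continuousOn (by simpa using hG0)
  rw [continuousOn_univ] at hfc
  replace hf : ∀ x, Complex.exp (f x) = G x := fun x => hf (Set.mem_univ x)
  -- The increment of the logarithm `f` of `G` along a closed loop does not depend on `s`. It is `0`
  -- for the constant loop and `2πi` for the circle.
  have h1 : ∀ s, f (s, 1) - f (s, 0) = f (0, 1) - f (0, 0) :=
    eq_of_continuous_of_exp_eq (h := fun s => f (s, 1) - f (s, 0)) (by fun_prop)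
      fun s => by simp [Complex.exp_sub, hf, hper, div_self (hG0 _)]
  have h2 : ∀ t, f (0, t) = f (0, 0) :=
    eq_of_continuous_of_exp_eq (h := fun t => f (0, t)) (by fun_prop)
      fun t => by rw [hf, hf, hconst]
  have h3 : ∀ t : ℝ, f (1, t) - t * (2 * Real.pi * Complex.I) =
      f (1, 0) - (0 : ℝ) * (2 * Real.pi * Complex.I) :=
    eq_of_continuous_of_exp_eq (h := fun t : ℝ => f (1, t) - t * (2 * Real.pi * Complex.I))
      (by fun_prop) fun t => by
        have := Complex.exp_ne_zero (t * (2 * Real.pi * Complex.I))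
        rw [Complex.exp_sub, Complex.exp_sub, hf, hf, hcirc, hcirc]
        simp [this]
  have h4 := h3 1
  have h5 := h1 1
  rw [h2 1, sub_self, sub_eq_zero] at h5
  rw [h5] at h4
  simp [Complex.I_ne_zero, Real.pi_ne_zero] at h4

open EuclideanHalfSpace in
/-- A point cannot be an interior point for one chart and a boundary point for another. -/
theorem halfPlane_boundary_invariance {X : Type*} [TopologicalSpace X]
    (e₁ e₂ : OpenPartialHomeomorph X (EuclideanHalfSpace 2)) {x : X} (hx₁ : x ∈ e₁.source)
    (hx₂ : x ∈ e₂.source) (h₁ : (e₁ x).1 0 = 0) (h₂ : 0 < (e₂ x).1 0) : False := by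
  set φ := e₁.symm.trans e₂ with hφ
  set y := e₁ x with hy
  set z := e₂ x with hz
  have hys : y ∈ φ.source := by simp [hφ, hy, hx₁, hx₂]
  have hyz : φ y = z := by simp [hφ, hy, hx₁, hz]
  have hzt : z ∈ φ.target := hyz ▸ φ.map_source hys
  have hzy : φ.symm z = y := by rw [← hyz, φ.left_inv hys]
  -- a half disc around `y` in the source
  obtain ⟨ε, hε, hεs⟩ : ∃ ε > 0, ∀ w : ℂ, dist w y.toComplex < ε → ofComplex w ∈ φ.source := by
    have : ofComplex ⁻¹' φ.source ∈ nhds y.toComplex :=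
      (φ.open_source.preimage continuous_ofComplex).mem_nhds (by simpa using hys)
    obtain ⟨ε, hε, h⟩ := Metric.mem_nhds_iff.1 this
    exact ⟨ε, hε, fun w hw => h hw⟩
  -- a disc around `z`, mapped into this half disc
  obtain ⟨δ, hδ, hδs⟩ : ∃ δ > 0, ∀ w : ℂ, dist w z.toComplex < δ → 0 < w.im ∧
      ofComplex w ∈ φ.target ∧ dist (φ.symm (ofComplex w)).toComplex y.toComplex < ε := by
    have a1 : {w : ℂ | 0 < w.im} ∈ nhds z.toComplex :=
      (isOpen_lt continuous_const Complex.continuous_im).mem_nhds h₂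
    have a2 : ofComplex ⁻¹' φ.target ∈ nhds z.toComplex :=
      (φ.open_target.preimage continuous_ofComplex).mem_nhds (by simpa using hzt)
    have a3 : ContinuousAt (fun w => (φ.symm (ofComplex w)).toComplex) z.toComplex := by
      refine continuous_toComplex.continuousAt.comp ?_
      refine ContinuousAt.comp ?_ continuous_ofComplex.continuousAt
      simpa using φ.continuousAt_symm hzt
    have a4 : (fun w => (φ.symm (ofComplex w)).toComplex) ⁻¹' Metric.ball y.toComplex ε ∈
        nhds z.toComplex := a3 (by simpa [hzy] using Metric.ball_mem_nhds _ hε)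
    obtain ⟨δ, hδ, h⟩ := Metric.mem_nhds_iff.1 (Filter.inter_mem a1 (Filter.inter_mem a2 a4))
    exact ⟨δ, hδ, fun w hw => h hw⟩
  -- The circle `z + ω` is carried by the transition map to a loop `γ` in the half disc around `y`
  -- that avoids `y`.
  set ω : ℝ → ℂ := fun t => (δ / 2 : ℝ) * Complex.exp (t * (2 * Real.pi * Complex.I)) with hω
  have hωc : Continuous ω := by fun_prop
  have hωn : ∀ t, ‖ω t‖ = δ / 2 := fun t => by
    have : (t * (2 * Real.pi * Complex.I) : ℂ) = ((t * (2 * Real.pi) : ℝ) : ℂ) * Complex.I := by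
      push_cast; ring
    simp only [hω, norm_mul, this, Complex.norm_exp_ofReal_mul_I, Complex.norm_real]
    simp [abs_of_pos hδ]
  have hωd : ∀ t, dist (z.toComplex + ω t) z.toComplex < δ := fun t => by
    simp [dist_eq_norm, hωn]; linarith
  set γ : ℝ → ℂ := fun t => (φ.symm (ofComplex (z.toComplex + ω t))).toComplex with hγ
  have hγc : Continuous γ := by
    refine continuous_toComplex.comp ?_
    rw [← continuousOn_univ]
    refine φ.continuousOn_symm.comp (Continuous.continuousOn ?_) ?_
    · exact continuous_ofComplex.comp (by fun_prop)
    · exact fun t _ => (hδs _ (hωd t)).2.1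
  have hγy : ∀ t, γ t ≠ y.toComplex := fun t ht => by
    have h1 := toComplex_injective ht
    have h2 := φ.right_inv (hδs _ (hωd t)).2.1
    rw [h1, hyz] at h2
    have h3 := toComplex_ofComplex (hδs _ (hωd t)).1.le
    rw [← h2] at h3
    have h4 : ω t = 0 := by simpa using h3
    have := hωn t
    rw [h4, norm_zero] at this
    linarith
  -- `W` contracts `γ` to the point `b` straight above `y` along segments. Clamping the time to `[0,
  -- 1]` extends the homotopy to the whole plane.
  set b : ℂ := y.toComplex + (ε / 2 : ℝ) * Complex.I with hb
  have hbim : b.im = ε / 2 := by simp [hb, h₁]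
  have hbd : b ∈ Metric.ball y.toComplex ε := by
    simp [hb, dist_eq_norm, abs_of_pos hε]
    linarith
  set W : ℝ × ℝ → ℂ := fun x => (1 - (max 0 (min 1 x.1) : ℝ)) * b + (max 0 (min 1 x.1) : ℝ) * γ x.2
    with hW
  have hWc : Continuous W := by
    have : Continuous fun x : ℝ × ℝ => ((max 0 (min 1 x.1) : ℝ) : ℂ) :=
      Complex.continuous_ofReal.comp (by fun_prop)
    fun_prop
  have hWball : ∀ x, dist (W x) y.toComplex < ε := fun x => by
    have h0 : (0 : ℝ) ≤ max 0 (min 1 x.1) := by simp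
    have h1 : max 0 (min 1 x.1) ≤ (1 : ℝ) := by simp
    have := (convex_ball y.toComplex ε) hbd (hδs _ (hωd x.2)).2.2 (sub_nonneg.2 h1) h0 (by ring)
    simpa [hW] using this
  -- Since `y` is on the real line and `b` above it, a segment from `b` can meet the line only at
  -- its end, which lies on `γ` and is not `y`.
  have hWim : ∀ x, 0 ≤ (W x).im ∧ W x ≠ y.toComplex := fun x => by
    have h0 : (0 : ℝ) ≤ max 0 (min 1 x.1) := by simp
    have h1 : max 0 (min 1 x.1) ≤ (1 : ℝ) := by simp
    have hi : (W x).im = (1 - max 0 (min 1 x.1)) * (ε / 2) + max 0 (min 1 x.1) * (γ x.2).im := by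
      simp only [hW, ← hbim, ← Complex.ofReal_one, ← Complex.ofReal_sub, Complex.add_im,
        Complex.im_ofReal_mul]
    have hg : 0 ≤ (γ x.2).im := im_toComplex_nonneg _
    have hm := mul_nonneg h0 hg
    have hm' := mul_nonneg (sub_nonneg.2 h1) (half_pos hε).le
    refine ⟨by linarith, fun h => ?_⟩
    have h2 : (W x).im = 0 := by rw [h]; exact h₁
    have h3 : max 0 (min 1 x.1) = (1 : ℝ) := by
      by_contra h4
      have := mul_pos (sub_pos.2 (lt_of_le_of_ne h1 h4)) (half_pos hε)
      linarith
    apply hγy x.2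
    rw [← h]
    simp [hW, h3]
  have hgne : ∀ x, φ (ofComplex (W x)) ≠ z := fun x h => by
    apply (hWim x).2
    have : ofComplex (W x) = y := φ.injOn (hεs _ (hWball x)) hys (h.trans hyz.symm)
    rw [← toComplex_ofComplex (hWim x).1, this]
  refine not_nullhomotopic_circle (G := fun x => (φ (ofComplex (W x))).toComplex - z.toComplex)
    (c := (δ / 2 : ℝ)) ?_ ?_ ?_ ?_ ?_
  · refine (continuous_toComplex.comp ?_).sub continuous_const
    rw [← continuousOn_univ]
    exact φ.continuousOn.comp (continuous_ofComplex.comp hWc).continuousOn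
      fun x _ => hεs _ (hWball x)
  · exact fun x => sub_ne_zero.2 fun h => hgne x (toComplex_injective h)
  · intro t
    simp [hW]
  · intro s
    have : γ 1 = γ 0 := by simp [hγ, hω]
    simp [hW, this]
  · intro t
    have h1 : W (1, t) = γ t := by simp [hW]
    simp only [h1, hγ, ofComplex_toComplex]
    rw [φ.right_inv (hδs _ (hωd t)).2.1, toComplex_ofComplex (hδs _ (hωd t)).1.le]
    simp [hω]

/-! ### Charts from parametrizations by compact spaces -/

section ParametrizedCharts

variable {N X : Type*} [TopologicalSpace N] [CompactSpace N] [TopologicalSpace X] [T2Space X]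
  {q : N → X} {Ψ : N → ℂ} {U : Set N}

open EuclideanHalfSpace in
/-- If two continuous maps from a compact space, to `X` and to the upper half plane, have the same
fibres, and if the images of a set `U` are open, then the image of `U` in `X` is the domain of a
chart. -/
theorem exists_halfPlane_chart (hq : Continuous q) (hΨ : Continuous Ψ) (him : ∀ y, 0 ≤ (Ψ y).im)
    (hker : ∀ y y', q y = q y' ↔ Ψ y = Ψ y') (hqU : IsOpen (q '' U)) {O : Set ℂ} (hO : IsOpen O)
    (hΨU : Ψ '' U = O ∩ {z | 0 ≤ z.im}) {y : N} (hy : y ∈ U) :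
    ∃ e : OpenPartialHomeomorph X (EuclideanHalfSpace 2),
      q y ∈ e.source ∧ (e (q y)).1 0 = (Ψ y).im := by
  have : Nonempty N := ⟨y⟩
  set ψ : N → EuclideanHalfSpace 2 := ofComplex ∘ Ψ with hψ
  have hψc : Continuous ψ := continuous_ofComplex.comp hΨ
  have hψΨ : ∀ y, (ψ y).toComplex = Ψ y := fun y => toComplex_ofComplex (him y)
  have hker' : ∀ y y', q y = q y' ↔ ψ y = ψ y' := fun y y' => by
    rw [hker, ← hψΨ, ← hψΨ, toComplex_injective.eq_iff]
  have hψU : IsOpen (ψ '' U) := by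
    have : ψ '' U = toComplex ⁻¹' O := by
      ext h
      constructor
      · rintro ⟨y, hy, rfl⟩
        have : Ψ y ∈ Ψ '' U := ⟨y, hy, rfl⟩
        rw [hΨU] at this
        rw [Set.mem_preimage, hψΨ]
        exact this.1
      · intro hh
        have : h.toComplex ∈ Ψ '' U := by
          rw [hΨU]
          exact ⟨hh, im_toComplex_nonneg h⟩
        obtain ⟨y, hy, hyh⟩ := this
        exact ⟨y, hy, toComplex_injective (by rw [hψΨ, hyh])⟩
    rw [this]
    exact hO.preimage continuous_toComplex
  -- Both maps descend to injections of the compact quotient by the common fibres into Hausdorff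
  -- spaces, hence to closed embeddings. The chart is one embedding after the inverse of the other;
  -- values of `invFun` off the images play no role.
  let Q := Quotient (Setoid.ker q)
  have : Nonempty Q := ⟨Quotient.mk _ y⟩
  let qb : Q → X := Quotient.lift q fun _ _ h => h
  let ψb : Q → EuclideanHalfSpace 2 := Quotient.lift ψ fun _ _ h => (hker' _ _).1 h
  have hqb : Topology.IsClosedEmbedding qb := (hq.quotient_lift _).isClosedEmbedding (by
    rintro ⟨a⟩ ⟨b⟩ h
    exact Quotient.sound h)
  have hT2 : T2Space (EuclideanHalfSpace 2) :=
    inferInstanceAs (T2Space {x : EuclideanSpace ℝ (Fin 2) // 0 ≤ x 0})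
  have hψb : Topology.IsClosedEmbedding ψb := (hψc.quotient_lift _).isClosedEmbedding (by
    rintro ⟨a⟩ ⟨b⟩ h
    exact Quotient.sound ((hker' _ _).2 h))
  have hli : ∀ y, Function.invFun qb (q y) = Quotient.mk _ y := fun y =>
    Function.leftInverse_invFun hqb.injective (Quotient.mk _ y)
  have hli' : ∀ y, Function.invFun ψb (ψ y) = Quotient.mk _ y := fun y =>
    Function.leftInverse_invFun hψb.injective (Quotient.mk _ y)
  refine ⟨{
    toFun := fun x => ψb (Function.invFun qb x)
    invFun := fun h => qb (Function.invFun ψb h)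
    source := q '' U
    target := ψ '' U
    map_source' := ?_
    map_target' := ?_
    left_inv' := ?_
    right_inv' := ?_
    open_source := hqU
    open_target := hψU
    continuousOn_toFun := ?_
    continuousOn_invFun := ?_ }, ⟨y, hy, rfl⟩, ?_⟩
  · rintro _ ⟨y, hy, rfl⟩
    rw [hli]
    exact ⟨y, hy, rfl⟩
  · rintro _ ⟨y, hy, rfl⟩
    rw [hli']
    exact ⟨y, hy, rfl⟩
  · rintro _ ⟨y, hy, rfl⟩
    rw [hli]
    exact congrArg qb (hli' y)
  · rintro _ ⟨y, hy, rfl⟩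
    rw [hli']
    exact congrArg ψb (hli y)
  · refine hψb.continuous.comp_continuousOn ?_
    rw [hqb.isInducing.continuousOn_iff]
    refine continuousOn_id.congr ?_
    rintro _ ⟨y, hy, rfl⟩
    simp only [Function.comp, hli]
    rfl
  · refine hqb.continuous.comp_continuousOn ?_
    rw [hψb.isInducing.continuousOn_iff]
    refine continuousOn_id.congr ?_
    rintro _ ⟨y, hy, rfl⟩
    simp only [Function.comp, hli']
    rfl
  · change (ψb (Function.invFun qb (q y))).1 0 = _
    rw [hli, ← hψΨ]
    rfl

/-- The variant of `exists_halfPlane_chart` for interior points. -/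
theorem exists_interior_chart (hq : Continuous q) (hΨ : Continuous Ψ)
    (hker : ∀ y y', q y = q y' ↔ Ψ y = Ψ y') (hqU : IsOpen (q '' U)) (hΨU : IsOpen (Ψ '' U))
    {y : N} (hy : y ∈ U) :
    ∃ e : OpenPartialHomeomorph X (EuclideanHalfSpace 2),
      q y ∈ e.source ∧ 0 < (e (q y)).1 0 := by
  -- As `N` is compact, a translation moves the image of `Ψ` into the open upper half plane.
  obtain ⟨M, hM⟩ : ∃ M : ℝ, ∀ y, 0 < (Ψ y).im + M := by
    obtain ⟨M, hM⟩ := (isCompact_range (Complex.continuous_im.comp hΨ)).bddBelow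
    refine ⟨1 - M, fun y => ?_⟩
    have : M ≤ (Ψ y).im := hM ⟨y, rfl⟩
    linarith
  have hO : IsOpen ((fun z : ℂ => z + M * Complex.I) '' (Ψ '' U)) :=
    (Homeomorph.addRight ((M : ℂ) * Complex.I)).isOpenMap _ hΨU
  obtain ⟨e, h1, h2⟩ := exists_halfPlane_chart (Ψ := fun y => Ψ y + M * Complex.I) (U := U) hq
    (by fun_prop) (fun y => by simpa using (hM y).le) (fun y y' => by simp [hker]) hqU hO
    (by
      rw [Set.image_image]
      symm
      rw [Set.inter_eq_left]
      rintro _ ⟨y, -, rfl⟩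
      simpa using (hM y).le) hy
  exact ⟨e, h1, by rw [h2]; simpa using hM y⟩

end ParametrizedCharts

/-! ### Coordinates in the closed triangle -/

namespace Triangle

theorem fin3_cases (i j : Fin 3) : j = i ∨ j = i + 1 ∨ j = i + 2 := by
  revert i j; decide

theorem ext_at (i : Fin 3) {p p' : Triangle} (h0 : p.1 i = p'.1 i)
    (h1 : p.1 (i + 1) = p'.1 (i + 1)) (h2 : p.1 (i + 2) = p'.1 (i + 2)) : p = p' := by
  apply Subtype.ext
  funext j
  rcases fin3_cases i j with rfl | rfl | rfl <;> assumption

theorem sum_at (i : Fin 3) (p : Triangle) : p.1 i + p.1 (i + 1) + p.1 (i + 2) = 1 := by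
  have h : ∑ j, p.1 j = 1 := p.2.2
  rw [Fin.sum_univ_three] at h
  fin_cases i
  · simpa using h
  · change p.1 1 + p.1 2 + p.1 0 = 1
    linarith
  · change p.1 2 + p.1 0 + p.1 1 = 1
    linarith

theorem nonneg (p : Triangle) (j : Fin 3) : 0 ≤ p.1 j := p.2.1 j

theorem continuous_apply (j : Fin 3) : Continuous fun p : Triangle => p.1 j :=
  (_root_.continuous_apply j).comp continuous_subtype_val

/-- The point with the coordinates `a`, `b`, `c` at `i`, `i + 1`, `i + 2`. -/
def mkAt (i : Fin 3) (a b c : ℝ) (ha : 0 ≤ a) (hb : 0 ≤ b) (hc : 0 ≤ c) (h : a + b + c = 1) :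
    Triangle :=
  ⟨fun j => if j = i then a else if j = i + 1 then b else c, by
    constructor
    · intro j
      dsimp only
      split_ifs <;> assumption
    · rw [Fin.sum_univ_three]
      fin_cases i <;> simp <;> linarith⟩

section mkAt
variable {i : Fin 3} {a b c : ℝ} {ha : 0 ≤ a} {hb : 0 ≤ b} {hc : 0 ≤ c} {h : a + b + c = 1}

@[simp] theorem mkAt_zero : (mkAt i a b c ha hb hc h).1 i = a := by simp [mkAt]

@[simp] theorem mkAt_one : (mkAt i a b c ha hb hc h).1 (i + 1) = b := by simp [mkAt]

@[simp] theorem mkAt_two : (mkAt i a b c ha hb hc h).1 (i + 2) = c := by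
  have h1 : i + 2 ≠ i := by simp
  have h2 : i + 2 ≠ i + 1 := by simp
  simp [mkAt]

end mkAt

theorem continuous_mkAt {Y : Type*} [TopologicalSpace Y] {i : Fin 3} {a b c : Y → ℝ}
    {ha : ∀ y, 0 ≤ a y} {hb : ∀ y, 0 ≤ b y} {hc : ∀ y, 0 ≤ c y} {h : ∀ y, a y + b y + c y = 1}
    (ca : Continuous a) (cb : Continuous b) (cc : Continuous c) :
    Continuous fun y => mkAt i (a y) (b y) (c y) (ha y) (hb y) (hc y) (h y) := by
  refine Continuous.subtype_mk (continuous_pi fun j => ?_) _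
  split_ifs <;> assumption

@[simp] theorem side_zero (i : Fin 3) (x : unitInterval) : (side i x).1 i = 0 := by simp [side]

@[simp] theorem side_one (i : Fin 3) (x : unitInterval) : (side i x).1 (i + 1) = 1 - x := by
  simp [side]

@[simp] theorem side_two (i : Fin 3) (x : unitInterval) : (side i x).1 (i + 2) = x := by
  simp [side]

theorem side_notMem_interior (i : Fin 3) (x : unitInterval) : side i x ∉ interior := fun h =>
  (h i).ne' (side_zero i x)

theorem eq_side {i : Fin 3} {p : Triangle} (h : p.1 i = 0) :
    ∃ x : unitInterval, p = side i x ∧ (x : ℝ) = p.1 (i + 2) := by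
  have h1 := sum_at i p
  have h2 := nonneg p (i + 1)
  have h3 := nonneg p (i + 2)
  refine ⟨⟨p.1 (i + 2), h3, by linarith⟩, ext_at i ?_ ?_ ?_, rfl⟩
  · simp [h]
  · simp; linarith
  · simp

theorem exists_eq_zero_of_notMem_interior {p : Triangle} (h : p ∉ interior) : ∃ i, p.1 i = 0 := by
  by_contra! h'
  exact h fun j => lt_of_le_of_ne (nonneg p j) (h' j).symm

/-- The position of the projection of a point to the side `i`. -/
noncomputable def sideCoord (i : Fin 3) (p : Triangle) : unitInterval :=
  ⟨(1 + p.1 (i + 2) - p.1 (i + 1)) / 2, by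
    have h0 := sum_at i p
    have h1 := nonneg p i
    have h2 := nonneg p (i + 1)
    have h3 := nonneg p (i + 2)
    constructor <;> linarith⟩

theorem continuous_sideCoord (i : Fin 3) : Continuous (sideCoord i) := by
  have h1 := continuous_apply (i + 1)
  have h2 := continuous_apply (i + 2)
  exact Continuous.subtype_mk (((continuous_const.add h2).sub h1).div_const 2) _

/-- The height of the strip along a side over the point `x`. -/
noncomputable def stripHeight (x : unitInterval) : ℝ := x * (1 - x) / 2

theorem stripHeight_pos {x : unitInterval} (hx : x ∈ Set.Ioo (0 : unitInterval) 1) :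
    0 < stripHeight x := by
  have h0 : (0 : ℝ) < x := hx.1
  have h1 : (x : ℝ) < 1 := hx.2
  exact half_pos (mul_pos h0 (sub_pos.2 h1))

theorem continuous_stripHeight : Continuous stripHeight := by
  unfold stripHeight; fun_prop

/-- A strip along the side `i`, parametrized by a square. -/
noncomputable def strip (i : Fin 3) (x y : unitInterval) : Triangle :=
  mkAt i (y * stripHeight x) (1 - x - y * stripHeight x / 2) (x - y * stripHeight x / 2)
    (by
      obtain ⟨x, hx0, hx1⟩ := x
      obtain ⟨y, hy0, hy1⟩ := y
      have : 0 ≤ 1 - x := by linarith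
      simp only [stripHeight]
      positivity)
    (by
      obtain ⟨x, hx0, hx1⟩ := x
      obtain ⟨y, hy0, hy1⟩ := y
      have h1 : 0 ≤ 1 - x := by linarith
      have h2 : y * x ≤ 1 := mul_le_one₀ hy1 hx0 hx1
      simp only [stripHeight]
      nlinarith [mul_nonneg h1 (sub_nonneg.2 h2)])
    (by
      obtain ⟨x, hx0, hx1⟩ := x
      obtain ⟨y, hy0, hy1⟩ := y
      have h1 : 0 ≤ 1 - x := by linarith
      have h2 : y * (1 - x) ≤ 1 := mul_le_one₀ hy1 h1 (by linarith)
      simp only [stripHeight]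
      nlinarith [mul_nonneg hx0 (sub_nonneg.2 h2)])
    (by ring)

theorem continuous_strip (i : Fin 3) :
    Continuous fun z : unitInterval × unitInterval => strip i z.1 z.2 := by
  have := continuous_stripHeight
  exact continuous_mkAt (by fun_prop) (by fun_prop) (by fun_prop)

theorem strip_apply (i : Fin 3) (x y : unitInterval) : (strip i x y).1 i = y * stripHeight x :=
  mkAt_zero

/-- The factor `x (1 - x) / 2` makes the strip so thin that the coordinate `i` is the strictly
smallest one. So strips along different sides of one triangle do not meet. -/
theorem strip_lt (i : Fin 3) {x : unitInterval} (hx : x ∈ Set.Ioo (0 : unitInterval) 1)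
    (y : unitInterval) : (strip i x y).1 i < (strip i x y).1 (i + 1) ∧
      (strip i x y).1 i < (strip i x y).1 (i + 2) := by
  have h0 : (0 : ℝ) < x := hx.1
  have h1 : (x : ℝ) < 1 := hx.2
  have hy0 : (0 : ℝ) ≤ y := y.2.1
  have hy1 : (y : ℝ) ≤ 1 := y.2.2
  simp only [strip, mkAt_zero, mkAt_one, mkAt_two, stripHeight]
  have h2 : (0 : ℝ) < 1 - x := sub_pos.2 h1
  have h3 : (y : ℝ) * x ≤ 1 := mul_le_one₀ hy1 h0.le h1.le
  have h4 : (y : ℝ) * (1 - x) ≤ 1 := mul_le_one₀ hy1 h2.le (by linarith)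
  constructor
  · nlinarith [mul_nonneg h2.le (sub_nonneg.2 h3)]
  · nlinarith [mul_nonneg h0.le (sub_nonneg.2 h4)]

@[simp] theorem strip_zero (i : Fin 3) (x : unitInterval) : strip i x 0 = side i x :=
  ext_at i (by simp [strip]) (by simp [strip]) (by simp [strip])

theorem strip_mem_interior (i : Fin 3) {x y : unitInterval}
    (hx : x ∈ Set.Ioo (0 : unitInterval) 1) (hy : 0 < y) : strip i x y ∈ interior := by
  have h := strip_lt i hx y
  have h0 : 0 < (strip i x y).1 i := by
    rw [strip_apply]
    exact mul_pos hy (stripHeight_pos hx)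
  intro j
  rcases fin3_cases i j with rfl | rfl | rfl <;> linarith

-- The height is taken in equal parts from the two other coordinates, so their difference is that of
-- the point `x` of the side.
@[simp] theorem sideCoord_strip (i : Fin 3) (x y : unitInterval) :
    sideCoord i (strip i x y) = x := by
  apply Subtype.ext
  simp only [sideCoord, strip, mkAt_one, mkAt_two]
  ring

@[simp] theorem sideCoord_side (i : Fin 3) (x : unitInterval) : sideCoord i (side i x) = x := by
  rw [← strip_zero, sideCoord_strip]

theorem strip_inj {i i' : Fin 3} {x x' y y' : unitInterval}
    (hx : x ∈ Set.Ioo (0 : unitInterval) 1) (hx' : x' ∈ Set.Ioo (0 : unitInterval) 1)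
    (h : strip i x y = strip i' x' y') : i = i' ∧ x = x' ∧ y = y' := by
  have hi : i = i' := by
    have h1 := strip_lt i hx y
    have h2 := strip_lt i' hx' y'
    rw [← h] at h2
    rcases fin3_cases i i' with rfl | rfl | rfl
    · rfl
    · rw [add_assoc, add_assoc, show (1 + 2 : Fin 3) = 0 from rfl, add_zero] at h2
      linarith
    · rw [add_assoc, add_assoc, show (2 + 1 : Fin 3) = 0 from rfl, add_zero] at h2
      linarith
  subst hi
  have hxx : x = x' := by rw [← sideCoord_strip i x y, h, sideCoord_strip]
  subst hxx
  refine ⟨rfl, rfl, Subtype.ext ?_⟩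
  have := congrArg (fun p : Triangle => p.1 i) h
  simp only [strip_apply] at this
  exact mul_right_cancel₀ (stripHeight_pos hx).ne' this

/-- A point below the height of the strip lies in the strip. -/
theorem exists_eq_strip {i : Fin 3} {p : Triangle} (h : p.1 i < stripHeight (sideCoord i p)) :
    ∃ y : unitInterval, y < 1 ∧ p = strip i (sideCoord i p) y := by
  have h0 := nonneg p i
  have hw : 0 < stripHeight (sideCoord i p) := h0.trans_lt h
  have hy1 : p.1 i / stripHeight (sideCoord i p) < 1 := (div_lt_one hw).2 h
  have hs := sum_at i p
  refine ⟨⟨p.1 i / stripHeight (sideCoord i p), div_nonneg h0 hw.le, hy1.le⟩, hy1, ext_at i ?_ ?_ ?_⟩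
  · simp [strip, hw.ne']
  · simp only [strip, mkAt_one, div_mul_cancel₀ _ hw.ne']
    simp only [sideCoord]
    linarith
  · simp only [strip, mkAt_two, div_mul_cancel₀ _ hw.ne']
    simp only [sideCoord]
    linarith

end Triangle

/-! ### Homeomorphisms of the unit interval -/

/-- A continuous injection of the interval is strictly monotone or antitone, so inner points cannot
go to ends. -/
theorem unitInterval.homeomorph_mem_Ioo (h : unitInterval ≃ₜ unitInterval) {x : unitInterval} :
    h x ∈ Set.Ioo (0 : unitInterval) 1 ↔ x ∈ Set.Ioo (0 : unitInterval) 1 := by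
  have key : ∀ (h : unitInterval ≃ₜ unitInterval) (x : unitInterval),
      x ∈ Set.Ioo (0 : unitInterval) 1 → h x ∈ Set.Ioo (0 : unitInterval) 1 := by
    intro h x hx
    have hlt : ∀ {a b : unitInterval}, a < b → a ≠ 1 ∧ b ≠ 0 := fun {a b} hab =>
      ⟨fun h1 => (lt_of_lt_of_le hab unitInterval.le_one').ne h1,
        fun h1 => (lt_of_le_of_lt unitInterval.nonneg' hab).ne' h1⟩
    have h01 : ∀ a : unitInterval, a ∈ Set.Ioo (0 : unitInterval) 1 ↔ a ≠ 0 ∧ a ≠ 1 := fun a =>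
      ⟨fun h => ⟨h.1.ne', h.2.ne⟩, fun h => ⟨unitInterval.pos_iff_ne_zero.2 h.1,
        unitInterval.lt_one_iff_ne_one.2 h.2⟩⟩
    rcases h.continuous.strictMono_of_inj_boundedOrder' h.injective with hm | hm
    · rw [h01]
      exact ⟨(hlt (hm hx.1)).2, (hlt (hm hx.2)).1⟩
    · rw [h01]
      exact ⟨(hlt (hm hx.2)).2, (hlt (hm hx.1)).1⟩
  exact ⟨fun hx => by simpa using key h.symm _ hx, key h x⟩

/-! ### The topology of a triangular cell structure -/

namespace TriangularCellStructure

variable {X : Type*} [TopologicalSpace X] (K : TriangularCellStructure X)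

instance : Finite K.V := K.finite_V
instance : Finite K.E := K.finite_E
instance : Finite K.F := K.finite_F

theorem cell_unique {x : X} {c c'} (h : x ∈ K.cell c) (h' : x ∈ K.cell c') : c = c' :=
  (K.existsUnique_cell x).unique h h'

theorem edge_mem_cell (e : K.E) {x : unitInterval} (hx : x ∈ Set.Ioo (0 : unitInterval) 1) :
    K.edgeMap e x ∈ K.cell (.inr (.inl e)) := ⟨x, hx, rfl⟩

theorem face_mem_cell (T : K.F) {p : Triangle} (hp : p ∈ Triangle.interior) :
    K.faceMap T p ∈ K.cell (.inr (.inr T)) := ⟨p, hp, rfl⟩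

theorem edge_mem_vertex_cell (e : K.E) {x : unitInterval}
    (hx : x ∉ Set.Ioo (0 : unitInterval) 1) : ∃ v, K.edgeMap e x ∈ K.cell (.inl v) := by
  have : x = 0 ∨ x = 1 := by
    by_contra! h
    exact hx ⟨unitInterval.pos_iff_ne_zero.2 h.1, unitInterval.lt_one_iff_ne_one.2 h.2⟩
  rcases this with rfl | rfl
  · obtain ⟨v, hv⟩ := K.edge_zero e
    exact ⟨v, hv.symm⟩
  · obtain ⟨v, hv⟩ := K.edge_one e
    exact ⟨v, hv.symm⟩

theorem edge_notMem_face_cell (e : K.E) (x : unitInterval) (T : K.F) :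
    K.edgeMap e x ∉ K.cell (.inr (.inr T)) := by
  intro h
  by_cases hx : x ∈ Set.Ioo (0 : unitInterval) 1
  · simpa using K.cell_unique h (K.edge_mem_cell e hx)
  · obtain ⟨v, hv⟩ := K.edge_mem_vertex_cell e hx
    simpa using K.cell_unique h hv

/-- Because open cells are disjoint, it suffices that one of the two parameters is an inner point:
the other cannot be an end, which would lie in a 0-cell. -/
theorem edge_eq_edge {e e' : K.E} {x x' : unitInterval} (hx : x ∈ Set.Ioo (0 : unitInterval) 1)
    (h : K.edgeMap e x = K.edgeMap e' x') : e = e' ∧ x = x' := by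
  have h1 := K.edge_mem_cell e hx
  by_cases hx' : x' ∈ Set.Ioo (0 : unitInterval) 1
  · have h2 := K.edge_mem_cell e' hx'
    rw [← h] at h2
    have h3 := K.cell_unique h1 h2
    simp only [Sum.inr.injEq, Sum.inl.injEq] at h3
    subst h3
    have := (K.edge_isEmbedding e).injective (a₁ := ⟨x, hx⟩) (a₂ := ⟨x', hx'⟩) h
    exact ⟨rfl, congrArg Subtype.val this⟩
  · obtain ⟨v, hv⟩ := K.edge_mem_vertex_cell e' hx'
    rw [← h] at hv
    simpa using K.cell_unique h1 hv

/-- The homeomorphism by which a side of a triangle runs along its edge. -/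
noncomputable def sideHomeo (T : K.F) (i : Fin 3) : unitInterval ≃ₜ unitInterval :=
  (K.side_eq T i).choose

theorem faceMap_side (T : K.F) (i : Fin 3) (x : unitInterval) :
    K.faceMap T (Triangle.side i x) = K.edgeMap (K.sideEdge T i) (K.sideHomeo T i x) :=
  (K.side_eq T i).choose_spec x

theorem exists_edge_eq (T : K.F) {p : Triangle} (hp : p ∉ Triangle.interior) :
    ∃ i x, p = Triangle.side i x ∧
      K.faceMap T p = K.edgeMap (K.sideEdge T i) (K.sideHomeo T i x) := by
  obtain ⟨i, hi⟩ := Triangle.exists_eq_zero_of_notMem_interior hp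
  obtain ⟨x, rfl, -⟩ := Triangle.eq_side hi
  exact ⟨i, x, rfl, K.faceMap_side T i x⟩

theorem face_eq_edge {T : K.F} {p : Triangle} {e : K.E} {u : unitInterval}
    (hu : u ∈ Set.Ioo (0 : unitInterval) 1) (h : K.faceMap T p = K.edgeMap e u) :
    ∃ i x, p = Triangle.side i x ∧ K.sideEdge T i = e ∧ K.sideHomeo T i x = u := by
  have hp : p ∉ Triangle.interior := fun hp => by
    have := K.face_mem_cell T hp
    rw [h] at this
    exact K.edge_notMem_face_cell _ _ _ this
  obtain ⟨i, x, rfl, h1⟩ := K.exists_edge_eq T hp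
  rw [h] at h1
  obtain ⟨h2, h3⟩ := K.edge_eq_edge hu h1
  exact ⟨i, x, rfl, h2.symm, h3.symm⟩

theorem face_eq_face {T T' : K.F} {p p' : Triangle} (hp : p ∈ Triangle.interior)
    (h : K.faceMap T p = K.faceMap T' p') : T = T' ∧ p = p' := by
  have h1 := K.face_mem_cell T hp
  by_cases hp' : p' ∈ Triangle.interior
  · have h2 := K.face_mem_cell T' hp'
    rw [← h] at h2
    have h3 := K.cell_unique h1 h2
    simp only [Sum.inr.injEq] at h3
    subst h3
    have := (K.face_isEmbedding T).injective (a₁ := ⟨p, hp⟩) (a₂ := ⟨p', hp'⟩) h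
    exact ⟨rfl, congrArg Subtype.val this⟩
  · obtain ⟨i, x, -, hx⟩ := K.exists_edge_eq T' hp'
    rw [h, hx] at h1
    exact absurd h1 (K.edge_notMem_face_cell _ _ _)

/-- The complement of `W` is a finite union of compact images of closed sets, together with finitely
many points. So 0-cells impose no condition. -/
theorem isOpen_of_preimages [T2Space X] {W : Set X} (hF : ∀ T, IsOpen (K.faceMap T ⁻¹' W))
    (hE : ∀ e, IsOpen (K.edgeMap e ⁻¹' W)) : IsOpen W := by
  have : Wᶜ = (⋃ T, K.faceMap T '' (K.faceMap T ⁻¹' W)ᶜ) ∪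
      ((⋃ e, K.edgeMap e '' (K.edgeMap e ⁻¹' W)ᶜ) ∪ (Set.range K.pointMap ∩ Wᶜ)) := by
    ext x
    constructor
    · intro hx
      obtain ⟨c, hc, -⟩ := K.existsUnique_cell x
      rcases c with v | e | T
      · exact .inr (.inr ⟨⟨v, hc.symm⟩, hx⟩)
      · obtain ⟨y, -, rfl⟩ := hc
        exact .inr (.inl (Set.mem_iUnion.2 ⟨e, y, hx, rfl⟩))
      · obtain ⟨y, -, rfl⟩ := hc
        exact .inl (Set.mem_iUnion.2 ⟨T, y, hx, rfl⟩)
    · rintro (h | h | h)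
      · obtain ⟨T, y, hy, rfl⟩ := Set.mem_iUnion.1 h
        exact hy
      · obtain ⟨e, y, hy, rfl⟩ := Set.mem_iUnion.1 h
        exact hy
      · exact h.2
  rw [← isClosed_compl_iff, this]
  refine (isClosed_iUnion_of_finite fun T => ?_).union
    ((isClosed_iUnion_of_finite fun e => ?_).union ?_)
  · exact ((hF T).isClosed_compl.isCompact.image (K.faceMap T).continuous).isClosed
  · exact ((hE e).isClosed_compl.isCompact.image (K.edgeMap e).continuous).isClosed
  · exact ((Set.finite_range _).inter_of_left _).isClosed

/-- Points of open triangles have interior charts. -/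
theorem exists_interior_chart_face [T2Space X] (T : K.F) {p : Triangle}
    (hp : p ∈ Triangle.interior) : ∃ e : OpenPartialHomeomorph X (EuclideanHalfSpace 2),
      K.faceMap T p ∈ e.source ∧ 0 < (e (K.faceMap T p)).1 0 := by
  -- The compact parameter space is the smaller triangle with all coordinates at least `ε`, on which
  -- the characteristic map is injective; two barycentric coordinates serve as `Ψ`.
  obtain ⟨ε, hε, hεp⟩ : ∃ ε > 0, ∀ j, ε < p.1 j := by
    obtain ⟨j, hj⟩ := Finite.exists_min p.1
    exact ⟨p.1 j / 2, half_pos (hp j), fun k => by linarith [hj k, hp j]⟩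
  have hcl : IsClosed {p : Triangle | ∀ j, ε ≤ p.1 j} := by
    simp only [Set.ofPred_forall]
    exact isClosed_iInter fun j => isClosed_le continuous_const (Triangle.continuous_apply j)
  have : CompactSpace {p : Triangle // ∀ j, ε ≤ p.1 j} :=
    isCompact_iff_compactSpace.1 hcl.isCompact
  set U : Set {p : Triangle // ∀ j, ε ≤ p.1 j} := {p | ∀ j, ε < p.1.1 j}
  have c0 := Triangle.continuous_apply 0
  have c1 := Triangle.continuous_apply 1
  refine exists_interior_chart (N := {p : Triangle // ∀ j, ε ≤ p.1 j})
    (q := fun p => K.faceMap T p.1) (Ψ := fun p => (p.1.1 0 : ℂ) + p.1.1 1 * Complex.I) (U := U)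
    (by fun_prop) ?_ ?_ ?_ ?_ (y := ⟨p, fun j => (hεp j).le⟩) hεp
  · have c0' := Complex.continuous_ofReal.comp (c0.comp
      (continuous_subtype_val (p := fun p : Triangle => ∀ j, ε ≤ p.1 j)))
    have c1' := Complex.continuous_ofReal.comp (c1.comp
      (continuous_subtype_val (p := fun p : Triangle => ∀ j, ε ≤ p.1 j)))
    exact c0'.add (c1'.mul continuous_const)
  · rintro ⟨p, hp⟩ ⟨p', hp'⟩
    have hpi : p ∈ Triangle.interior := fun j => hε.trans_le (hp j)
    constructor
    · intro h
      obtain ⟨-, rfl⟩ := K.face_eq_face hpi h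
      rfl
    · intro h
      have h0 := congrArg Complex.re h
      have h1 := congrArg Complex.im h
      simp at h0 h1
      have s0 := Triangle.sum_at 0 p
      have s1 := Triangle.sum_at 0 p'
      simp only [zero_add] at s0 s1
      have : p = p' := Triangle.ext_at 0 h0 h1 (by simp only [zero_add]; linarith)
      subst this
      rfl
  · refine K.isOpen_of_preimages (fun T' => ?_) (fun e => ?_)
    · by_cases hT : T' = T
      · subst hT
        have : K.faceMap T' ⁻¹' ((fun p : {p : Triangle // ∀ j, ε ≤ p.1 j} => K.faceMap T' p.1) '' U) =
            ⋂ j, {p : Triangle | ε < p.1 j} := by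
          ext p
          simp only [Set.mem_preimage, Set.mem_image, Set.mem_iInter]
          constructor
          · rintro ⟨⟨p', hp'⟩, hU, h⟩
            obtain ⟨-, rfl⟩ := K.face_eq_face (fun j => hε.trans_le (hp' j)) h
            exact hU
          · exact fun h => ⟨⟨p, fun j => (h j).le⟩, h, rfl⟩
        rw [this]
        exact isOpen_iInter_of_finite fun j => isOpen_lt continuous_const (Triangle.continuous_apply j)
      · convert isOpen_empty
        rw [Set.eq_empty_iff_forall_notMem]
        rintro p ⟨⟨p', hp'⟩, -, h⟩
        exact hT (K.face_eq_face (fun j => hε.trans_le (hp' j)) h).1.symm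
    · convert isOpen_empty
      rw [Set.eq_empty_iff_forall_notMem]
      rintro x ⟨⟨p', hp'⟩, -, h⟩
      have := K.face_mem_cell T (fun j => hε.trans_le (hp' j))
      rw [show K.faceMap T p' = _ from h] at this
      exact K.edge_notMem_face_cell _ _ _ this
  · have : ((fun p : {p : Triangle // ∀ j, ε ≤ p.1 j} => (p.1.1 0 : ℂ) + p.1.1 1 * Complex.I) '' U) =
        {z : ℂ | ε < z.re} ∩ ({z : ℂ | ε < z.im} ∩ {z : ℂ | ε < 1 - z.re - z.im}) := by
      ext z
      constructor
      · rintro ⟨⟨p, hp⟩, hU, rfl⟩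
        have s0 := Triangle.sum_at 0 p
        have h2 : ε < p.1 2 := hU 2
        simp only [zero_add] at s0
        refine ⟨?_, ?_, ?_⟩
        · simpa using hU 0
        · simpa using hU 1
        · simp
          linarith
      · rintro ⟨h0, h1, h2⟩
        simp only [Set.mem_ofPred_eq] at h0 h1 h2
        have hall : ∀ j, ε < (Triangle.mkAt 0 z.re z.im (1 - z.re - z.im) (by linarith) (by linarith)
            (by linarith) (by ring)).1 j := by
          intro j
          rcases Triangle.fin3_cases 0 j with rfl | rfl | rfl
          · rwa [Triangle.mkAt_zero]
          · rwa [Triangle.mkAt_one]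
          · rwa [Triangle.mkAt_two]
        refine ⟨⟨_, fun j => (hall j).le⟩, hall, ?_⟩
        apply Complex.ext <;> simp [Triangle.mkAt]
    rw [this]
    refine (isOpen_lt continuous_const Complex.continuous_re).inter
      ((isOpen_lt continuous_const Complex.continuous_im).inter
        (isOpen_lt continuous_const ?_))
    exact (continuous_const.sub Complex.continuous_re).sub Complex.continuous_im

end TriangularCellStructure

namespace TriangularCellStructure

variable {X : Type*} [TopologicalSpace X] (K : TriangularCellStructure X)

/-! ### Charts at the points of open edges -/

section EdgeCharts

variable {m : ℕ} {e : K.E} {s : Fin m → K.F × Fin 3} {δ : ℝ}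

/-- Strips along the sides of triangles that run along an edge, parametrized by the position on the
edge and the height. -/
noncomputable def edgeStrips (s : Fin m → K.F × Fin 3) (δ : ℝ)
    (n : Fin m × {x : unitInterval // δ ≤ x ∧ (x : ℝ) ≤ 1 - δ} × unitInterval) : X :=
  K.faceMap (s n.1).1 (Triangle.strip (s n.1).2 ((K.sideHomeo (s n.1).1 (s n.1).2).symm n.2.1.1)
    n.2.2)

theorem continuous_edgeStrips : Continuous (K.edgeStrips s δ) := by
  rw [continuous_prod_of_discrete_left]
  intro k
  have h : Continuous fun z : {x : unitInterval // δ ≤ x ∧ (x : ℝ) ≤ 1 - δ} × unitInterval =>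
      ((K.sideHomeo (s k).1 (s k).2).symm z.1.1, z.2) :=
    ((Homeomorph.continuous _).comp (continuous_subtype_val.comp continuous_fst)).prodMk
      continuous_snd
  exact (K.faceMap (s k).1).continuous.comp ((Triangle.continuous_strip (s k).2).comp h)

theorem mem_Ioo_of_margin (hδ : 0 < δ) {x : unitInterval} (hx : δ ≤ x ∧ (x : ℝ) ≤ 1 - δ) :
    x ∈ Set.Ioo (0 : unitInterval) 1 := by
  constructor
  · have : (0 : ℝ) < x := by linarith [hx.1]
    exact this
  · have : (x : ℝ) < 1 := by linarith [hx.2]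
    exact this

theorem edgeStrips_zero (hs : ∀ k, K.sideEdge (s k).1 (s k).2 = e) (k : Fin m)
    (x : {x : unitInterval // δ ≤ x ∧ (x : ℝ) ≤ 1 - δ}) :
    K.edgeStrips s δ (k, x, 0) = K.edgeMap e x.1 := by
  simp only [edgeStrips, Triangle.strip_zero, faceMap_side, hs, Homeomorph.apply_symm_apply]

/-- A point of positive height lies in an open triangle and so determines its strip. All strips
agree at height zero, because positions are measured on the edge and not on the sides. -/
theorem edgeStrips_eq_iff (hδ : 0 < δ) (hinj : Function.Injective s)
    (hs : ∀ k, K.sideEdge (s k).1 (s k).2 = e)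
    (n n' : Fin m × {x : unitInterval // δ ≤ x ∧ (x : ℝ) ≤ 1 - δ} × unitInterval) :
    K.edgeStrips s δ n = K.edgeStrips s δ n' ↔ n.2 = n'.2 ∧ (n.2.2 = 0 ∨ n.1 = n'.1) := by
  have key : ∀ n n' : Fin m × {x : unitInterval // δ ≤ x ∧ (x : ℝ) ≤ 1 - δ} × unitInterval,
      0 < n.2.2 → K.edgeStrips s δ n = K.edgeStrips s δ n' → n = n' := by
    rintro ⟨k, x, y⟩ ⟨k', x', y'⟩ hy h
    have h1 := (unitInterval.homeomorph_mem_Ioo (K.sideHomeo (s k).1 (s k).2).symm).2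
      (mem_Ioo_of_margin hδ x.2)
    have h1' := (unitInterval.homeomorph_mem_Ioo (K.sideHomeo (s k').1 (s k').2).symm).2
      (mem_Ioo_of_margin hδ x'.2)
    obtain ⟨hT, hp⟩ := K.face_eq_face (Triangle.strip_mem_interior _ h1 hy) h
    obtain ⟨hi, hx, hy⟩ := Triangle.strip_inj h1 h1' hp
    have hk : k = k' := hinj (Prod.ext hT hi)
    subst hk
    have hxx : x = x' := Subtype.ext ((K.sideHomeo (s k).1 (s k).2).symm.injective hx)
    have hyy : y = y' := hy
    rw [hxx, hyy]
  constructor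
  · intro h
    rcases eq_or_ne n.2.2 0 with h0 | h0
    · rcases eq_or_ne n'.2.2 0 with h0' | h0'
      · obtain ⟨k, x, y⟩ := n
        obtain ⟨k', x', y'⟩ := n'
        simp only at h0 h0'
        subst h0 h0'
        rw [K.edgeStrips_zero hs, K.edgeStrips_zero hs] at h
        have := (K.edge_eq_edge (mem_Ioo_of_margin hδ x.2) h).2
        exact ⟨by rw [Subtype.ext this], .inl rfl⟩
      · have := key n' n (unitInterval.pos_iff_ne_zero.2 h0') h.symm
        exact ⟨by rw [this], .inr (by rw [this])⟩
    · have := key n n' (unitInterval.pos_iff_ne_zero.2 h0) h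
      exact ⟨by rw [this], .inr (by rw [this])⟩
  · rintro ⟨h, h0 | h0⟩
    · obtain ⟨k, x, y⟩ := n
      obtain ⟨k', x', y'⟩ := n'
      simp only at h h0
      subst h0
      rw [← h, K.edgeStrips_zero hs, K.edgeStrips_zero hs]
    · rw [Prod.ext h0 h]

/-- The open part of the parameter space of `edgeStrips`. -/
def openStrips (m : ℕ) (δ : ℝ) :
    Set (Fin m × {x : unitInterval // δ ≤ x ∧ (x : ℝ) ≤ 1 - δ} × unitInterval) :=
  {n | δ < n.2.1.1 ∧ (n.2.1.1 : ℝ) < 1 - δ ∧ n.2.2 < 1}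

/-- The family `s` lists all sides running along `e`, so the preimage in each triangle is the union
of the open strips along such sides. At least one side is needed to reach the points of `e` itself.
-/
theorem isOpen_edgeStrips_image [T2Space X] (hδ : 0 < δ)
    (hs : ∀ T i, K.sideEdge T i = e ↔ ∃ k, s k = (T, i)) [NeZero m] :
    IsOpen (K.edgeStrips s δ '' openStrips m δ) := by
  have hs' : ∀ k, K.sideEdge (s k).1 (s k).2 = e := fun k => (hs _ _).2 ⟨k, rfl⟩
  refine K.isOpen_of_preimages (fun T => ?_) (fun e' => ?_)
  · have : K.faceMap T ⁻¹' (K.edgeStrips s δ '' openStrips m δ) =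
        ⋃ i ∈ {i | K.sideEdge T i = e}, {p | p.1 i < Triangle.stripHeight (Triangle.sideCoord i p)} ∩
          {p | δ < K.sideHomeo T i (Triangle.sideCoord i p) ∧
            (K.sideHomeo T i (Triangle.sideCoord i p) : ℝ) < 1 - δ} := by
      ext p
      simp only [Set.mem_iUnion, Set.mem_preimage]
      constructor
      · rintro ⟨⟨k, x, y⟩, ⟨hx0, hx1, hy⟩, h⟩
        simp only at hx0 hx1 hy
        have hx := mem_Ioo_of_margin hδ x.2
        have h1 := (unitInterval.homeomorph_mem_Ioo (K.sideHomeo (s k).1 (s k).2).symm).2 hx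
        have hw := Triangle.stripHeight_pos h1
        rcases eq_or_ne y 0 with rfl | hy0
        · rw [K.edgeStrips_zero hs'] at h
          obtain ⟨i, x', rfl, he, hi⟩ := K.face_eq_edge hx h.symm
          refine ⟨i, he, ?_, ?_⟩
          · have h2 : x' ∈ Set.Ioo (0 : unitInterval) 1 := by
              rw [← unitInterval.homeomorph_mem_Ioo (K.sideHomeo T i), hi]
              exact hx
            simpa using Triangle.stripHeight_pos h2
          · simpa [hi] using ⟨hx0, hx1⟩
        · have hy0' := unitInterval.pos_iff_ne_zero.2 hy0
          obtain ⟨hT, rfl⟩ := K.face_eq_face (Triangle.strip_mem_interior _ h1 hy0') h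
          subst hT
          refine ⟨(s k).2, hs' k, ?_, ?_⟩
          · simp only [Set.mem_ofPred_eq, Triangle.sideCoord_strip, Triangle.strip_apply]
            exact mul_lt_of_lt_one_left hw hy
          · simpa using ⟨hx0, hx1⟩
      · rintro ⟨i, hi, hp, h0, h1⟩
        obtain ⟨y, hy, hpy⟩ := Triangle.exists_eq_strip hp
        obtain ⟨k, hk⟩ := (hs T i).1 hi
        refine ⟨(k, ⟨K.sideHomeo T i (Triangle.sideCoord i p), h0.le, h1.le⟩, y), ⟨h0, h1, hy⟩, ?_⟩
        simp only [edgeStrips, hk, Homeomorph.symm_apply_apply]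
        rw [← hpy]
    rw [this]
    refine isOpen_biUnion fun i _ => IsOpen.inter ?_ ?_
    · exact isOpen_lt (Triangle.continuous_apply i)
        (Triangle.continuous_stripHeight.comp (Triangle.continuous_sideCoord i))
    · have hc : Continuous fun p => (K.sideHomeo T i (Triangle.sideCoord i p) : ℝ) :=
        continuous_subtype_val.comp ((K.sideHomeo T i).continuous.comp
          (Triangle.continuous_sideCoord i))
      exact (isOpen_lt continuous_const hc).inter (isOpen_lt hc continuous_const)
  · by_cases he : e' = e
    · subst he
      have : K.edgeMap e' ⁻¹' (K.edgeStrips s δ '' openStrips m δ) =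
          {x : unitInterval | δ < (x : ℝ)} ∩ {x : unitInterval | (x : ℝ) < 1 - δ} := by
        ext x
        constructor
        · rintro ⟨⟨k, x', y⟩, ⟨hx0, hx1, hy⟩, h⟩
          have hx := mem_Ioo_of_margin hδ x'.2
          obtain ⟨i, x'', hp, he, hi⟩ := K.face_eq_edge (T := (s k).1) (u := x) (e := e')
            (p := _) (by
              by_contra hn
              obtain ⟨v, hv⟩ := K.edge_mem_vertex_cell e' hn
              rw [← h] at hv
              rcases eq_or_ne y 0 with rfl | hy0
              · rw [K.edgeStrips_zero hs'] at hv
                simpa using K.cell_unique hv (K.edge_mem_cell e' hx)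
              · have h1 := (unitInterval.homeomorph_mem_Ioo
                  (K.sideHomeo (s k).1 (s k).2).symm).2 hx
                simpa using K.cell_unique hv (K.face_mem_cell _ (Triangle.strip_mem_interior _ h1
                  (unitInterval.pos_iff_ne_zero.2 hy0)))) h
          have hy0 : y = 0 := by
            by_contra hy0
            have h1 := (unitInterval.homeomorph_mem_Ioo (K.sideHomeo (s k).1 (s k).2).symm).2 hx
            have := Triangle.strip_mem_interior (s k).2 h1 (unitInterval.pos_iff_ne_zero.2 hy0)
            rw [hp] at this
            exact Triangle.side_notMem_interior _ _ this
          subst hy0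
          rw [K.edgeStrips_zero hs'] at h
          obtain ⟨-, rfl⟩ := K.edge_eq_edge hx h
          exact ⟨hx0, hx1⟩
        · rintro ⟨h0, h1⟩
          simp only [Set.mem_ofPred_eq] at h0 h1
          exact ⟨(0, ⟨x, h0.le, h1.le⟩, 0), ⟨h0, h1, zero_lt_one⟩, K.edgeStrips_zero hs' _ _⟩
      rw [this]
      exact (isOpen_lt continuous_const continuous_subtype_val).inter
        (isOpen_lt continuous_subtype_val continuous_const)
    · convert isOpen_empty
      rw [Set.eq_empty_iff_forall_notMem]
      rintro x ⟨⟨k, x', y⟩, -, h⟩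
      have hx := mem_Ioo_of_margin hδ x'.2
      rcases eq_or_ne y 0 with rfl | hy0
      · rw [K.edgeStrips_zero hs'] at h
        exact he (K.edge_eq_edge hx h).1.symm
      · have h1 := (unitInterval.homeomorph_mem_Ioo (K.sideHomeo (s k).1 (s k).2).symm).2 hx
        have := K.face_mem_cell (s k).1 (Triangle.strip_mem_interior (s k).2 h1
          (unitInterval.pos_iff_ne_zero.2 hy0))
        rw [show K.faceMap (s k).1 _ = _ from h] at this
        exact K.edge_notMem_face_cell _ _ _ this

theorem compactSpace_margin (δ : ℝ) :
    CompactSpace {x : unitInterval // δ ≤ x ∧ (x : ℝ) ≤ 1 - δ} :=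
  isCompact_iff_compactSpace.1 (IsClosed.isCompact
    ((isClosed_le continuous_const continuous_subtype_val).inter
      (isClosed_le continuous_subtype_val continuous_const)))

theorem exists_margin {x : unitInterval} (hx : x ∈ Set.Ioo (0 : unitInterval) 1) :
    ∃ δ : ℝ, 0 < δ ∧ δ < x ∧ (x : ℝ) < 1 - δ := by
  have h0 : (0 : ℝ) < x := hx.1
  have h1 : (0 : ℝ) < 1 - x := sub_pos.2 hx.2
  obtain ⟨δ, hδ, h⟩ := exists_between (lt_min h0 h1)
  exact ⟨δ, hδ, (lt_min_iff.1 h).1, by linarith [(lt_min_iff.1 h).2]⟩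

/-- Points of an open edge with exactly two adjacent sides have interior charts. -/
theorem exists_interior_chart_edge [T2Space X] {s₀ s₁ : K.F × Fin 3} (hne : s₀ ≠ s₁)
    (hs : ∀ T i, K.sideEdge T i = e ↔ (T, i) = s₀ ∨ (T, i) = s₁) {x : unitInterval}
    (hx : x ∈ Set.Ioo (0 : unitInterval) 1) : ∃ φ : OpenPartialHomeomorph X (EuclideanHalfSpace 2),
      K.edgeMap e x ∈ φ.source ∧ 0 < (φ (K.edgeMap e x)).1 0 := by
  obtain ⟨δ, hδ, h0, h1⟩ := exists_margin hx
  have := compactSpace_margin δ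
  set s : Fin 2 → K.F × Fin 3 := ![s₀, s₁] with hsdef
  have hs1 : ∀ T i, K.sideEdge T i = e ↔ ∃ k, s k = (T, i) := fun T i => by
    rw [hs, Fin.exists_fin_two]
    simp [hsdef, eq_comm]
  have hs2 : ∀ k, K.sideEdge (s k).1 (s k).2 = e := fun k => (hs1 _ _).2 ⟨k, rfl⟩
  have hinj : Function.Injective s := by
    intro k k' h
    fin_cases k <;> fin_cases k' <;> simp [hsdef, hne, hne.symm] at h ⊢
  rw [← K.edgeStrips_zero hs2 0 ⟨x, h0.le, h1.le⟩]
  -- One strip goes above the real axis and the other below. The two sides may belong to the same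
  -- triangle, as in the self-folded case.
  refine exists_interior_chart
    (Ψ := fun n => ((n.2.1.1 : ℝ) : ℂ) + ((![1, -1] : Fin 2 → ℝ) n.1 * (n.2.2 : ℝ) : ℝ) * Complex.I)
    (U := openStrips 2 δ) K.continuous_edgeStrips ?_ ?_ (K.isOpen_edgeStrips_image hδ hs1) ?_
    ⟨h0, h1, zero_lt_one⟩
  · rw [continuous_prod_of_discrete_left]
    intro k
    fun_prop
  · intro n n'
    rw [K.edgeStrips_eq_iff hδ hinj hs2]
    obtain ⟨k, x, y⟩ := n
    obtain ⟨k', x', y'⟩ := n'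
    have hy : (0 : ℝ) ≤ y := y.2.1
    have hy' : (0 : ℝ) ≤ y' := y'.2.1
    simp only [Complex.ext_iff, Complex.add_re, Complex.add_im, Complex.ofReal_re,
      Complex.ofReal_im, Complex.re_ofReal_mul, Complex.im_ofReal_mul, Complex.I_re, Complex.I_im,
      mul_zero, add_zero, zero_add, mul_one, Prod.mk.injEq, Subtype.ext_iff]
    have e0 : ((0 : unitInterval) : ℝ) = 0 := rfl
    rw [e0, and_assoc]
    refine and_congr_right fun _ => ?_
    generalize (y : ℝ) = a at *
    generalize (y' : ℝ) = a' at *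
    fin_cases k <;> fin_cases k' <;> simp
    · constructor
      · rintro ⟨h, h'⟩; linarith
      · intro h; constructor <;> linarith
    · constructor
      · rintro ⟨h, h'⟩; linarith
      · intro h; constructor <;> linarith
  · have : (fun n : Fin 2 × {x : unitInterval // δ ≤ x ∧ (x : ℝ) ≤ 1 - δ} × unitInterval =>
        ((n.2.1.1 : ℝ) : ℂ) + ((![1, -1] : Fin 2 → ℝ) n.1 * (n.2.2 : ℝ) : ℝ) * Complex.I) ''
          openStrips 2 δ =
        ({z | δ < z.re} ∩ {z | z.re < 1 - δ}) ∩ ({z | -1 < z.im} ∩ {z | z.im < 1}) := by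
      ext z
      constructor
      · rintro ⟨⟨k, x, y⟩, ⟨h0, h1, hy⟩, rfl⟩
        have hy0 : (0 : ℝ) ≤ y := y.2.1
        have hy1 : (y : ℝ) < 1 := hy
        refine ⟨⟨by simpa using h0, by simpa using h1⟩, ?_⟩
        simp only [Set.mem_inter_iff, Set.mem_ofPred_eq, Complex.add_im, Complex.ofReal_im,
          Complex.im_ofReal_mul, Complex.I_im, mul_one, zero_add]
        generalize (y : ℝ) = a at *
        fin_cases k <;> constructor <;> simp <;> linarith
      · rintro ⟨⟨h0, h1⟩, h2, h3⟩
        simp only [Set.mem_ofPred_eq] at h0 h1 h2 h3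
        have hx : δ ≤ (⟨z.re, by linarith, by linarith⟩ : unitInterval) ∧
            ((⟨z.re, by linarith, by linarith⟩ : unitInterval) : ℝ) ≤ 1 - δ := ⟨h0.le, h1.le⟩
        rcases le_total 0 z.im with hz | hz
        · refine ⟨(0, ⟨_, hx⟩, ⟨z.im, hz, h3.le⟩), ⟨h0, h1, h3⟩, ?_⟩
          apply Complex.ext <;> simp
        · refine ⟨(1, ⟨_, hx⟩, ⟨-z.im, by linarith, by linarith⟩), ⟨h0, h1, ?_⟩, ?_⟩
          · change -z.im < 1
            linarith
          · apply Complex.ext <;> simp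
    rw [this]
    exact ((isOpen_lt continuous_const Complex.continuous_re).inter
      (isOpen_lt Complex.continuous_re continuous_const)).inter
      ((isOpen_lt continuous_const Complex.continuous_im).inter
      (isOpen_lt Complex.continuous_im continuous_const))

/-- Points of an open edge with exactly one adjacent side have boundary charts. -/
theorem exists_boundary_chart_edge [T2Space X] {s₀ : K.F × Fin 3}
    (hs : ∀ T i, K.sideEdge T i = e ↔ (T, i) = s₀) {x : unitInterval}
    (hx : x ∈ Set.Ioo (0 : unitInterval) 1) : ∃ φ : OpenPartialHomeomorph X (EuclideanHalfSpace 2),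
      K.edgeMap e x ∈ φ.source ∧ (φ (K.edgeMap e x)).1 0 = 0 := by
  obtain ⟨δ, hδ, h0, h1⟩ := exists_margin hx
  have := compactSpace_margin δ
  set s : Fin 1 → K.F × Fin 3 := fun _ => s₀ with hsdef
  have hs1 : ∀ T i, K.sideEdge T i = e ↔ ∃ k, s k = (T, i) := fun T i => by
    rw [hs]
    simp [hsdef, eq_comm]
  have hs2 : ∀ k, K.sideEdge (s k).1 (s k).2 = e := fun k => (hs1 _ _).2 ⟨k, rfl⟩
  have hinj : Function.Injective s := fun _ _ _ => Subsingleton.elim _ _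
  rw [← K.edgeStrips_zero hs2 0 ⟨x, h0.le, h1.le⟩]
  refine (exists_halfPlane_chart (q := K.edgeStrips s δ)
    (Ψ := fun n => ((n.2.1.1 : ℝ) : ℂ) + ((n.2.2 : ℝ) : ℂ) * Complex.I)
    (U := openStrips 1 δ) (O := ({z | δ < z.re} ∩ {z | z.re < 1 - δ}) ∩ {z | z.im < 1})
    (y := (0, ⟨x, h0.le, h1.le⟩, 0))
    K.continuous_edgeStrips (by fun_prop) (fun n => by simpa using n.2.2.2.1) ?_
    (K.isOpen_edgeStrips_image hδ hs1)
    (((isOpen_lt continuous_const Complex.continuous_re).inter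
      (isOpen_lt Complex.continuous_re continuous_const)).inter
      (isOpen_lt Complex.continuous_im continuous_const)) ?_
    ⟨h0, h1, zero_lt_one⟩).imp fun φ hφ => ⟨hφ.1, by simpa using hφ.2⟩
  · intro n n'
    rw [K.edgeStrips_eq_iff hδ hinj hs2]
    obtain ⟨k, x, y⟩ := n
    obtain ⟨k', x', y'⟩ := n'
    obtain rfl := Subsingleton.elim k k'
    simp only [Complex.ext_iff, Complex.add_re, Complex.add_im, Complex.ofReal_re,
      Complex.ofReal_im, Complex.re_ofReal_mul, Complex.im_ofReal_mul, Complex.I_re, Complex.I_im,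
      mul_zero, add_zero, zero_add, mul_one, Prod.mk.injEq, Subtype.ext_iff, or_true, and_true]
  · ext z
    constructor
    · rintro ⟨⟨k, x, y⟩, ⟨h0, h1, hy⟩, rfl⟩
      have hy0 : (0 : ℝ) ≤ y := y.2.1
      have hy1 : (y : ℝ) < 1 := hy
      exact ⟨⟨⟨by simpa using h0, by simpa using h1⟩, by simpa using hy1⟩, by simpa using hy0⟩
    · rintro ⟨⟨⟨h0, h1⟩, h2⟩, h3⟩
      simp only [Set.mem_ofPred_eq] at h0 h1 h2 h3
      refine ⟨(0, ⟨⟨z.re, by linarith, by linarith⟩, h0.le, h1.le⟩, ⟨z.im, h3, h2.le⟩),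
        ⟨h0, h1, h2⟩, ?_⟩
      apply Complex.ext <;> simp

end EdgeCharts

end TriangularCellStructure

/-! ### The boundary of a directed triangulated surface and the fixed loops -/

theorem Surface.mem_boundary_iff (S : Surface.{w}) (x : S.carrier) :
    x ∈ S.boundary ↔ (chartAt (EuclideanHalfSpace 2) x x).1 0 = 0 := by
  change extChartAt (𝓡∂ 2) x x ∈ frontier (Set.range (𝓡∂ 2)) ↔ _
  rw [frontier_range_modelWithCornersEuclideanHalfSpace]
  simp [eq_comm]

/-- The boundary is defined by the preferred chart at `x`; by invariance, an interior chart that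
need not belong to the atlas decides as well. -/
theorem Surface.notMem_boundary (S : Surface.{w}) {x : S.carrier}
    (h : ∃ φ : OpenPartialHomeomorph S.carrier (EuclideanHalfSpace 2),
      x ∈ φ.source ∧ 0 < (φ x).1 0) : x ∉ S.boundary := fun hx => by
  obtain ⟨φ, h1, h2⟩ := h
  exact halfPlane_boundary_invariance _ φ (mem_chart_source _ x) h1 ((S.mem_boundary_iff x).1 hx) h2

open EuclideanHalfSpace in
/-- Near a boundary point there are boundary points outside of any given finite set. -/
theorem exists_boundary_point_notMem {X : Type*} [TopologicalSpace X]
    (e : OpenPartialHomeomorph X (EuclideanHalfSpace 2)) {x : X} (hx : x ∈ e.source)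
    (h : (e x).1 0 = 0) {s : Set X} (hs : s.Finite) :
    ∃ y ∈ e.source, (e y).1 0 = 0 ∧ y ∉ s := by
  -- Real translations move `e x` along the boundary line of the half plane and give infinitely many
  -- boundary points.
  have hopen : IsOpen {t : ℝ | ofComplex ((e x).toComplex + t) ∈ e.target} :=
    e.open_target.preimage (continuous_ofComplex.comp (by fun_prop))
  have h0 : (0 : ℝ) ∈ {t : ℝ | ofComplex ((e x).toComplex + t) ∈ e.target} := by
    simpa using e.map_source hx
  have hinf : {t : ℝ | ofComplex ((e x).toComplex + t) ∈ e.target}.Infinite :=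
    infinite_of_mem_nhds 0 (hopen.mem_nhds h0)
  have hc : ∀ t : ℝ, (ofComplex ((e x).toComplex + t)).toComplex = (e x).toComplex + t := fun t =>
    toComplex_ofComplex (by simp [h])
  have hinj : Set.InjOn (fun t : ℝ => e.symm (ofComplex ((e x).toComplex + t)))
      {t : ℝ | ofComplex ((e x).toComplex + t) ∈ e.target} := by
    intro t ht t' ht' htt
    have h1 := congrArg toComplex (e.symm.injOn ht ht' htt)
    rw [hc, hc] at h1
    simpa using h1
  obtain ⟨_, ⟨t, ht, rfl⟩, hns⟩ := (hinf.image hinj).exists_notMem_finite hs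
  refine ⟨_, e.map_target ht, ?_, hns⟩
  rw [e.right_inv ht, ← im_toComplex, hc]
  simp [h]

namespace DirectedTriangulatedSurface

/-- No chart is constructed at the 0-cells: a boundary point `x` yields a boundary point `y` of the
same chart on an open edge or in an open triangle, where an interior chart is available. -/
theorem boundary_eq_empty (D : DirectedTriangulatedSurface.{w})
    (h : ∀ e, ∃ s₀ s₁, s₀ ≠ s₁ ∧
      ∀ T i, D.cells.sideEdge T i = e ↔ (T, i) = s₀ ∨ (T, i) = s₁) : D.boundary = ∅ := by
  rw [Set.eq_empty_iff_forall_notMem]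
  intro x hx
  obtain ⟨y, hy, hy0, hyv⟩ := exists_boundary_point_notMem _ (mem_chart_source _ x)
    ((D.surface.mem_boundary_iff x).1 hx) (Set.finite_range D.cells.pointMap)
  obtain ⟨φ, h1, h2⟩ : ∃ φ : OpenPartialHomeomorph D.surface.carrier (EuclideanHalfSpace 2),
      y ∈ φ.source ∧ 0 < (φ y).1 0 := by
    obtain ⟨c, hc, -⟩ := D.cells.existsUnique_cell y
    rcases c with v | e | T
    · exact absurd ⟨v, hc.symm⟩ hyv
    · obtain ⟨u, hu, rfl⟩ := hc
      obtain ⟨s₀, s₁, hne, hs⟩ := h e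
      exact D.cells.exists_interior_chart_edge hne hs hu
    · obtain ⟨p, hp, rfl⟩ := hc
      exact D.cells.exists_interior_chart_face T hp
  exact halfPlane_boundary_invariance _ φ hy h1 hy0 h2

/-- If every edge is the source of exactly two arrows, and if the surface has a boundary point,
then some edge is a boundary edge. -/
theorem exists_isBoundaryEdge (D : DirectedTriangulatedSurface.{w})
    (h : ∀ e, {α : D.quiver.A | D.quiver.s α = e}.ncard = 2) (hb : D.boundary.Nonempty) :
    ∃ e, D.IsBoundaryEdge e := by
  by_contra! hno
  -- Without boundary edges, the two arrows starting at `e` both come from sides of triangles, and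
  -- these are the two sides along `e`.
  refine hb.ne_empty (D.boundary_eq_empty fun e => ?_)
  obtain ⟨a, b, hab, hset⟩ := Set.ncard_eq_two.1 (h e)
  have hmem : ∀ α : D.quiver.A, D.quiver.s α = e ↔ α = a ∨ α = b := fun α => by
    have : α ∈ {α : D.quiver.A | D.quiver.s α = e} ↔ α ∈ ({a, b} : Set _) := by rw [hset]
    simpa using this
  rcases a with s₀ | e₀
  · rcases b with s₁ | e₁
    · refine ⟨s₀, s₁, fun h => hab (by rw [h]), fun T i => ?_⟩
      have := hmem (.inl (T, i))
      simpa [quiver] using this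
    · exact absurd e₁.2 (hno _)
  · exact absurd e₀.2 (hno _)

/-- A 3-cycle on three sides has full support, so no arrow of a triangle is fixed. -/
theorem hasFixedLoop_quiver_iff (D : DirectedTriangulatedSurface.{w}) :
    D.quiver.HasFixedLoop ↔ ∃ e, D.IsBoundaryEdge e := by
  constructor
  · rintro ⟨α | e, -, hα⟩
    · obtain ⟨T, i⟩ := α
      have h1 : (T, D.next T i) = (T, i) := Sum.inl_injective hα
      have h2 : i ∉ (D.next T).support := by simpa using h1
      have h3 := (Finset.card_eq_iff_eq_univ _).1
        ((D.next_isThreeCycle T).card_support.trans (Fintype.card_fin 3).symm)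
      exact absurd (h3 ▸ Finset.mem_univ i) h2
    · exact ⟨e.1, e.2⟩
  · rintro ⟨e, he⟩
    exact ⟨.inr ⟨e, he⟩, rfl, rfl⟩

end DirectedTriangulatedSurface

/-! ### Transport of fixed loops along isomorphisms -/

namespace QuiverPerm.Iso

variable {Q : QuiverPerm.{u, v}} {Q' : QuiverPerm.{u', v'}}

theorem hasFixedLoop_iff (φ : Q.Iso Q') : Q.HasFixedLoop ↔ Q'.HasFixedLoop := by
  constructor
  · rintro ⟨α, h1, h2⟩
    exact ⟨φ.onA α, by rw [← φ.map_s, ← φ.map_t, h1], by rw [← φ.map_f, h2]⟩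
  · rintro ⟨α, h1, h2⟩
    obtain ⟨α, rfl⟩ := φ.onA.surjective α
    exact ⟨α, φ.onV.injective (by rw [φ.map_s, φ.map_t, h1]), φ.onA.injective (by rw [φ.map_f, h2])⟩

theorem ncard_outgoing (φ : Q.Iso Q') (v : Q.V) :
    {α : Q'.A | Q'.s α = φ.onV v}.ncard = {α : Q.A | Q.s α = v}.ncard := by
  rw [← Set.ncard_image_of_injective _ φ.onA.injective]
  congr 1
  ext α
  obtain ⟨α, rfl⟩ := φ.onA.surjective α
  simp [← φ.map_s]

/-- An isomorphism `Q ≅ Q(S, T⃗)` identifies fixed loops with boundary edges. -/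
theorem hasFixedLoop_iff_boundary_nonempty (hQ : Q.IsTriangulationQuiver)
    {D : DirectedTriangulatedSurface.{w}} (φ : Q.Iso D.quiver) :
    Q.HasFixedLoop ↔ D.boundary.Nonempty := by
  rw [φ.hasFixedLoop_iff, D.hasFixedLoop_quiver_iff]
  constructor
  · rintro ⟨e, he⟩
    exact ⟨_, he ⟨0, rfl⟩⟩
  · intro hb
    refine D.exists_isBoundaryEdge (fun e => ?_) hb
    obtain ⟨v, rfl⟩ := φ.onV.surjective e
    rw [φ.ncard_outgoing, hQ.two_outgoing]

end QuiverPerm.Iso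

/-! ### Gluing triangles along their sides -/

theorem Triangle.continuous_side (i : Fin 3) : Continuous (Triangle.side i) := by
  have : Triangle.side i = fun x => Triangle.strip i x 0 :=
    funext fun x => (Triangle.strip_zero i x).symm
  rw [this]
  exact (Triangle.continuous_strip i).comp (continuous_id.prodMk continuous_const)

/-- Data for gluing triangles: finite sets of triangles and of edges, an edge for each side of each
triangle, and an involution of the sides whose orbits are the sets of sides with the same edge. Sides
fixed by the involution are not glued. -/
structure TriangleGluing where
  /-- the triangles -/
  F : Type
  /-- the edges -/
  E : Type
  [finite_F : Finite F]
  [nonempty_F : Nonempty F]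
  /-- the edge of a side -/
  edge : F × Fin 3 → E
  edge_surjective : Function.Surjective edge
  /-- the side to which a side is glued -/
  bar : F × Fin 3 → F × Fin 3
  bar_bar : ∀ s, bar (bar s) = s
  edge_eq_iff : ∀ s s', edge s = edge s' ↔ s' = s ∨ s' = bar s
  connected : ∀ e e', Relation.EqvGen (fun a b => ∃ T i j, edge (T, i) = a ∧ edge (T, j) = b) e e'

/-- A continuous map from a compact space to a Hausdorff space is an embedding on a set on which
it is injective and which is saturated. -/
theorem isEmbedding_of_saturated {Y X : Type*} [TopologicalSpace Y] [CompactSpace Y]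
    [TopologicalSpace X] [T2Space X] {f : Y → X} (hf : Continuous f) {A : Set Y}
    (hA : ∀ a ∈ A, ∀ y, f a = f y → a = y) : Topology.IsEmbedding fun a : A => f a := by
  refine ⟨?_, fun a b h => Subtype.ext (hA a a.2 b h)⟩
  rw [Topology.isInducing_iff]
  refine le_antisymm (continuous_iff_le_induced.1 (hf.comp continuous_subtype_val)) ?_
  intro U hU
  obtain ⟨O, hO, rfl⟩ := isOpen_induced_iff.1 hU
  -- The compact image of `Oᶜ` is closed; by saturation its complement cuts out the same part of `A`
  -- as `O`.
  refine isOpen_induced_iff.2 ⟨(f '' Oᶜ)ᶜ, (hO.isClosed_compl.isCompact.image hf).isClosed.isOpen_compl,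
    ?_⟩
  ext a
  simp only [Set.mem_preimage, Set.mem_compl_iff, Set.mem_image, not_exists, not_and]
  constructor
  · intro h
    by_contra ha
    exact h a ha rfl
  · intro ha y hy hya
    rw [← hA a a.2 y hya.symm] at hy
    exact hy ha

namespace TriangleGluing

variable (G : TriangleGluing)

instance : Finite G.F := G.finite_F
instance : Nonempty G.F := G.nonempty_F
instance : Finite G.E := Finite.of_surjective _ G.edge_surjective

/-- The side crossed when leaving a corner in the positive direction. -/
def exit (c : G.F × Fin 3) : G.F × Fin 3 := (c.1, c.2 + 2)

/-- The next corner in the positive direction around a vertex. -/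
def rot (c : G.F × Fin 3) : G.F × Fin 3 := ((G.bar (G.exit c)).1, (G.bar (G.exit c)).2 + 2)

/-- The vertices: classes of corners under crossing glued sides. -/
def Vertex : Type := Quot fun c c' => G.bar (G.exit c) ≠ G.exit c ∧ c' = G.rot c

/-- The vertex of a corner. -/
def vertex (c : G.F × Fin 3) : G.Vertex := Quot.mk _ c

theorem vertex_surjective : Function.Surjective G.vertex := Quot.mk_surjective

instance : Finite G.Vertex := Finite.of_surjective _ G.vertex_surjective

theorem vertex_rot {c : G.F × Fin 3} (h : G.bar (G.exit c) ≠ G.exit c) :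
    G.vertex (G.rot c) = G.vertex c := (Quot.sound ⟨h, rfl⟩).symm

theorem add_one_two (i : Fin 3) : i + 1 + 2 = i := by revert i; decide
theorem add_two_one (i : Fin 3) : i + 2 + 1 = i := by revert i; decide
theorem add_one_one (i : Fin 3) : i + 1 + 1 = i + 2 := by revert i; decide
theorem add_two_two (i : Fin 3) : i + 2 + 2 = i + 1 := by revert i; decide

/-- Side `i` runs from the corner `i + 1` to the corner `i + 2`. Gluing reverses the direction, so
the start of a side meets the end of its partner. -/
theorem vertex_glue {s : G.F × Fin 3} (h : G.bar s ≠ s) :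
    G.vertex (s.1, s.2 + 1) = G.vertex ((G.bar s).1, (G.bar s).2 + 2) := by
  have he : G.exit (s.1, s.2 + 1) = s := Prod.ext rfl (add_one_two s.2)
  have := G.vertex_rot (c := (s.1, s.2 + 1)) (by rwa [he])
  rw [← this, rot, he]

theorem vertex_glue' {s : G.F × Fin 3} (h : G.bar s ≠ s) :
    G.vertex (s.1, s.2 + 2) = G.vertex ((G.bar s).1, (G.bar s).2 + 1) := by
  have := G.vertex_glue (s := G.bar s) (by rw [G.bar_bar]; exact h.symm)
  rw [G.bar_bar] at this
  exact this.symm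

/-- The preferred side of an edge. -/
noncomputable def mainSide (e : G.E) : G.F × Fin 3 := (G.edge_surjective e).choose

@[simp] theorem edge_mainSide (e : G.E) : G.edge (G.mainSide e) = e :=
  (G.edge_surjective e).choose_spec

/-- The coordinate space in which the glued space is realized. -/
abbrev Ambient : Type := (G.Vertex → ℝ) × (G.E × Bool → ℝ) × (G.F × Fin 3 → ℝ)

open Classical in
/-- The realization of a point of a triangle. -/
noncomputable def point (T : G.F) (p : Triangle) : G.Ambient :=
  -- The vertex coordinates live near corners; on the sides, the edge coordinates see only the
  -- carrying edge, and the face coordinates vanish. The two coordinates of an edge weigh its ends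
  -- differently and so fix the position; they are exchanged for a side other than `mainSide`, which
  -- runs backwards.
  (fun v => ∑ j, if G.vertex (T, j) = v then max (p.1 j - 1 / 2) 0 else 0,
   fun e => ∑ i, if G.edge (T, i) = e.1 then p.1 (i + 1) * p.1 (i + 2) *
     (if decide ((T, i) = G.mainSide e.1) = e.2 then p.1 (i + 1) else p.1 (i + 2)) else 0,
   fun s => if s.1 = T then p.1 0 * p.1 1 * p.1 2 * p.1 s.2 else 0)

theorem continuous_point (T : G.F) : Continuous (G.point T) := by
  have h := Triangle.continuous_apply
  refine (continuous_pi fun v => continuous_finsetSum _ fun j _ => ?_).prodMk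
    ((continuous_pi fun e => continuous_finsetSum _ fun i _ => ?_).prodMk
    (continuous_pi fun s => ?_))
  · split_ifs
    · exact ((h j).sub continuous_const).max continuous_const
    · exact continuous_const
  · split_ifs
    · exact ((h _).mul (h _)).mul (h _)
    · exact ((h _).mul (h _)).mul (h _)
    · exact continuous_const
  · split_ifs
    · exact (((h 0).mul (h 1)).mul (h 2)).mul (h _)
    · exact continuous_const

/-- The space obtained by gluing the triangles. -/
def Space : Type := {x : G.Ambient // ∃ T p, G.point T p = x}

instance : TopologicalSpace G.Space :=
  inferInstanceAs (TopologicalSpace {x : G.Ambient // ∃ T p, G.point T p = x})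

instance : T2Space G.Space := inferInstanceAs (T2Space {x : G.Ambient // ∃ T p, G.point T p = x})

/-- The characteristic map of a triangle. -/
noncomputable def faceMap (T : G.F) : C(Triangle, G.Space) :=
  ⟨fun p => ⟨G.point T p, T, p, rfl⟩, (G.continuous_point T).subtype_mk _⟩

/-- The characteristic map of an edge. -/
noncomputable def edgeMap (e : G.E) : C(unitInterval, G.Space) :=
  ⟨fun x => G.faceMap (G.mainSide e).1 (Triangle.side (G.mainSide e).2 x),
    (G.faceMap _).continuous.comp (Triangle.continuous_side _)⟩

end TriangleGluing

/-- The corner `j` of the triangle. -/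
def Triangle.corner (j : Fin 3) : Triangle :=
  Triangle.mkAt j 1 0 0 zero_le_one le_rfl le_rfl (by norm_num)

@[simp] theorem Triangle.corner_zero (j : Fin 3) : (Triangle.corner j).1 j = 1 := mkAt_zero

@[simp] theorem Triangle.corner_one (j : Fin 3) : (Triangle.corner j).1 (j + 1) = 0 := mkAt_one

@[simp] theorem Triangle.corner_two (j : Fin 3) : (Triangle.corner j).1 (j + 2) = 0 := mkAt_two

theorem Triangle.side_one_eq (i : Fin 3) : Triangle.side i 1 = Triangle.corner (i + 2) :=
  Triangle.ext_at (i + 2) (by rw [side_two, corner_zero]; rfl)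
    (by rw [corner_one, TriangleGluing.add_two_one, side_zero])
    (by rw [corner_two, TriangleGluing.add_two_two, side_one]; simp)

theorem Triangle.side_zero_eq (i : Fin 3) : Triangle.side i 0 = Triangle.corner (i + 1) :=
  Triangle.ext_at (i + 1) (by rw [side_one, corner_zero]; simp)
    (by rw [corner_one, TriangleGluing.add_one_one, side_two]; rfl)
    (by rw [corner_two, TriangleGluing.add_one_two, side_zero])

theorem Fin.sum_three_at {M : Type*} [AddCommMonoid M] (f : Fin 3 → M) (i : Fin 3) :
    ∑ j, f j = f i + f (i + 1) + f (i + 2) := by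
  rw [Fin.sum_univ_three]
  fin_cases i
  · rfl
  · change f 0 + f 1 + f 2 = f 1 + f 2 + f 0
    abel
  · change f 0 + f 1 + f 2 = f 2 + f 0 + f 1
    abel

/-! ### Sides, corners and cells of the glued space -/

namespace TriangleGluing

variable (G : TriangleGluing)

open Classical in
theorem point_side_vertex (T : G.F) (i : Fin 3) (x : unitInterval) (v : G.Vertex) :
    (G.point T (Triangle.side i x)).1 v =
      (if G.vertex (T, i + 1) = v then max (1 - (x : ℝ) - 1 / 2) 0 else 0) +
      (if G.vertex (T, i + 2) = v then max ((x : ℝ) - 1 / 2) 0 else 0) := by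
  simp only [point]
  rw [Fin.sum_three_at _ i, Triangle.side_zero, Triangle.side_one, Triangle.side_two]
  norm_num

open Classical in
theorem point_side_edge (T : G.F) (i : Fin 3) (x : unitInterval) (e : G.E × Bool) :
    (G.point T (Triangle.side i x)).2.1 e = if G.edge (T, i) = e.1 then (1 - (x : ℝ)) * x *
      (if decide ((T, i) = G.mainSide e.1) = e.2 then 1 - (x : ℝ) else x) else 0 := by
  simp only [point]
  rw [Fin.sum_three_at _ i, add_one_one, add_one_two, add_two_one, Triangle.side_zero,
    Triangle.side_one, Triangle.side_two]
  simp

theorem mul_three_at (f : Fin 3 → ℝ) (i : Fin 3) : f 0 * f 1 * f 2 = f i * f (i + 1) * f (i + 2) := by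
  fin_cases i
  · rfl
  · change f 0 * f 1 * f 2 = f 1 * f 2 * f 0
    ring
  · change f 0 * f 1 * f 2 = f 2 * f 0 * f 1
    ring

theorem point_side_face (T : G.F) (i : Fin 3) (x : unitInterval) (s : G.F × Fin 3) :
    (G.point T (Triangle.side i x)).2.2 s = 0 := by
  simp only [point]
  rw [mul_three_at _ i, Triangle.side_zero]
  simp

open Classical in
/-- Glued sides are identified, reversing the direction. -/
theorem faceMap_glue {s : G.F × Fin 3} (h : G.bar s ≠ s) (x : unitInterval) :
    G.faceMap s.1 (Triangle.side s.2 x) =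
      G.faceMap (G.bar s).1 (Triangle.side (G.bar s).2 (unitInterval.symm x)) := by
  apply Subtype.ext
  change G.point _ _ = G.point _ _
  refine Prod.ext (funext fun v => ?_) (Prod.ext (funext fun e => ?_) (funext fun t => ?_))
  · rw [point_side_vertex, point_side_vertex, G.vertex_glue h, G.vertex_glue' h, add_comm]
    simp
  · have h3 : (s.1, s.2) = s := rfl
    have h4 : ((G.bar s).1, (G.bar s).2) = G.bar s := rfl
    rw [point_side_edge, point_side_edge, h3, h4]
    have he : G.edge s = G.edge (G.bar s) := (G.edge_eq_iff _ _).2 (.inr rfl)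
    rcases eq_or_ne (G.edge s) e.1 with h1 | h1
    · have h2 : (s = G.mainSide e.1) ↔ ¬ (G.bar s = G.mainSide e.1) := by
        constructor
        · intro h2 h3
          exact h (h3.trans h2.symm)
        · intro h3
          rw [← G.edge_mainSide e.1, G.edge_eq_iff] at h1
          rcases h1 with h1 | h1
          · exact h1.symm
          · exact absurd h1.symm h3
      rw [if_pos h1, if_pos (he.symm.trans h1)]
      rw [unitInterval.coe_symm_eq]
      generalize e.2 = b
      by_cases h5 : s = G.mainSide e.1
      · rw [decide_eq_true h5, decide_eq_false (h2.1 h5)]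
        cases b
        · rw [if_neg (by decide), if_pos rfl]
          ring
        · rw [if_pos rfl, if_neg (by decide)]
          ring
      · rw [decide_eq_false h5, decide_eq_true (by_contra fun h6 => h5 (h2.2 h6))]
        cases b
        · rw [if_pos rfl, if_neg (by decide)]
          ring
        · rw [if_neg (by decide), if_pos rfl]
          ring
    · rw [if_neg h1, if_neg (fun h' => h1 (he.trans h'))]
  · rw [point_side_face, point_side_face]

open Classical in
theorem faceMap_side (T : G.F) (i : Fin 3) (x : unitInterval) :
    G.faceMap T (Triangle.side i x) = G.edgeMap (G.edge (T, i))
      ((if (T, i) = G.mainSide (G.edge (T, i)) then Homeomorph.refl _ else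
        unitInterval.symmHomeomorph : unitInterval ≃ₜ unitInterval) x) := by
  change _ = G.faceMap _ _
  split_ifs with h
  · rw [← h]
    rfl
  · have h1 := G.edge_mainSide (G.edge (T, i))
    rw [G.edge_eq_iff] at h1
    rcases h1 with h1 | h1
    · exact absurd h1 h
    · have h2 : G.mainSide (G.edge (T, i)) = G.bar (T, i) := by
        conv_rhs => rw [h1]
        exact (G.bar_bar _).symm
      rw [h2]
      refine G.faceMap_glue (s := (T, i)) (fun h3 => h ?_) x
      rw [h2, h3]

/-- The points of the glued space that are vertices. -/
noncomputable def vertexPoint (v : G.Vertex) : G.Space :=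
  G.faceMap (G.vertex_surjective v).choose.1 (Triangle.corner (G.vertex_surjective v).choose.2)

open Classical in
theorem point_corner (T : G.F) (j : Fin 3) : G.point T (Triangle.corner j) =
    (fun v => if G.vertex (T, j) = v then 1 / 2 else 0, 0, 0) := by
  have hj : Triangle.corner j = Triangle.side (j + 1) 1 := by
    rw [Triangle.side_one_eq, add_one_two]
  rw [hj]
  refine Prod.ext (funext fun v => ?_) (Prod.ext (funext fun e => ?_) (funext fun t => ?_))
  · rw [point_side_vertex, add_one_two]
    norm_num
  · rw [point_side_edge]
    simp
  · rw [point_side_face]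
    rfl

theorem faceMap_corner (T : G.F) (j : Fin 3) :
    G.faceMap T (Triangle.corner j) = G.vertexPoint (G.vertex (T, j)) := by
  apply Subtype.ext
  change G.point _ _ = G.point _ _
  have := (G.vertex_surjective (G.vertex (T, j))).choose_spec
  rw [point_corner, point_corner, this]

theorem point_face_pos {T : G.F} {p : Triangle} (hp : p ∈ Triangle.interior) (T' : G.F) :
    0 < (G.point T p).2.2 (T', 0) ↔ T' = T := by
  have := hp 0
  have := hp 1
  have := hp 2
  simp only [point]
  split_ifs with h
  · exact ⟨fun _ => h, fun _ => by positivity⟩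
  · simp [h]

/-- The face coordinates are the barycentric coordinates times a common factor. Their sum is this
factor, which is nonzero in the interior. -/
theorem faceMap_injective {T : G.F} {p p' : Triangle} (hp : p ∈ Triangle.interior)
    (h : G.faceMap T p = G.faceMap T p') : p = p' := by
  have h1 : ∀ j, p.1 0 * p.1 1 * p.1 2 * p.1 j = p'.1 0 * p'.1 1 * p'.1 2 * p'.1 j := fun j => by
    have : (G.point T p).2.2 (T, j) = (G.point T p').2.2 (T, j) :=
      congrFun (congrArg (fun x : G.Space => x.1.2.2) h) (T, j)
    simpa [point] using this
  have h2 : 0 < p.1 0 * p.1 1 * p.1 2 := mul_pos (mul_pos (hp 0) (hp 1)) (hp 2)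
  have s := Triangle.sum_at 0 p
  have s' := Triangle.sum_at 0 p'
  simp only [zero_add] at s s'
  have h3 : p.1 0 * p.1 1 * p.1 2 = p'.1 0 * p'.1 1 * p'.1 2 := by
    have e0 := h1 0
    have e1 := h1 1
    have e2 := h1 2
    generalize p.1 0 * p.1 1 * p.1 2 = a at *
    generalize p'.1 0 * p'.1 1 * p'.1 2 = b at *
    calc a = a * (p.1 0 + p.1 1 + p.1 2) := by rw [s, mul_one]
      _ = b * (p'.1 0 + p'.1 1 + p'.1 2) := by rw [mul_add, mul_add, e0, e1, e2]; ring
      _ = b := by rw [s', mul_one]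
  refine Subtype.ext (funext fun j => ?_)
  have := h1 j
  rw [← h3] at this
  exact mul_left_cancel₀ h2.ne' this

theorem edgeMap_edge (e : G.E) (x : unitInterval) (e' : G.E) (o : Bool) :
    (G.edgeMap e x).1.2.1 (e', o) =
      open Classical in if e = e' then (1 - (x : ℝ)) * x * (if o then 1 - (x : ℝ) else x) else 0 := by
  change (G.point _ _).2.1 (e', o) = _
  rw [point_side_edge]
  have h : ((G.mainSide e).1, (G.mainSide e).2) = G.mainSide e := rfl
  rw [h, G.edge_mainSide]
  rcases eq_or_ne e e' with rfl | he
  · cases o <;> simp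
  · simp [he]

/-- The two coordinates of `e` add up to `(1 - x) x`, and dividing one of them by this sum gives
`x`. -/
theorem edgeMap_injective {e : G.E} {x x' : unitInterval} (hx : x ∈ Set.Ioo (0 : unitInterval) 1)
    (h : G.edgeMap e x = G.edgeMap e x') : x = x' := by
  have h1 : ∀ o, (G.edgeMap e x).1.2.1 (e, o) = (G.edgeMap e x').1.2.1 (e, o) := fun o => by rw [h]
  have ht := h1 true
  have hf := h1 false
  rw [edgeMap_edge, edgeMap_edge] at ht hf
  simp only [if_true, Bool.false_eq_true, if_false] at ht hf
  have hx0 : (0 : ℝ) < x := hx.1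
  have hx1 : (0 : ℝ) < 1 - x := sub_pos.2 hx.2
  have h2 : (1 - (x : ℝ)) * x = (1 - (x' : ℝ)) * x' := by linear_combination ht + hf
  rw [← h2] at hf
  exact Subtype.ext (mul_left_cancel₀ (mul_pos hx1 hx0).ne' hf)

/-- The characteristic maps of the glued space. -/
noncomputable def cellMaps : CellMaps G.Space where
  V := G.Vertex
  E := G.E
  F := G.F
  pointMap := G.vertexPoint
  edgeMap := G.edgeMap
  faceMap := G.faceMap

/-- Signs of coordinates tell cells apart: a positive face coordinate means an open triangle;
failing that, a positive edge coordinate means an open edge; failing both, the positive vertex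
coordinate names the vertex. -/
theorem vertex_cell_coords {v : G.Vertex} {x : G.Space} (hx : x ∈ G.cellMaps.cell (.inl v)) :
    (∀ T, ¬ 0 < x.1.2.2 (T, 0)) ∧ (∀ e, ¬ 0 < x.1.2.1 (e, true)) ∧
      ∀ v', 0 < x.1.1 v' ↔ v' = v := by
  obtain rfl : x = G.vertexPoint v := hx
  obtain ⟨⟨T, j⟩, rfl⟩ := G.vertex_surjective v
  rw [← faceMap_corner]
  have : (G.faceMap T (Triangle.corner j)).1 = G.point T (Triangle.corner j) := rfl
  rw [this, point_corner]
  refine ⟨fun T => lt_irrefl _, fun e => lt_irrefl _, fun v' => ?_⟩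
  dsimp only
  split_ifs with h
  · simp [h]
  · simp [Ne.symm h]

theorem edge_cell_coords {e : G.E} {x : G.Space} (hx : x ∈ G.cellMaps.cell (.inr (.inl e))) :
    (∀ T, ¬ 0 < x.1.2.2 (T, 0)) ∧ ∀ e', 0 < x.1.2.1 (e', true) ↔ e' = e := by
  obtain ⟨y, hy, rfl⟩ := hx
  change (∀ T, ¬ 0 < (G.edgeMap e y).1.2.2 (T, 0)) ∧
    ∀ e', 0 < (G.edgeMap e y).1.2.1 (e', true) ↔ e' = e
  refine ⟨fun T => ?_, fun e' => ?_⟩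
  · change ¬ 0 < (G.point _ _).2.2 _
    rw [point_side_face]
    exact lt_irrefl _
  · have hx0 : (0 : ℝ) < y := hy.1
    have hx1 : (0 : ℝ) < 1 - y := sub_pos.2 hy.2
    rw [edgeMap_edge, if_pos rfl]
    split_ifs with h
    · exact ⟨fun _ => h.symm, fun _ => mul_pos (mul_pos hx1 hx0) hx1⟩
    · exact ⟨fun h' => absurd h' (lt_irrefl _), fun h' => absurd h'.symm h⟩

theorem face_cell_coords {T : G.F} {x : G.Space} (hx : x ∈ G.cellMaps.cell (.inr (.inr T))) :
    ∀ T', 0 < x.1.2.2 (T', 0) ↔ T' = T := by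
  obtain ⟨p, hp, rfl⟩ := hx
  exact G.point_face_pos hp

theorem existsUnique_cell (x : G.Space) : ∃! c, x ∈ G.cellMaps.cell c := by
  refine existsUnique_of_exists_of_unique ?_ ?_
  · obtain ⟨x, T, p, rfl⟩ := x
    change ∃ c, G.faceMap T p ∈ _
    by_cases hp : p ∈ Triangle.interior
    · exact ⟨.inr (.inr T), p, hp, rfl⟩
    · obtain ⟨i, hi⟩ := Triangle.exists_eq_zero_of_notMem_interior hp
      obtain ⟨x, rfl, -⟩ := Triangle.eq_side hi
      by_cases hx : x ∈ Set.Ioo (0 : unitInterval) 1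
      · rw [G.faceMap_side]
        exact ⟨.inr (.inl (G.edge (T, i))), _, (unitInterval.homeomorph_mem_Ioo _).2 hx, rfl⟩
      · have : x = 0 ∨ x = 1 := by
          by_contra! h
          exact hx ⟨unitInterval.pos_iff_ne_zero.2 h.1, unitInterval.lt_one_iff_ne_one.2 h.2⟩
        rcases this with rfl | rfl
        · rw [Triangle.side_zero_eq, faceMap_corner]
          exact ⟨.inl _, rfl⟩
        · rw [Triangle.side_one_eq, faceMap_corner]
          exact ⟨.inl _, rfl⟩
  · intro c c' h h'
    rcases c with v | e | T <;> rcases c' with v' | e' | T'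
    · rw [((G.vertex_cell_coords h').2.2 v).1 (((G.vertex_cell_coords h).2.2 v).2 rfl)]
    · exact absurd (((G.edge_cell_coords h').2 e').2 rfl) ((G.vertex_cell_coords h).2.1 e')
    · exact absurd ((G.face_cell_coords h' T').2 rfl) ((G.vertex_cell_coords h).1 T')
    · exact absurd (((G.edge_cell_coords h).2 e).2 rfl) ((G.vertex_cell_coords h').2.1 e)
    · rw [((G.edge_cell_coords h').2 e).1 (((G.edge_cell_coords h).2 e).2 rfl)]
    · exact absurd ((G.face_cell_coords h' T').2 rfl) ((G.edge_cell_coords h).1 T')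
    · exact absurd ((G.face_cell_coords h T).2 rfl) ((G.vertex_cell_coords h').1 T)
    · exact absurd ((G.face_cell_coords h T).2 rfl) ((G.edge_cell_coords h').1 T)
    · rw [(G.face_cell_coords h' T).1 ((G.face_cell_coords h T).2 rfl)]

/-- The triangular cell structure of the glued space. -/
noncomputable def cells : TriangularCellStructure G.Space where
  toCellMaps := G.cellMaps
  edge_isEmbedding e := isEmbedding_of_saturated (G.edgeMap e).continuous
    fun _ hx _ h => G.edgeMap_injective hx h
  face_isEmbedding T := isEmbedding_of_saturated (G.faceMap T).continuous
    fun _ hp _ h => G.faceMap_injective hp h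
  existsUnique_cell := G.existsUnique_cell
  edge_zero e := ⟨_, by
    change _ = G.faceMap _ _
    rw [Triangle.side_zero_eq, faceMap_corner]
    rfl⟩
  edge_one e := ⟨_, by
    change _ = G.faceMap _ _
    rw [Triangle.side_one_eq, faceMap_corner]
    rfl⟩
  sideEdge T i := G.edge (T, i)
  side_eq T i := ⟨_, G.faceMap_side T i⟩
  -- An edge has at most two sides; otherwise the sides `1` and `2` would both be the partner of the
  -- side `0`.
  sides_not_all_equal T := by
    by_contra! h
    have h1 : (T, (1 : Fin 3)) = (T, 0) ∨ (T, 1) = G.bar (T, 0) := (G.edge_eq_iff _ _).1 (h 0 1)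
    have h2 : (T, (2 : Fin 3)) = (T, 0) ∨ (T, 2) = G.bar (T, 0) := (G.edge_eq_iff _ _).1 (h 0 2)
    simp only [Prod.mk.injEq, true_and, Fin.reduceEq, false_or] at h1 h2
    simpa using h1.trans h2.symm

theorem exists_faceMap_eq (x : G.Space) : ∃ T p, G.faceMap T p = x := by
  obtain ⟨x, T, p, rfl⟩ := x
  exact ⟨T, p, rfl⟩

theorem iUnion_range_faceMap : ⋃ T, Set.range (G.faceMap T) = Set.univ := by
  rw [Set.eq_univ_iff_forall]
  intro x
  obtain ⟨T, p, rfl⟩ := G.exists_faceMap_eq x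
  exact Set.mem_iUnion.2 ⟨T, p, rfl⟩

instance : CompactSpace G.Space := by
  rw [← isCompact_univ_iff, ← G.iUnion_range_faceMap]
  exact isCompact_iUnion fun T => isCompact_range (G.faceMap T).continuous

instance : ConnectedSpace G.Space := by
  have hne : Nonempty G.Space := ⟨G.faceMap (Classical.arbitrary _) (Triangle.corner 0)⟩
  have hT : ∀ T, IsConnected (Set.range (G.faceMap T)) := fun T => by
    have : ConnectedSpace Triangle :=
      isConnected_iff_connectedSpace.1 ((convex_stdSimplex ℝ (Fin 3)).isConnected
        ⟨_, (Triangle.corner 0).2⟩)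
    exact isConnected_range (G.faceMap T).continuous
  set r : G.F → G.F → Prop := fun T T' => (Set.range (G.faceMap T) ∩ Set.range (G.faceMap T')).Nonempty
  have hmem : ∀ s : G.F × Fin 3, G.edgeMap (G.edge s) 0 ∈ Set.range (G.faceMap s.1) := fun s => by
    obtain ⟨h, hh⟩ := G.cells.side_eq s.1 s.2
    refine ⟨Triangle.side s.2 (h.symm 0), ?_⟩
    have := hh (h.symm 0)
    rw [h.apply_symm_apply] at this
    exact this
  -- Triangles with sides along a common edge share the point `edgeMap e 0`, so a chain of edges
  -- gives a chain of overlapping connected sets.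
  have key : ∀ e e', Relation.EqvGen
      (fun a b => ∃ T i j, G.edge (T, i) = a ∧ G.edge (T, j) = b) e e' →
      ∀ s s', G.edge s = e → G.edge s' = e' → Relation.ReflTransGen r s.1 s'.1 := by
    intro e e' h
    induction h with
    | rel a b h =>
      intro s s' hs hs'
      obtain ⟨T, i, j, hi, hj⟩ := h
      have h1 := hmem s
      have h2 := hmem s'
      rw [hs, ← hi] at h1
      rw [hs', ← hj] at h2
      exact .trans (.single ⟨_, h1, hmem (T, i)⟩) (.single ⟨_, hmem (T, j), h2⟩)
    | refl a =>
      intro s s' hs hs'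
      have h1 := hmem s
      have h2 := hmem s'
      rw [hs] at h1
      rw [hs'] at h2
      exact .single ⟨_, h1, h2⟩
    | symm a b _ ih =>
      intro s s' hs hs'
      have : Std.Symm r := ⟨fun T T' ⟨x, h, h'⟩ => ⟨x, h', h⟩⟩
      exact Relation.ReflTransGen.stdSymm.symm _ _ (ih s' s hs' hs)
    | trans a b c _ _ ih ih' =>
      intro s s' hs hs'
      obtain ⟨t, ht⟩ := G.edge_surjective b
      exact (ih s t hs ht).trans (ih' t s' ht hs')
  refine { toPreconnectedSpace := ⟨?_⟩, toNonempty := hne }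
  rw [← G.iUnion_range_faceMap]
  exact IsPreconnected.iUnion_of_reflTransGen (fun T => (hT T).isPreconnected)
    fun T T' => key _ _ (G.connected _ _) (T, 0) (T', 0) rfl rfl

end TriangleGluing

namespace TriangleGluing

variable (G : TriangleGluing)

/-! ### The corners around a vertex -/

/-- The side crossed when entering a corner in the positive direction. -/
def entry (c : G.F × Fin 3) : G.F × Fin 3 := (c.1, c.2 + 1)

theorem entry_rot (c : G.F × Fin 3) : G.entry (G.rot c) = G.bar (G.exit c) :=
  Prod.ext rfl (add_two_one _)

/-- The rotation of corners as a permutation. -/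
def rotPerm : Equiv.Perm (G.F × Fin 3) where
  toFun := G.rot
  invFun c := ((G.bar (G.entry c)).1, (G.bar (G.entry c)).2 + 1)
  left_inv c := by
    dsimp only
    rw [entry_rot, G.bar_bar]
    exact Prod.ext rfl (add_two_one _)
  right_inv c := by
    have h : G.exit ((G.bar (G.entry c)).1, (G.bar (G.entry c)).2 + 1) = G.bar (G.entry c) :=
      Prod.ext rfl (add_one_two _)
    dsimp only
    rw [rot, h, G.bar_bar]
    exact Prod.ext rfl (add_one_two _)

theorem rotPerm_apply (c : G.F × Fin 3) : G.rotPerm c = G.rot c := rfl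

/-- A set of corners closed under crossing glued sides is a union of classes. -/
theorem mem_of_vertex_eq {S : Set (G.F × Fin 3)}
    (hS : ∀ x, G.bar (G.exit x) ≠ G.exit x → (x ∈ S ↔ G.rot x ∈ S)) {x y : G.F × Fin 3}
    (h : G.vertex x = G.vertex y) (hx : x ∈ S) : y ∈ S := by
  have := congrArg (Quot.lift (fun x => x ∈ S) fun a b ⟨h1, h2⟩ => by
    rw [h2]
    exact propext (hS a h1)) h
  exact cast this hx

/-- The corners at a vertex, in cyclic or linear order: `c k` for `k < n`. -/
structure CornerOrder (v : G.Vertex) where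
  n : ℕ
  n_pos : 0 < n
  c : ℕ → G.F × Fin 3
  injOn : ∀ k < n, ∀ k' < n, c k = c k' → k = k'
  vertex_eq_iff : ∀ x, G.vertex x = v ↔ ∃ k < n, c k = x
  succ : ∀ k, k + 1 < n → G.bar (G.exit (c k)) ≠ G.exit (c k) ∧ c (k + 1) = G.rot (c k)
  cyclic : Prop
  cycle : cyclic → G.bar (G.exit (c (n - 1))) ≠ G.exit (c (n - 1)) ∧ G.rot (c (n - 1)) = c 0
  chain : ¬ cyclic → G.bar (G.exit (c (n - 1))) = G.exit (c (n - 1))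

theorem vertex_pow {c : G.F × Fin 3} {k : ℕ}
    (h : ∀ i < k, G.bar (G.exit ((G.rotPerm ^ i) c)) ≠ G.exit ((G.rotPerm ^ i) c)) :
    G.vertex ((G.rotPerm ^ k) c) = G.vertex c := by
  induction k with
  | zero => rfl
  | succ k ih =>
    rw [pow_succ', Equiv.Perm.mul_apply, rotPerm_apply, G.vertex_rot (h k k.lt_succ_self)]
    exact ih fun i hi => h i (hi.trans k.lt_succ_self)

theorem pow_succ_rotPerm (c : G.F × Fin 3) (k : ℕ) :
    (G.rotPerm ^ (k + 1)) c = G.rot ((G.rotPerm ^ k) c) := by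
  rw [pow_succ', Equiv.Perm.mul_apply, rotPerm_apply]

/-- At a free exit side `rot` does not turn around the vertex but jumps to another corner of the
same triangle. If the `rot`-orbit of `c` has no such corner, the class is the whole orbit and
cyclic. Otherwise it is the stretch of the orbit between two jumps: go back from `c` to the corner
`c₀` just after a jump, then forward to the next free exit. -/
theorem nonempty_cornerOrder (v : G.Vertex) : Nonempty (G.CornerOrder v) := by
  classical
  obtain ⟨c, rfl⟩ := G.vertex_surjective v
  set ρ := G.rotPerm with hρ
  have hN : 0 < orderOf ρ := orderOf_pos ρ
  by_cases hB : ∃ i, G.bar (G.exit ((ρ ^ i) c)) = G.exit ((ρ ^ i) c)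
  · obtain ⟨i, hi⟩ := hB
    have hex : ∃ m, G.bar (G.exit ((ρ⁻¹ ^ (m + 1)) c)) = G.exit ((ρ⁻¹ ^ (m + 1)) c) := by
      -- The power `ρ ^ i` as a negative power; the multiple `i + 1` of the order keeps the
      -- subtraction from truncating.
      refine ⟨orderOf ρ * (i + 1) - i - 1, ?_⟩
      have h1 : i + 1 ≤ orderOf ρ * (i + 1) := Nat.le_mul_of_pos_left _ hN
      have h2 : orderOf ρ * (i + 1) - i - 1 + 1 + i = orderOf ρ * (i + 1) := by omega
      have h3 : ρ⁻¹ ^ (orderOf ρ * (i + 1) - i - 1 + 1) = ρ ^ i := by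
        rw [inv_pow, inv_eq_iff_mul_eq_one, ← pow_add, h2, pow_mul, pow_orderOf_eq_one, one_pow]
      rw [h3]
      exact hi
    set m := Nat.find hex with hm
    set c₀ := (ρ⁻¹ ^ m) c with hc₀
    have hc : (ρ ^ m) c₀ = c := by
      rw [hc₀, ← Equiv.Perm.mul_apply, inv_pow, mul_inv_cancel, Equiv.Perm.one_apply]
    have hlast : G.bar (G.exit (ρ⁻¹ c₀)) = G.exit (ρ⁻¹ c₀) := by
      have := Nat.find_spec hex
      rwa [← hm, pow_succ', Equiv.Perm.mul_apply, ← hc₀] at this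
    have hex' : ∃ l, G.bar (G.exit ((ρ ^ l) c₀)) = G.exit ((ρ ^ l) c₀) := by
      refine ⟨orderOf ρ - 1, ?_⟩
      have : ρ ^ (orderOf ρ - 1) = ρ⁻¹ := by
        rw [eq_inv_iff_mul_eq_one, ← pow_succ, Nat.sub_add_cancel hN, pow_orderOf_eq_one]
      rw [this]
      exact hlast
    set l := Nat.find hex' with hl
    have hlmin : ∀ i < l, G.bar (G.exit ((ρ ^ i) c₀)) ≠ G.exit ((ρ ^ i) c₀) := fun i hi =>
      Nat.find_min hex' hi
    -- The corner `c` itself lies on the stretch: a free exit between `c₀` and `c` would contradict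
    -- the minimality of `m`.
    have hml : m ≤ l := by
      by_contra! hlt
      have h1 := Nat.find_min hex (m := m - l - 1) (by omega)
      have h2 : (ρ⁻¹ ^ (m - l - 1 + 1)) c = (ρ ^ l) c₀ := by
        rw [inv_pow, Equiv.Perm.inv_eq_iff_eq, ← Equiv.Perm.mul_apply, ← pow_add,
          show m - l - 1 + 1 + l = m by omega, hc]
      rw [h2] at h1
      exact h1 (Nat.find_spec hex')
    have hclosed : ∀ x, G.bar (G.exit x) ≠ G.exit x →
        (x ∈ {x | ∃ k < l + 1, (ρ ^ k) c₀ = x} ↔ G.rot x ∈ {x | ∃ k < l + 1, (ρ ^ k) c₀ = x}) := by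
      intro x hx
      constructor
      · rintro ⟨k, hk, rfl⟩
        have hkl : k ≠ l := fun h => hx (h ▸ Nat.find_spec hex')
        exact ⟨k + 1, by omega, G.pow_succ_rotPerm _ _⟩
      · rintro ⟨k, hk, hkx⟩
        rcases k with _ | k
        · have : x = ρ⁻¹ c₀ := by
            rw [Equiv.Perm.eq_inv_iff_eq]
            exact hkx.symm
          exact absurd (this ▸ hlast) hx
        · rw [pow_succ_rotPerm] at hkx
          exact ⟨k, by omega, ρ.injective hkx⟩
    have hv : ∀ k < l + 1, G.vertex ((ρ ^ k) c₀) = G.vertex c₀ := fun k hk =>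
      G.vertex_pow fun i hi => hlmin i (by omega)
    have hvc : G.vertex c = G.vertex c₀ := by rw [← hc]; exact hv m (by omega)
    exact ⟨{
      n := l + 1
      n_pos := l.succ_pos
      c := fun k => (ρ ^ k) c₀
      injOn := by
        have key : ∀ k k', k < k' → k' < l + 1 → (ρ ^ k) c₀ ≠ (ρ ^ k') c₀ := by
          intro k k' hkk hk h
          -- A repetition would bring the corner before `c₀`, whose exit is free, into the stretch
          -- before `l`.
          have h1 : (ρ ^ (k' - k - 1)) c₀ = ρ⁻¹ c₀ := by
            rw [Equiv.Perm.eq_inv_iff_eq, hρ, rotPerm_apply, ← pow_succ_rotPerm]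
            apply (ρ ^ k).injective
            rw [← Equiv.Perm.mul_apply, ← pow_add, h]
            congr 2
            omega
          exact hlmin (k' - k - 1) (by omega) (h1 ▸ hlast)
        intro k hk k' hk' h
        rcases lt_trichotomy k k' with h1 | h1 | h1
        · exact absurd h (key k k' h1 hk')
        · exact h1
        · exact absurd h.symm (key k' k h1 hk)
      vertex_eq_iff := fun x => by
        constructor
        · intro h
          exact G.mem_of_vertex_eq hclosed h.symm ⟨m, by omega, hc⟩
        · rintro ⟨k, hk, rfl⟩
          rw [hv k hk, hvc]
      succ := fun k hk => ⟨hlmin k (by omega), G.pow_succ_rotPerm _ _⟩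
      cyclic := False
      cycle := False.elim
      chain := fun _ => Nat.find_spec hex' }⟩
  · push Not at hB
    have hex : ∃ m, (ρ ^ (m + 1)) c = c :=
      ⟨orderOf ρ - 1, by rw [Nat.sub_add_cancel hN, pow_orderOf_eq_one, Equiv.Perm.one_apply]⟩
    set l := Nat.find hex with hl
    have hlc : (ρ ^ (l + 1)) c = c := Nat.find_spec hex
    have hclosed : ∀ x, G.bar (G.exit x) ≠ G.exit x →
        (x ∈ {x | ∃ k < l + 1, (ρ ^ k) c = x} ↔ G.rot x ∈ {x | ∃ k < l + 1, (ρ ^ k) c = x}) := by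
      intro x hx
      constructor
      · rintro ⟨k, hk, rfl⟩
        rcases eq_or_ne k l with rfl | hkl
        · exact ⟨0, l.succ_pos, by rw [← pow_succ_rotPerm, hlc]; rfl⟩
        · exact ⟨k + 1, by omega, G.pow_succ_rotPerm _ _⟩
      · rintro ⟨k, hk, hkx⟩
        rcases k with _ | k
        · refine ⟨l, by omega, ρ.injective ?_⟩
          rw [hρ, rotPerm_apply, rotPerm_apply, ← pow_succ_rotPerm, ← hkx]
          exact hlc
        · rw [pow_succ_rotPerm] at hkx
          exact ⟨k, by omega, ρ.injective hkx⟩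
    exact ⟨{
      n := l + 1
      n_pos := l.succ_pos
      c := fun k => (ρ ^ k) c
      injOn := by
        have key : ∀ k k', k < k' → k' < l + 1 → (ρ ^ k) c ≠ (ρ ^ k') c := by
          intro k k' hkk hk h
          refine Nat.find_min hex (m := k' - k - 1) (by omega) ?_
          apply (ρ ^ k).injective
          rw [← Equiv.Perm.mul_apply, ← pow_add, h]
          congr 2
          omega
        intro k hk k' hk' h
        rcases lt_trichotomy k k' with h1 | h1 | h1
        · exact absurd h (key k k' h1 hk')
        · exact h1
        · exact absurd h.symm (key k' k h1 hk)
      vertex_eq_iff := fun x => by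
        constructor
        · intro h
          exact G.mem_of_vertex_eq hclosed h.symm ⟨0, by omega, rfl⟩
        · rintro ⟨k, hk, rfl⟩
          exact G.vertex_pow fun i _ => hB i
      succ := fun k hk => ⟨hB k, G.pow_succ_rotPerm _ _⟩
      cyclic := True
      cycle := fun _ => ⟨hB _, by
        rw [← pow_succ_rotPerm]
        exact hlc⟩
      chain := fun h => absurd trivial h }⟩

variable {G}

/-- Crossing the exit side of the corner `c k` leads to the corner `c k'`. -/
theorem CornerOrder.adjacent_iff {v : G.Vertex} (o : G.CornerOrder v) {k k' : ℕ} (hk : k < o.n)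
    (hk' : k' < o.n) : (G.bar (G.exit (o.c k)) ≠ G.exit (o.c k) ∧ o.c k' = G.rot (o.c k)) ↔
      k' = k + 1 ∨ (o.cyclic ∧ k + 1 = o.n ∧ k' = 0) := by
  constructor
  · rintro ⟨h1, h2⟩
    rcases Nat.lt_or_ge (k + 1) o.n with h | h
    · left
      rw [← (o.succ k h).2] at h2
      exact o.injOn k' hk' (k + 1) h h2
    · right
      have hkn : k = o.n - 1 := by omega
      have hc : o.cyclic := by
        by_contra hc
        exact h1 (hkn ▸ o.chain hc)
      refine ⟨hc, by omega, o.injOn k' hk' 0 o.n_pos ?_⟩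
      rw [h2, hkn, (o.cycle hc).2]
  · rintro (rfl | ⟨hc, h, rfl⟩)
    · exact o.succ k hk'
    · have hkn : k = o.n - 1 := by omega
      rw [hkn]
      exact ⟨(o.cycle hc).1, (o.cycle hc).2.symm⟩

/-- In a cycle every exit side is glued, and every entry side is the partner of the exit side of the
preceding corner. -/
theorem CornerOrder.not_cyclic {v : G.Vertex} (o : G.CornerOrder v) {x : G.F × Fin 3}
    (hx : G.vertex x = v) (h : G.bar (G.exit x) = G.exit x ∨ G.bar (G.entry x) = G.entry x) :
    ¬ o.cyclic := by
  intro hc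
  have hall : ∀ k < o.n, G.bar (G.exit (o.c k)) ≠ G.exit (o.c k) ∧
      ∃ y, o.c ((k + 1) % o.n) = G.rot y ∧ y = o.c k := by
    intro k hk
    rcases Nat.lt_or_ge (k + 1) o.n with h | h
    · rw [Nat.mod_eq_of_lt h]
      exact ⟨(o.succ k h).1, _, (o.succ k h).2, rfl⟩
    · have hkn : k = o.n - 1 := by omega
      have : (k + 1) % o.n = 0 := by
        rw [show k + 1 = o.n by omega, Nat.mod_self]
      rw [this, hkn]
      exact ⟨(o.cycle hc).1, _, (o.cycle hc).2.symm, rfl⟩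
  obtain ⟨k, hk, rfl⟩ := (o.vertex_eq_iff x).1 hx
  rcases h with h | h
  · exact (hall k hk).1 h
  · have hpos := o.n_pos
    set l := (k + (o.n - 1)) % o.n with hl
    have hln : l < o.n := Nat.mod_lt _ hpos
    have hlk : (l + 1) % o.n = k := by
      rw [hl, Nat.mod_add_mod, show k + (o.n - 1) + 1 = k + o.n by omega, Nat.add_mod_right,
        Nat.mod_eq_of_lt hk]
    obtain ⟨h1, y, h2, rfl⟩ := hall l hln
    rw [hlk] at h2
    rw [h2, entry_rot, G.bar_bar] at h
    exact h1 h.symm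

end TriangleGluing

/-! ### Polar coordinates on a disc or half disc divided into sectors -/

/-- Polar coordinates: the `k`-th of `n` equal sectors of the disc (of the upper half disc if the
angle `ω` is `π`), at radius `r` and at the proportion `t` of the sector. -/
noncomputable def polarSector (ω : ℝ) (n : ℕ) (z : Fin n × unitInterval × unitInterval) : ℂ :=
  ((z.2.1 : ℝ) : ℂ) * Complex.exp (((ω * (((z.1 : ℕ) : ℝ) + z.2.2) / n : ℝ) : ℂ) * Complex.I)

theorem continuous_polarSector (ω : ℝ) (n : ℕ) : Continuous (polarSector ω n) := by
  rw [continuous_prod_of_discrete_left]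
  intro k
  unfold polarSector
  fun_prop

theorem norm_polarSector (ω : ℝ) (n : ℕ) (z : Fin n × unitInterval × unitInterval) :
    ‖polarSector ω n z‖ = z.2.1 := by
  rw [polarSector, norm_mul, Complex.norm_exp_ofReal_mul_I, Complex.norm_real, mul_one]
  exact abs_of_nonneg z.2.1.2.1

theorem sector_position_mem {n : ℕ} (k : Fin n) (t : unitInterval) :
    0 ≤ ((k : ℕ) : ℝ) + t ∧ ((k : ℕ) : ℝ) + t ≤ n := by
  have h0 : (0 : ℝ) ≤ (k : ℕ) := Nat.cast_nonneg _
  have h1 : (((k : ℕ) : ℝ) + 1) ≤ n := by exact_mod_cast k.2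
  have := t.2.1
  have := t.2.2
  constructor <;> linarith

/-- Intervals `[k, k + 1]` with different integers `k` meet only if consecutive, and then in the
common end. -/
theorem sector_position_eq_iff {n : ℕ} (k k' : Fin n) (t t' : unitInterval) :
    ((k : ℕ) : ℝ) + t = ((k' : ℕ) : ℝ) + t' ↔ (k = k' ∧ t = t') ∨
      ((k' : ℕ) = k + 1 ∧ t = 1 ∧ t' = 0) ∨ ((k : ℕ) = k' + 1 ∧ t' = 1 ∧ t = 0) := by
  have key : ∀ (k k' : Fin n) (t t' : unitInterval), (k : ℕ) < k' →
      ((k : ℕ) : ℝ) + t = ((k' : ℕ) : ℝ) + t' → (k' : ℕ) = k + 1 ∧ t = 1 ∧ t' = 0 := by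
    intro k k' t t' hk h
    have h1 : (((k : ℕ) : ℝ) + 1) ≤ (k' : ℕ) := by exact_mod_cast hk
    have h2 := t'.2.1
    have h3 := t.2.2
    refine ⟨?_, Subtype.ext ?_, Subtype.ext ?_⟩
    · have : ((k' : ℕ) : ℝ) = ((k : ℕ) : ℝ) + 1 := by linarith
      exact_mod_cast this
    · change (t : ℝ) = 1
      linarith
    · change (t' : ℝ) = 0
      linarith
  constructor
  · intro h
    rcases lt_trichotomy (k : ℕ) k' with hk | hk | hk
    · exact .inr (.inl (key k k' t t' hk h))
    · refine .inl ⟨Fin.ext hk, Subtype.ext ?_⟩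
      rw [hk] at h
      exact add_left_cancel h
    · exact .inr (.inr (key k' k t' t hk h.symm))
  · rintro (⟨rfl, rfl⟩ | ⟨h, rfl, rfl⟩ | ⟨h, rfl, rfl⟩)
    · rfl
    · rw [h]; simp
    · rw [h]; simp

theorem sector_position_eq_add_iff {n : ℕ} (k k' : Fin n) (t t' : unitInterval) :
    ((k : ℕ) : ℝ) + t = ((k' : ℕ) : ℝ) + t' + n ↔
      ((k : ℕ) + 1 = n ∧ (k' : ℕ) = 0) ∧ t = 1 ∧ t' = 0 := by
  have h1 : (((k : ℕ) : ℝ) + 1) ≤ n := by exact_mod_cast k.2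
  have h2 := t'.2.1
  have h3 := t.2.2
  have h4 : (0 : ℝ) ≤ (k' : ℕ) := Nat.cast_nonneg _
  constructor
  · intro h
    refine ⟨⟨?_, ?_⟩, Subtype.ext ?_, Subtype.ext ?_⟩
    · have : (((k : ℕ) : ℝ) + 1) = n := by linarith
      exact_mod_cast this
    · have : (((k' : ℕ) : ℝ)) = 0 := by linarith
      exact_mod_cast this
    · change (t : ℝ) = 1
      linarith
    · change (t' : ℝ) = 0
      linarith
  · rintro ⟨⟨h, h'⟩, rfl, rfl⟩
    have : (((k : ℕ) : ℝ) + 1) = n := by exact_mod_cast h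
    rw [h']
    simp [this]

/-- The radius is the norm, and angles count modulo `2π`. As positions lie in `[0, n]`, a full turn
allows only a shift by `n` between the last end and the first start, and a half turn allows none.
The form matches `CornerOrder.sectors_eq_iff`. -/
theorem polarSector_eq_iff {n : ℕ} (hn : 0 < n) (cyc : Prop) {ω : ℝ}
    (hω : ω = open Classical in if cyc then 2 * Real.pi else Real.pi)
    (k k' : Fin n) (r r' t t' : unitInterval) :
    polarSector ω n (k, r, t) = polarSector ω n (k', r', t') ↔ r = r' ∧ (r = 0 ∨ (k = k' ∧ t = t') ∨
      (((k' : ℕ) = k + 1 ∨ (cyc ∧ (k : ℕ) + 1 = n ∧ (k' : ℕ) = 0)) ∧ t = 1 ∧ t' = 0) ∨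
      (((k : ℕ) = k' + 1 ∨ (cyc ∧ (k' : ℕ) + 1 = n ∧ (k : ℕ) = 0)) ∧ t' = 1 ∧ t = 0)) := by
  have hn' : (0 : ℝ) < n := by exact_mod_cast hn
  have hpos : ∀ r : unitInterval, r ≠ 0 → ((r : ℝ) : ℂ) ≠ 0 := fun r hr h => by
    apply hr
    apply Subtype.ext
    exact_mod_cast h
  have hexp : r ≠ 0 → (polarSector ω n (k, r, t) = polarSector ω n (k', r, t') ↔
      ∃ m : ℤ, ω * ((((k : ℕ) : ℝ) + t) - (((k' : ℕ) : ℝ) + t')) = m * (2 * Real.pi) * n) := by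
    intro hr
    rw [polarSector, polarSector, mul_right_inj' (hpos r hr), Complex.exp_eq_exp_iff_exists_int]
    refine exists_congr fun m => ?_
    have h1 : ((m : ℂ) * (2 * Real.pi * Complex.I)) =
        ((m * (2 * Real.pi) : ℝ) : ℂ) * Complex.I := by push_cast; ring
    rw [h1, ← add_mul, mul_left_inj' Complex.I_ne_zero, ← Complex.ofReal_add, Complex.ofReal_inj]
    simp only
    rw [div_eq_iff hn'.ne', add_mul, div_mul_cancel₀ _ hn'.ne']
    constructor <;> intro h <;> linarith
  have hs := sector_position_mem k t
  have hs' := sector_position_mem k' t'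
  have hpi := Real.pi_pos
  have hmain : r ≠ 0 → (polarSector ω n (k, r, t) = polarSector ω n (k', r, t') ↔
      ((k : ℕ) : ℝ) + t = ((k' : ℕ) : ℝ) + t' ∨ (cyc ∧ (((k : ℕ) : ℝ) + t = ((k' : ℕ) : ℝ) + t' + n ∨
        ((k' : ℕ) : ℝ) + t' = ((k : ℕ) : ℝ) + t + n))) := by
    intro hr
    rw [hexp hr]
    generalize ((k : ℕ) : ℝ) + t = a at *
    generalize ((k' : ℕ) : ℝ) + t' = b at *
    by_cases hc : cyc
    · rw [if_pos hc] at hω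
      subst hω
      have h1 : ∀ m : ℤ, (2 * Real.pi * (a - b) = m * (2 * Real.pi) * n ↔ a - b = m * n) := by
        intro m
        rw [show (m * (2 * Real.pi) * n : ℝ) = 2 * Real.pi * (m * n) by ring,
          mul_right_inj' (by positivity)]
      simp only [h1, hc, true_and]
      constructor
      · rintro ⟨m, hm⟩
        have h2 : (m : ℝ) ≤ 1 := by
          by_contra! h
          nlinarith
        have h3 : (-1 : ℝ) ≤ m := by
          by_contra! h
          nlinarith
        have h2' : m ≤ 1 := by exact_mod_cast h2
        have h3' : -1 ≤ m := by exact_mod_cast h3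
        obtain rfl | rfl | rfl : m = -1 ∨ m = 0 ∨ m = 1 := by omega
        · right; right
          push_cast at hm
          linarith
        · left
          push_cast at hm
          linarith
        · right; left
          push_cast at hm
          linarith
      · rintro (h | h | h)
        · exact ⟨0, by push_cast; linarith⟩
        · exact ⟨1, by push_cast; linarith⟩
        · exact ⟨-1, by push_cast; linarith⟩
    · rw [if_neg hc] at hω
      subst hω
      have h1 : ∀ m : ℤ, (Real.pi * (a - b) = m * (2 * Real.pi) * n ↔ a - b = 2 * m * n) := by
        intro m
        rw [show (m * (2 * Real.pi) * n : ℝ) = Real.pi * (2 * m * n) by ring,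
          mul_right_inj' (by positivity)]
      simp only [h1, hc, false_and, or_false]
      constructor
      · rintro ⟨m, hm⟩
        have h2 : (m : ℝ) < 1 := by
          by_contra! h
          nlinarith
        have h3 : (-1 : ℝ) < m := by
          by_contra! h
          nlinarith
        have h2' : m < 1 := by exact_mod_cast h2
        have h3' : -1 < m := by exact_mod_cast h3
        obtain rfl : m = 0 := by omega
        push_cast at hm
        linarith
      · intro h
        exact ⟨0, by push_cast; linarith⟩
  have hr : polarSector ω n (k, r, t) = polarSector ω n (k', r', t') → r = r' := fun h => by
    have := congrArg norm h
    rw [norm_polarSector, norm_polarSector] at this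
    exact Subtype.ext this
  constructor
  · intro h
    obtain rfl := hr h
    refine ⟨rfl, ?_⟩
    rcases eq_or_ne r 0 with h0 | h0
    · exact .inl h0
    · right
      rw [hmain h0, sector_position_eq_iff, sector_position_eq_add_iff,
        sector_position_eq_add_iff] at h
      rcases h with (h | ⟨h1, h2⟩ | ⟨h1, h2⟩) | ⟨hc, ⟨h1, h2⟩ | ⟨h1, h2⟩⟩
      · exact .inl h
      · exact .inr (.inl ⟨.inl h1, h2⟩)
      · exact .inr (.inr ⟨.inl h1, h2⟩)
      · exact .inr (.inl ⟨.inr ⟨hc, h1⟩, h2⟩)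
      · exact .inr (.inr ⟨.inr ⟨hc, h1⟩, h2⟩)
  · rintro ⟨rfl, h⟩
    rcases eq_or_ne r 0 with h0 | h0
    · subst h0
      simp [polarSector]
    · rw [hmain h0, sector_position_eq_iff, sector_position_eq_add_iff,
        sector_position_eq_add_iff]
      rcases h with h | h | ⟨h1 | ⟨hc, h1⟩, h2⟩ | ⟨h1 | ⟨hc, h1⟩, h2⟩
      · exact absurd h h0
      · exact .inl (.inl h)
      · exact .inl (.inr (.inl ⟨h1, h2⟩))
      · exact .inr ⟨hc, .inl ⟨h1, h2⟩⟩
      · exact .inl (.inr (.inr ⟨h1, h2⟩))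
      · exact .inr ⟨hc, .inr ⟨h1, h2⟩⟩

theorem exists_sector_position {n : ℕ} (hn : 0 < n) {s : ℝ} (h0 : 0 ≤ s) (h1 : s ≤ n) :
    ∃ (k : Fin n) (t : unitInterval), ((k : ℕ) : ℝ) + t = s := by
  rcases eq_or_lt_of_le h1 with rfl | h1
  · refine ⟨⟨n - 1, by omega⟩, 1, ?_⟩
    have : (((n - 1 : ℕ) : ℝ) + 1) = n := by exact_mod_cast Nat.sub_add_cancel hn
    exact this
  · have h2 := Nat.floor_le h0
    have h3 := Nat.lt_floor_add_one s
    refine ⟨⟨⌊s⌋₊, (Nat.floor_lt h0).2 h1⟩, ⟨s - ⌊s⌋₊, by linarith, by linarith⟩, ?_⟩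
    simp

theorem exists_polarSector {n : ℕ} (hn : 0 < n) {ω θ : ℝ} (hω : 0 < ω) (h0 : 0 ≤ θ) (h1 : θ ≤ ω)
    (r : unitInterval) : ∃ k t, polarSector ω n (k, r, t) = ((r : ℝ) : ℂ) * Complex.exp (θ * Complex.I) := by
  have hn' : (0 : ℝ) < n := by exact_mod_cast hn
  obtain ⟨k, t, h⟩ := exists_sector_position hn (s := θ * n / ω) (by positivity)
    (by rw [div_le_iff₀ hω]; nlinarith)
  refine ⟨k, t, ?_⟩
  simp only [polarSector, h]
  congr 4
  field_simp

theorem polarSector_image_disc {n : ℕ} (hn : 0 < n) :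
    polarSector (2 * Real.pi) n '' {z | z.2.1 < 1} = Metric.ball 0 1 := by
  ext w
  constructor
  · rintro ⟨z, hz, rfl⟩
    rw [mem_ball_zero_iff, norm_polarSector]
    exact hz
  · intro hw
    rw [mem_ball_zero_iff] at hw
    obtain ⟨θ, h0, h1, hθ⟩ : ∃ θ : ℝ, 0 ≤ θ ∧ θ ≤ 2 * Real.pi ∧
        Complex.exp (θ * Complex.I) = Complex.exp (w.arg * Complex.I) := by
      have h2 := w.neg_pi_lt_arg
      have h3 := w.arg_le_pi
      rcases le_total 0 w.arg with h | h
      · exact ⟨w.arg, h, by linarith, rfl⟩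
      · refine ⟨w.arg + 2 * Real.pi, by linarith, by linarith, ?_⟩
        push_cast
        rw [add_mul, Complex.exp_add, Complex.exp_two_pi_mul_I, mul_one]
    obtain ⟨k, t, hkt⟩ := exists_polarSector hn (by positivity) h0 h1 ⟨‖w‖, norm_nonneg _, hw.le⟩
    refine ⟨(k, ⟨‖w‖, norm_nonneg _, hw.le⟩, t), hw, hkt.trans ?_⟩
    rw [hθ]
    exact Complex.norm_mul_exp_arg_mul_I w

theorem im_polarSector_nonneg {n : ℕ} (hn : 0 < n) (z : Fin n × unitInterval × unitInterval) :
    0 ≤ (polarSector Real.pi n z).im := by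
  have hn' : (0 : ℝ) < n := by exact_mod_cast hn
  obtain ⟨h0, h1⟩ := sector_position_mem z.1 z.2.2
  rw [polarSector, Complex.im_ofReal_mul, Complex.exp_ofReal_mul_I_im]
  refine mul_nonneg z.2.1.2.1 (Real.sin_nonneg_of_nonneg_of_le_pi ?_ ?_)
  · have := Real.pi_pos
    positivity
  · rw [div_le_iff₀ hn']
    exact mul_le_mul_of_nonneg_left h1 Real.pi_pos.le

theorem polarSector_image_halfDisc {n : ℕ} (hn : 0 < n) :
    polarSector Real.pi n '' {z | z.2.1 < 1} = Metric.ball 0 1 ∩ {z | 0 ≤ z.im} := by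
  ext w
  constructor
  · rintro ⟨z, hz, rfl⟩
    refine ⟨?_, im_polarSector_nonneg hn z⟩
    rw [mem_ball_zero_iff, norm_polarSector]
    exact hz
  · rintro ⟨hw, him⟩
    rw [mem_ball_zero_iff] at hw
    obtain ⟨k, t, hkt⟩ := exists_polarSector hn Real.pi_pos (Complex.arg_nonneg_iff.2 him)
      w.arg_le_pi ⟨‖w‖, norm_nonneg _, hw.le⟩
    exact ⟨(k, ⟨‖w‖, norm_nonneg _, hw.le⟩, t), hw, hkt.trans (Complex.norm_mul_exp_arg_mul_I w)⟩

/-! ### Sectors at the corners of a triangle -/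

namespace Triangle

/-- A neighbourhood of the corner `j`, parametrized by the (scaled) distance `r` from the corner and
by the position `t` between the two sides. -/
noncomputable def sector (j : Fin 3) (r t : unitInterval) : Triangle :=
  mkAt j (1 - r / 4) (r * t / 4) (r * (1 - t) / 4)
    (by have := r.2.2; linarith)
    (by have := r.2.1; have := t.2.1; positivity)
    (by
      have := r.2.1
      have : (0 : ℝ) ≤ 1 - t := sub_nonneg.2 t.2.2
      positivity)
    (by ring)

theorem continuous_sector (j : Fin 3) :
    Continuous fun z : unitInterval × unitInterval => sector j z.1 z.2 :=
  continuous_mkAt (by fun_prop) (by fun_prop) (by fun_prop)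

variable (j : Fin 3) (r t : unitInterval)

@[simp] theorem sector_apply_zero : (sector j r t).1 j = 1 - r / 4 := mkAt_zero
@[simp] theorem sector_apply_one : (sector j r t).1 (j + 1) = r * t / 4 := mkAt_one
@[simp] theorem sector_apply_two : (sector j r t).1 (j + 2) = r * (1 - t) / 4 := mkAt_two

variable {j r t}

theorem sector_mem_interior (hr : r ≠ 0) (ht : t ∈ Set.Ioo (0 : unitInterval) 1) :
    sector j r t ∈ interior := by
  have hr0 : (0 : ℝ) < r := unitInterval.pos_iff_ne_zero.2 hr
  have hr1 : (r : ℝ) ≤ 1 := r.2.2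
  have ht0 : (0 : ℝ) < t := ht.1
  have ht1 : (0 : ℝ) < 1 - t := sub_pos.2 ht.2
  intro i
  rcases fin3_cases j i with rfl | rfl | rfl
  · rw [sector_apply_zero]; linarith
  · rw [sector_apply_one]; positivity
  · rw [sector_apply_two]; positivity

/-- At most one coordinate is larger than `1 / 2`. -/
theorem eq_of_half_lt {p : Triangle} {i j : Fin 3} (hi : 1 / 2 < p.1 i) (hj : 1 / 2 < p.1 j) :
    i = j := by
  have h := sum_at i p
  have h1 := nonneg p (i + 1)
  have h2 := nonneg p (i + 2)
  rcases fin3_cases i j with rfl | rfl | rfl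
  · rfl
  · linarith
  · linarith

/-- The scaling by `1 / 4` serves this bound: by `eq_of_half_lt`, sectors at different corners of a
triangle are disjoint. -/
theorem half_lt_sector : 1 / 2 < (sector j r t).1 j := by
  have := r.2.2
  rw [sector_apply_zero]
  linarith

theorem sector_inj {j' : Fin 3} {r' t' : unitInterval} (hr : r ≠ 0)
    (h : sector j r t = sector j' r' t') : j = j' ∧ r = r' ∧ t = t' := by
  obtain rfl : j = j' := eq_of_half_lt half_lt_sector (by rw [h]; exact half_lt_sector)
  have h0 := congrArg (fun p : Triangle => p.1 j) h
  have h1 := congrArg (fun p : Triangle => p.1 (j + 1)) h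
  simp only [sector_apply_zero, sector_apply_one] at h0 h1
  obtain rfl : r = r' := Subtype.ext (by linarith)
  have hr0 : (r : ℝ) ≠ 0 := fun h => hr (Subtype.ext h)
  refine ⟨rfl, rfl, Subtype.ext (mul_left_cancel₀ hr0 ?_)⟩
  linarith

theorem sector_zero : sector j 0 t = corner j :=
  ext_at j (by simp) (by simp) (by simp)

/-- The point of the unit interval at distance `r / 4` from `0`. -/
noncomputable def quarter (r : unitInterval) : unitInterval :=
  ⟨r / 4, by have := r.2.1; positivity, by have := r.2.2; linarith⟩

theorem quarter_mem (hr : r ≠ 0) : quarter r ∈ Set.Ioo (0 : unitInterval) 1 := by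
  have hr0 : (0 : ℝ) < r := unitInterval.pos_iff_ne_zero.2 hr
  have hr1 : (r : ℝ) ≤ 1 := r.2.2
  constructor
  · change (0 : ℝ) < r / 4
    positivity
  · change (r : ℝ) / 4 < 1
    linarith

/-- The ray `t = 1` follows the exit side from its start; the ray `t = 0` follows the entry side
from its end. This fits the reversal of direction in the gluing. -/
theorem sector_one : sector j r 1 = side (j + 2) (quarter r) := by
  have h1 := side_one (j + 2) (quarter r)
  have h2 := side_two (j + 2) (quarter r)
  rw [TriangleGluing.add_two_one] at h1
  rw [TriangleGluing.add_two_two] at h2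
  refine ext_at j ?_ ?_ ?_
  · rw [sector_apply_zero, h1]; rfl
  · rw [sector_apply_one, h2]; simp [quarter]
  · rw [sector_apply_two, side_zero]; simp

theorem sector_zero_right : sector j r 0 = side (j + 1) (unitInterval.symm (quarter r)) := by
  have h1 := side_one (j + 1) (unitInterval.symm (quarter r))
  have h2 := side_two (j + 1) (unitInterval.symm (quarter r))
  rw [TriangleGluing.add_one_one] at h1
  rw [TriangleGluing.add_one_two] at h2
  refine ext_at j ?_ ?_ ?_
  · rw [sector_apply_zero, h2]; rfl
  · rw [sector_apply_one, side_zero]; simp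
  · rw [sector_apply_two, h1]; simp [quarter]

theorem exists_eq_sector {p : Triangle} (hp : 3 / 4 < p.1 j) :
    ∃ r t : unitInterval, r < 1 ∧ p = sector j r t := by
  have h := sum_at j p
  have h1 := nonneg p (j + 1)
  have h2 := nonneg p (j + 2)
  have hr : 4 * (1 - p.1 j) ∈ unitInterval := ⟨by linarith, by linarith⟩
  rcases eq_or_lt_of_le (show 0 ≤ 1 - p.1 j by linarith) with h0 | h0
  · refine ⟨⟨_, hr⟩, 0, ?_, ext_at j ?_ ?_ ?_⟩
    · change 4 * (1 - p.1 j) < 1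
      linarith
    · rw [sector_apply_zero]; simp
    · rw [sector_apply_one]; simp; linarith
    · rw [sector_apply_two]; simp; linarith
  · refine ⟨⟨_, hr⟩, ⟨p.1 (j + 1) / (1 - p.1 j), by positivity, ?_⟩, ?_, ext_at j ?_ ?_ ?_⟩
    · rw [div_le_one h0]; linarith
    · change 4 * (1 - p.1 j) < 1
      linarith
    · rw [sector_apply_zero]; simp
    · rw [sector_apply_one]
      field_simp
    · rw [sector_apply_two]
      field_simp
      linarith

end Triangle

namespace TriangleGluing

variable {G : TriangleGluing}

/-! ### Charts at the vertices -/

/-- If points on two sides are identified, the sides are equal or glued. -/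
theorem side_eq_side {s s' : G.F × Fin 3} {x x' : unitInterval}
    (hx : x ∈ Set.Ioo (0 : unitInterval) 1)
    (h : G.faceMap s.1 (Triangle.side s.2 x) = G.faceMap s'.1 (Triangle.side s'.2 x')) :
    (s = s' ∧ x = x') ∨ (G.bar s ≠ s ∧ s' = G.bar s ∧ x' = unitInterval.symm x) := by
  have hedge : G.edge s = G.edge s' ∧ ∀ s'' : G.F × Fin 3, s'' = s → ∀ x'' : unitInterval,
      G.faceMap s''.1 (Triangle.side s''.2 x) = G.faceMap s''.1 (Triangle.side s''.2 x'') → x = x'' := by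
    obtain ⟨k, hk⟩ := G.cells.side_eq s.1 s.2
    obtain ⟨k', hk'⟩ := G.cells.side_eq s'.1 s'.2
    have hkx := (unitInterval.homeomorph_mem_Ioo k).2 hx
    refine ⟨(G.cells.edge_eq_edge hkx ((hk x).symm.trans (h.trans (hk' x')))).1, ?_⟩
    rintro _ rfl x'' h''
    exact k.injective (G.cells.edge_eq_edge hkx ((hk x).symm.trans (h''.trans (hk x'')))).2
  obtain ⟨he, hinj⟩ := hedge
  by_cases hs : s' = s
  · subst hs
    exact .inl ⟨rfl, hinj _ rfl _ h⟩
  · obtain rfl := ((G.edge_eq_iff _ _).1 he).resolve_left hs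
    refine .inr ⟨hs, rfl, ?_⟩
    rw [← unitInterval.symm_symm x'] at h ⊢
    rw [← G.faceMap_glue hs] at h
    rw [← hinj _ rfl _ h]

namespace CornerOrder

variable {v : G.Vertex} (o : G.CornerOrder v)

/-- The sectors of the triangles around a vertex. -/
noncomputable def sectors (z : Fin o.n × unitInterval × unitInterval) : G.Space :=
  G.faceMap (o.c z.1).1 (Triangle.sector (o.c z.1).2 z.2.1 z.2.2)

theorem continuous_sectors : Continuous o.sectors := by
  rw [continuous_prod_of_discrete_left]
  exact fun k => (G.faceMap (o.c k).1).continuous.comp (Triangle.continuous_sector (o.c k).2)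

theorem sectors_zero (k : Fin o.n) (t : unitInterval) : o.sectors (k, 0, t) = G.vertexPoint v := by
  simp only [sectors, Triangle.sector_zero, faceMap_corner]
  rw [(o.vertex_eq_iff _).2 ⟨k, k.2, rfl⟩]

theorem sectors_glue {k k' : Fin o.n} (h : G.bar (G.exit (o.c k)) ≠ G.exit (o.c k))
    (hk : o.c k' = G.rot (o.c k)) (r : unitInterval) : o.sectors (k, r, 1) = o.sectors (k', r, 0) := by
  simp only [sectors, Triangle.sector_one, Triangle.sector_zero_right]
  have h1 := G.faceMap_glue h (Triangle.quarter r)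
  have h2 : G.bar (G.exit (o.c k)) = ((o.c k').1, (o.c k').2 + 1) := by
    rw [← entry_rot, ← hk]
    rfl
  rw [h2] at h1
  exact h1

theorem eq_of_sectors_eq {k k' : Fin o.n} {r r' t t' : unitInterval} (hr : r ≠ 0)
    (h : Triangle.sector (o.c k).2 r t = Triangle.sector (o.c k').2 r' t')
    (h1 : (o.c k).1 = (o.c k').1) : k = k' ∧ r = r' ∧ t = t' := by
  obtain ⟨h2, h3, h4⟩ := Triangle.sector_inj hr h
  exact ⟨Fin.ext (o.injOn k k.2 k' k'.2 (Prod.ext h1 h2)), h3, h4⟩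

/-- The point lies on an open edge, so its other representative is on the same side or on the glued
one. In the second case the large coordinate identifies the corner as the one reached by `rot`. -/
theorem sectors_eq_of_right {k k' : Fin o.n} {r r' t' : unitInterval} (hr : r ≠ 0)
    (h : o.sectors (k, r, 1) = o.sectors (k', r', t')) : r = r' ∧ ((k = k' ∧ 1 = t') ∨
      ((G.bar (G.exit (o.c k)) ≠ G.exit (o.c k) ∧ o.c k' = G.rot (o.c k)) ∧ t' = 0)) := by
  have hq := Triangle.quarter_mem hr
  have h' : G.faceMap (G.exit (o.c k)).1 (Triangle.side (G.exit (o.c k)).2 (Triangle.quarter r)) =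
      G.faceMap (o.c k').1 (Triangle.sector (o.c k').2 r' t') := by
    refine Eq.trans ?_ h
    simp only [sectors, Triangle.sector_one]
    rfl
  obtain ⟨g, hg⟩ := G.cells.side_eq (G.exit (o.c k)).1 (G.exit (o.c k)).2
  obtain ⟨i, x, hix, -, -⟩ := G.cells.face_eq_edge ((unitInterval.homeomorph_mem_Ioo g).2 hq)
    (h'.symm.trans (hg _))
  rw [hix] at h'
  rcases side_eq_side (s' := ((o.c k').1, i)) hq h' with ⟨h1, rfl⟩ | ⟨h1, h2, rfl⟩
  · obtain ⟨h3, rfl⟩ := Prod.ext_iff.1 h1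
    have h4 : Triangle.sector (o.c k).2 r 1 = Triangle.sector (o.c k').2 r' t' := by
      rw [Triangle.sector_one, hix]
      rfl
    obtain ⟨h5, h6, h7⟩ := o.eq_of_sectors_eq hr h4 h3
    exact ⟨h6, .inl ⟨h5, h7⟩⟩
  · have h3 : (o.c k').2 = i + 2 := by
      refine Triangle.eq_of_half_lt (Triangle.half_lt_sector (r := r') (t := t')) ?_
      rw [hix, Triangle.side_two]
      simp only [unitInterval.coe_symm_eq, Triangle.quarter]
      have := r.2.2
      linarith
    have h4 : o.c k' = G.rot (o.c k) := by
      rw [rot, ← h2]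
      exact Prod.ext rfl h3
    have h5 := congrArg (fun p : Triangle => p.1 (i + 2)) hix
    have h6 := congrArg (fun p : Triangle => p.1 i) hix
    simp only [Triangle.side_two, Triangle.side_zero, h3] at h5 h6
    rw [Triangle.sector_apply_zero] at h5
    have h7 := Triangle.sector_apply_one (i + 2) r' t'
    rw [add_two_one, h6] at h7
    simp only [unitInterval.coe_symm_eq, Triangle.quarter] at h5
    obtain rfl : r = r' := Subtype.ext (by linarith)
    have hr0 : (r : ℝ) ≠ 0 := fun h => hr (Subtype.ext h)
    refine ⟨rfl, .inr ⟨⟨h1, h4⟩, Subtype.ext ?_⟩⟩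
    have : (r : ℝ) * t' = 0 := by linarith
    exact (mul_eq_zero.1 this).resolve_left hr0

/-- On an entry side it is enough to find that the other representative lies on an exit side; by
symmetry `sectors_eq_of_right` then finishes. -/
theorem exists_right_of_left {k k' : Fin o.n} {r r' t' : unitInterval} (hr : r ≠ 0)
    (h : o.sectors (k, r, 0) = o.sectors (k', r', t')) : r' ≠ 0 ∧ ((k = k' ∧ r = r' ∧ 0 = t') ∨ t' = 1) := by
  have hq := Triangle.quarter_mem hr
  have hq' : unitInterval.symm (Triangle.quarter r) ∈ Set.Ioo (0 : unitInterval) 1 :=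
    (unitInterval.homeomorph_mem_Ioo unitInterval.symmHomeomorph).2 hq
  have h' : G.faceMap (G.entry (o.c k)).1 (Triangle.side (G.entry (o.c k)).2
      (unitInterval.symm (Triangle.quarter r))) =
      G.faceMap (o.c k').1 (Triangle.sector (o.c k').2 r' t') := by
    refine Eq.trans ?_ h
    simp only [sectors, Triangle.sector_zero_right]
    rfl
  obtain ⟨g, hg⟩ := G.cells.side_eq (G.entry (o.c k)).1 (G.entry (o.c k)).2
  obtain ⟨i, x, hix, -, -⟩ := G.cells.face_eq_edge ((unitInterval.homeomorph_mem_Ioo g).2 hq')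
    (h'.symm.trans (hg _))
  rw [hix] at h'
  rcases side_eq_side (s' := ((o.c k').1, i)) hq' h' with ⟨h1, rfl⟩ | ⟨h1, h2, rfl⟩
  · obtain ⟨h3, rfl⟩ := Prod.ext_iff.1 h1
    have h4 : Triangle.sector (o.c k).2 r 0 = Triangle.sector (o.c k').2 r' t' := by
      rw [Triangle.sector_zero_right, hix]
      rfl
    obtain ⟨h5, h6, h7⟩ := o.eq_of_sectors_eq hr h4 h3
    exact ⟨h6 ▸ hr, .inl ⟨h5, h6, h7⟩⟩
  · rw [unitInterval.symm_symm] at hix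
    have h3 : (o.c k').2 = i + 1 := by
      refine Triangle.eq_of_half_lt (Triangle.half_lt_sector (r := r') (t := t')) ?_
      rw [hix, Triangle.side_one]
      simp only [Triangle.quarter]
      have := r.2.2
      linarith
    have h5 := congrArg (fun p : Triangle => p.1 (i + 1)) hix
    have h6 := congrArg (fun p : Triangle => p.1 i) hix
    simp only [Triangle.side_one, Triangle.side_zero, h3] at h5 h6
    rw [Triangle.sector_apply_zero] at h5
    have h7 := Triangle.sector_apply_two (i + 1) r' t'
    rw [add_one_two, h6] at h7
    simp only [Triangle.quarter] at h5
    obtain rfl : r = r' := Subtype.ext (by linarith)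
    have hr0 : (r : ℝ) ≠ 0 := fun h => hr (Subtype.ext h)
    refine ⟨hr, .inr (Subtype.ext ?_)⟩
    have : (r : ℝ) * (1 - t') = 0 := by linarith
    have := (mul_eq_zero.1 this).resolve_left hr0
    change (t' : ℝ) = 1
    linarith

theorem sectors_eq_iff (k k' : Fin o.n) (r r' t t' : unitInterval) :
    o.sectors (k, r, t) = o.sectors (k', r', t') ↔ r = r' ∧ (r = 0 ∨ (k = k' ∧ t = t') ∨
      (((k' : ℕ) = k + 1 ∨ (o.cyclic ∧ (k : ℕ) + 1 = o.n ∧ (k' : ℕ) = 0)) ∧ t = 1 ∧ t' = 0) ∨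
      (((k : ℕ) = k' + 1 ∨ (o.cyclic ∧ (k' : ℕ) + 1 = o.n ∧ (k : ℕ) = 0)) ∧ t' = 1 ∧ t = 0)) := by
  rw [← o.adjacent_iff k.2 k'.2, ← o.adjacent_iff k'.2 k.2]
  have key : ∀ (k k' : Fin o.n) (r r' t t' : unitInterval), r ≠ 0 →
      o.sectors (k, r, t) = o.sectors (k', r', t') → r = r' ∧ ((k = k' ∧ t = t') ∨
      ((G.bar (G.exit (o.c k)) ≠ G.exit (o.c k) ∧ o.c k' = G.rot (o.c k)) ∧ t = 1 ∧ t' = 0) ∨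
      ((G.bar (G.exit (o.c k')) ≠ G.exit (o.c k') ∧ o.c k = G.rot (o.c k')) ∧ t' = 1 ∧ t = 0)) := by
    intro k k' r r' t t' hr h
    by_cases ht : t ∈ Set.Ioo (0 : unitInterval) 1
    · obtain ⟨h1, h2⟩ := G.cells.face_eq_face (Triangle.sector_mem_interior hr ht) h
      obtain ⟨h3, h4, h5⟩ := o.eq_of_sectors_eq hr h2 h1
      exact ⟨h4, .inl ⟨h3, h5⟩⟩
    · have : t = 0 ∨ t = 1 := by
        by_contra! h
        exact ht ⟨unitInterval.pos_iff_ne_zero.2 h.1, unitInterval.lt_one_iff_ne_one.2 h.2⟩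
      rcases this with rfl | rfl
      · obtain ⟨hr', ⟨h1, h2, h3⟩ | rfl⟩ := o.exists_right_of_left hr h
        · exact ⟨h2, .inl ⟨h1, h3⟩⟩
        · obtain ⟨h1, ⟨h2, h3⟩ | ⟨h2, h3⟩⟩ := o.sectors_eq_of_right hr' h.symm
          · exact ⟨h1.symm, .inl ⟨h2.symm, h3.symm⟩⟩
          · exact ⟨h1.symm, .inr (.inr ⟨h2, rfl, rfl⟩)⟩
      · obtain ⟨h1, ⟨h2, h3⟩ | ⟨h2, h3⟩⟩ := o.sectors_eq_of_right hr h
        · exact ⟨h1, .inl ⟨h2, h3⟩⟩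
        · exact ⟨h1, .inr (.inl ⟨h2, rfl, h3⟩)⟩
  constructor
  · intro h
    rcases eq_or_ne r 0 with hr | hr
    · rcases eq_or_ne r' 0 with hr' | hr'
      · exact ⟨hr.trans hr'.symm, .inl hr⟩
      · exact absurd ((key k' k r' r t' t hr' h.symm).1.trans hr) hr'
    · obtain ⟨h1, h2⟩ := key k k' r r' t t' hr h
      exact ⟨h1, .inr h2⟩
  · rintro ⟨rfl, h | ⟨rfl, rfl⟩ | ⟨⟨h1, h2⟩, rfl, rfl⟩ | ⟨⟨h1, h2⟩, rfl, rfl⟩⟩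
    · subst h
      rw [o.sectors_zero, o.sectors_zero]
    · rfl
    · exact o.sectors_glue h1 h2 r
    · exact (o.sectors_glue h1 h2 r).symm

-- The image is cut out by the vertex coordinate being larger than `1 / 4`: only one corner can
-- contribute to the sum, so its barycentric coordinate exceeds `3 / 4`, which is the condition `r <
-- 1`.
open Classical in
theorem isOpen_sectors_image : IsOpen (o.sectors '' {z | z.2.1 < 1}) := by
  have : o.sectors '' {z | z.2.1 < 1} = {x : G.Space | 1 / 4 < x.1.1 v} := by
    have hval : ∀ T p, (G.faceMap T p).1.1 v =
        ∑ j, if G.vertex (T, j) = v then max (p.1 j - 1 / 2) 0 else 0 := fun T p => rfl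
    ext x
    constructor
    · rintro ⟨⟨k, r, t⟩, hr, rfl⟩
      have hr' : (r : ℝ) < 1 := hr
      change 1 / 4 < (G.faceMap _ _).1.1 v
      rw [hval]
      refine lt_of_lt_of_le ?_ (Finset.single_le_sum (fun j _ => ?_) (Finset.mem_univ (o.c k).2))
      · rw [if_pos ((o.vertex_eq_iff _).2 ⟨k, k.2, rfl⟩)]
        refine lt_max_of_lt_left ?_
        rw [Triangle.sector_apply_zero]
        linarith
      · split_ifs
        · exact le_max_right _ _
        · exact le_rfl
    · intro hx
      obtain ⟨T, p, rfl⟩ := G.exists_faceMap_eq x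
      rw [Set.mem_ofPred_eq, hval] at hx
      obtain ⟨j, hj⟩ : ∃ j, 0 < if G.vertex (T, j) = v then max (p.1 j - 1 / 2) 0 else 0 := by
        by_contra! h
        linarith [Finset.sum_nonpos fun j (_ : j ∈ Finset.univ) => h j]
      have hjv : G.vertex (T, j) = v := by
        by_contra h
        rw [if_neg h] at hj
        exact lt_irrefl _ hj
      rw [if_pos hjv, lt_max_iff] at hj
      have hj' : 1 / 2 < p.1 j := by
        rcases hj with hj | hj
        · linarith
        · exact absurd hj (lt_irrefl _)
      rw [Finset.sum_eq_single j (fun i _ hij => by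
        split_ifs
        · refine max_eq_right ?_
          by_contra! h
          exact hij (Triangle.eq_of_half_lt (by linarith) hj')
        · rfl) (fun h => absurd (Finset.mem_univ j) h), if_pos hjv,
        max_eq_left (by linarith)] at hx
      obtain ⟨r, t, hr, hp⟩ := Triangle.exists_eq_sector (p := p) (j := j) (by linarith)
      obtain ⟨k, hk, hkc⟩ := (o.vertex_eq_iff _).1 hjv
      refine ⟨(⟨k, hk⟩, r, t), hr, ?_⟩
      simp only [sectors, hkc, ← hp]
  rw [this]
  exact isOpen_lt continuous_const ((continuous_apply v).comp
    (continuous_fst.comp continuous_subtype_val))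

end CornerOrder

variable (G)

/-- Vertices have charts, which are boundary charts if an unglued side ends at the vertex. -/
theorem exists_chart_vertex (v : G.Vertex) :
    ∃ φ : OpenPartialHomeomorph G.Space (EuclideanHalfSpace 2), G.vertexPoint v ∈ φ.source ∧
      ∀ x, G.vertex x = v → (G.bar (G.exit x) = G.exit x ∨ G.bar (G.entry x) = G.entry x) →
        (φ (G.vertexPoint v)).1 0 = 0 := by
  obtain ⟨o⟩ := G.nonempty_cornerOrder v
  rw [← o.sectors_zero ⟨0, o.n_pos⟩ 0]
  by_cases hc : o.cyclic
  · obtain ⟨φ, h1, -⟩ := exists_interior_chart (q := o.sectors) (Ψ := polarSector (2 * Real.pi) o.n)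
      (U := {z | z.2.1 < 1}) (y := (⟨0, o.n_pos⟩, 0, 0)) o.continuous_sectors
      (continuous_polarSector _ _)
      (fun ⟨k, r, t⟩ ⟨k', r', t'⟩ => by
        rw [o.sectors_eq_iff, polarSector_eq_iff o.n_pos o.cyclic (by rw [if_pos hc])])
      o.isOpen_sectors_image
      (by rw [polarSector_image_disc o.n_pos]; exact Metric.isOpen_ball)
      (show (0 : unitInterval) < 1 from zero_lt_one)
    exact ⟨φ, h1, fun x hx h => absurd hc (o.not_cyclic hx h)⟩
  · obtain ⟨φ, h1, h2⟩ := exists_halfPlane_chart (q := o.sectors) (Ψ := polarSector Real.pi o.n)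
      (U := {z | z.2.1 < 1}) (y := (⟨0, o.n_pos⟩, 0, 0)) o.continuous_sectors
      (continuous_polarSector _ _) (im_polarSector_nonneg o.n_pos)
      (fun ⟨k, r, t⟩ ⟨k', r', t'⟩ => by
        rw [o.sectors_eq_iff, polarSector_eq_iff o.n_pos o.cyclic (by rw [if_neg hc])])
      o.isOpen_sectors_image Metric.isOpen_ball (polarSector_image_halfDisc o.n_pos)
      (show (0 : unitInterval) < 1 from zero_lt_one)
    exact ⟨φ, h1, fun x hx h => by rw [h2]; simp [polarSector]⟩

end TriangleGluing

namespace TriangleGluing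

variable (G : TriangleGluing)

/-! ### The glued space as a surface -/

/-- The edges with only one side. -/
def IsFree (e : G.E) : Prop := ∃ s, G.edge s = e ∧ G.bar s = s

variable {G}

theorem IsFree.bar_eq {e : G.E} (he : G.IsFree e) {s : G.F × Fin 3} (hs : G.edge s = e) :
    G.bar s = s := by
  obtain ⟨s', rfl, hb⟩ := he
  rcases (G.edge_eq_iff _ _).1 hs with h | h
  · rw [← h, hb]
  · have : s = s' := by
      rw [← G.bar_bar s, ← h, hb]
    rw [this, hb]

theorem IsFree.sideEdge_iff {s : G.F × Fin 3} (hb : G.bar s = s) (T : G.F) (i : Fin 3) :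
    G.cells.sideEdge T i = G.edge s ↔ (T, i) = s := by
  have := G.edge_eq_iff s (T, i)
  rw [hb, or_self] at this
  rw [← this]
  exact eq_comm

theorem sideEdge_iff (s : G.F × Fin 3) (T : G.F) (i : Fin 3) :
    G.cells.sideEdge T i = G.edge s ↔ (T, i) = s ∨ (T, i) = G.bar s := by
  rw [← G.edge_eq_iff]
  exact eq_comm

theorem exists_interior_chart_of_not_isFree {e : G.E} (he : ¬ G.IsFree e) {x : unitInterval}
    (hx : x ∈ Set.Ioo (0 : unitInterval) 1) :
    ∃ φ : OpenPartialHomeomorph G.Space (EuclideanHalfSpace 2),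
      G.edgeMap e x ∈ φ.source ∧ 0 < (φ (G.edgeMap e x)).1 0 := by
  obtain ⟨s, rfl⟩ := G.edge_surjective e
  exact G.cells.exists_interior_chart_edge (fun h => he ⟨s, rfl, h.symm⟩) (sideEdge_iff s) hx

variable (G)

/-- Every point has a chart, which is a boundary chart at the points of free edges. -/
theorem exists_chart (x : G.Space) : ∃ φ : OpenPartialHomeomorph G.Space (EuclideanHalfSpace 2),
    x ∈ φ.source ∧ ∀ e, G.IsFree e → x ∈ Set.range (G.edgeMap e) → (φ x).1 0 = 0 := by
  obtain ⟨c, hc, -⟩ := G.cells.existsUnique_cell x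
  rcases c with v | e | T
  · obtain rfl : x = G.vertexPoint v := hc
    obtain ⟨φ, h1, h2⟩ := G.exists_chart_vertex v
    refine ⟨φ, h1, ?_⟩
    rintro e he ⟨u, hu⟩
    have hvinj : ∀ v', G.vertexPoint v' = G.vertexPoint v → v' = v := fun v' h =>
      Sum.inl_injective (G.cells.cell_unique (c := .inl v') (c' := .inl v) h.symm rfl)
    have hbar := he.bar_eq (G.edge_mainSide e)
    have hu01 : u = 0 ∨ u = 1 := by
      by_contra! h
      have := G.cells.edge_mem_cell e (x := u)
        ⟨unitInterval.pos_iff_ne_zero.2 h.1, unitInterval.lt_one_iff_ne_one.2 h.2⟩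
      rw [show G.cells.edgeMap e u = G.vertexPoint v from hu] at this
      simpa using G.cells.cell_unique (c := .inl v) rfl this
    rcases hu01 with rfl | rfl
    -- The free side is the exit side of the corner at its start and the entry side of the corner at
    -- its end.
    · refine h2 ((G.mainSide e).1, (G.mainSide e).2 + 1) (hvinj _ ?_) (.inl ?_)
      · rw [← faceMap_corner, ← Triangle.side_zero_eq]
        exact hu
      · have : G.exit ((G.mainSide e).1, (G.mainSide e).2 + 1) = G.mainSide e :=
          Prod.ext rfl (add_one_two _)
        rw [this, hbar]
    · refine h2 ((G.mainSide e).1, (G.mainSide e).2 + 2) (hvinj _ ?_) (.inr ?_)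
      · rw [← faceMap_corner, ← Triangle.side_one_eq]
        exact hu
      · have : G.entry ((G.mainSide e).1, (G.mainSide e).2 + 2) = G.mainSide e :=
          Prod.ext rfl (add_two_one _)
        rw [this, hbar]
  · obtain ⟨u, hu, rfl⟩ := hc
    by_cases he : G.IsFree e
    · obtain ⟨s, rfl, hb⟩ := he
      obtain ⟨φ, h1, h2⟩ := G.cells.exists_boundary_chart_edge (IsFree.sideEdge_iff hb) hu
      exact ⟨φ, h1, fun _ _ _ => h2⟩
    · obtain ⟨φ, h1, -⟩ := exists_interior_chart_of_not_isFree he hu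
      refine ⟨φ, h1, ?_⟩
      rintro e' he' ⟨u', hu'⟩
      obtain ⟨rfl, -⟩ := G.cells.edge_eq_edge hu hu'.symm
      exact absurd he' he
  · obtain ⟨p, hp, rfl⟩ := hc
    obtain ⟨φ, h1, -⟩ := G.cells.exists_interior_chart_face T hp
    refine ⟨φ, h1, ?_⟩
    rintro e - ⟨u, hu⟩
    have := G.cells.face_mem_cell T hp
    rw [show G.cells.faceMap T p = G.cells.edgeMap e u from hu.symm] at this
    exact absurd this (G.cells.edge_notMem_face_cell _ _ _)

/-- The selected charts become the preferred ones, so closed free edges lie in the boundary by the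
choice made in `exists_chart`. -/
noncomputable instance : ChartedSpace (EuclideanHalfSpace 2) G.Space where
  atlas := Set.range fun x => (G.exists_chart x).choose
  chartAt x := (G.exists_chart x).choose
  mem_chart_source x := (G.exists_chart x).choose_spec.1
  chart_mem_atlas x := ⟨x, rfl⟩

/-- The directed triangulated surface of a gluing. -/
noncomputable def directedSurface (h : 3 ≤ Nat.card G.E) : DirectedTriangulatedSurface.{0} where
  surface := { carrier := G.Space }
  cells := G.cells
  three_le_edges := h
  next _ := finRotate 3
  next_isThreeCycle _ := cycleType_finRotate

/-- An inner point of a glued edge has an interior chart, so invariance keeps it out of the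
boundary. For free edges, ends included, the preferred charts decide. -/
theorem isBoundaryEdge_iff (h : 3 ≤ Nat.card G.E) (e : G.E) :
    (G.directedSurface h).IsBoundaryEdge e ↔ G.IsFree e := by
  constructor
  · intro hb
    by_contra he
    obtain ⟨x, hx⟩ : ∃ x : unitInterval, x ∈ Set.Ioo (0 : unitInterval) 1 := exists_between zero_lt_one
    exact (G.directedSurface h).surface.notMem_boundary
      (exists_interior_chart_of_not_isFree he hx) (hb ⟨x, rfl⟩)
  · intro he x hx
    exact ((G.directedSurface h).surface.mem_boundary_iff x).2
      ((G.exists_chart x).choose_spec.2 e he hx)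

end TriangleGluing

/-! ### The gluing of a triangulation quiver -/

/-- The orbits of a permutation of order three without fixed points can be labelled by `Fin 3`. -/
theorem Equiv.Perm.exists_orbit_equiv {A : Type*} [Finite A] (g : Equiv.Perm A)
    (h3 : ∀ a, g (g (g a)) = a) (h1 : ∀ a, g a ≠ a) :
    ∃ (m : ℕ) (ψ : Fin m × Fin 3 ≃ A), ∀ T i, ψ (T, i + 1) = g (ψ (T, i)) := by
  let O := Quotient (Equiv.Perm.SameCycle.setoid g)
  obtain ⟨m, ⟨ε⟩⟩ := Finite.exists_equiv_fin O
  have h2 : ∀ a, g (g a) ≠ a := fun a h => h1 a (by rw [← h, h3, h])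
  let ψ : Fin m × Fin 3 → A := fun s => (g ^ (s.2 : ℕ)) (ε.symm s.1).out
  have hinj : Function.Injective ψ := by
    rintro ⟨T, i⟩ ⟨T', i'⟩ h
    have hT : T = T' := by
      apply ε.symm.injective
      rw [← Quotient.out_equiv_out]
      exact ⟨-(i' : ℕ) + (i : ℕ), by
        rw [zpow_add, Equiv.Perm.mul_apply, zpow_natCast, show (g ^ (i : ℕ)) _ = _ from h, zpow_neg,
          zpow_natCast, Equiv.Perm.inv_eq_iff_eq]⟩
    subst hT
    congr 1
    simp only [ψ] at h
    generalize (ε.symm T).out = a at h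
    have e1 := h1 a
    have e2 := h2 a
    have e3 := h1 (g a)
    fin_cases i <;> fin_cases i' <;> simp [pow_succ, e1, e2, e1.symm, e2.symm] at h ⊢
  have hsurj : Function.Surjective ψ := by
    intro a
    obtain ⟨i, hi⟩ : Equiv.Perm.SameCycle g (Quotient.mk (Equiv.Perm.SameCycle.setoid g) a).out a :=
      Quotient.mk_out (s := Equiv.Perm.SameCycle.setoid g) a
    have hg : g ^ (3 : ℤ) = 1 := Equiv.ext h3
    have hi3 : (i % 3).toNat < 3 := by omega
    refine ⟨(ε (Quotient.mk _ a), ⟨(i % 3).toNat, hi3⟩), ?_⟩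
    simp only [ψ, Equiv.symm_apply_apply]
    rw [← zpow_natCast, Int.toNat_of_nonneg (Int.emod_nonneg _ (by norm_num))]
    conv_rhs => rw [← hi, ← Int.emod_add_mul_ediv i 3, zpow_add, zpow_mul, hg, one_zpow, mul_one]
  refine ⟨m, Equiv.ofBijective ψ ⟨hinj, hsurj⟩, fun T i => ?_⟩
  change (g ^ ((i + 1 : Fin 3) : ℕ)) (ε.symm T).out = g ((g ^ (i : ℕ)) (ε.symm T).out)
  generalize (ε.symm T).out = a
  fin_cases i
  · rfl
  · rfl
  · exact (h3 a).symm

/-! ### The surface of a triangulation quiver -/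

namespace QuiverPerm.IsTriangulationQuiver

variable {Q : QuiverPerm.{u, v}}

/-- Every vertex has an outgoing arrow that is not fixed. -/
theorem not_two_fixed (hQ : Q.IsTriangulationQuiver) (hcard : 3 ≤ Nat.card Q.V) {α β : Q.A}
    (hne : α ≠ β) (hs : Q.s α = Q.s β) (hα : Q.f α = α) (hβ : Q.f β = β) : False := by
  have := hQ.finite_vertices
  have := hQ.finite_arrows
  have hout : ∀ γ, Q.s γ = Q.s α → γ = α ∨ γ = β := by
    obtain ⟨a, b, hab, h⟩ := Set.ncard_eq_two.1 (hQ.two_outgoing (Q.s α))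
    have h' : ∀ γ, Q.s γ = Q.s α ↔ γ = a ∨ γ = b := fun γ => by
      have : γ ∈ {γ | Q.s γ = Q.s α} ↔ γ ∈ ({a, b} : Set Q.A) := by rw [h]
      simpa using this
    have hα' := (h' α).1 rfl
    have hβ' := (h' β).1 hs.symm
    intro γ hγ
    have hγ' := (h' γ).1 hγ
    grind
  have htα : Q.t α = Q.s α := by rw [← hQ.s_f, hα]
  have htβ : Q.t β = Q.s α := by rw [← hQ.s_f, hβ, hs]
  -- If `γ` ends at the vertex, `f γ` starts there and is `α` or `β`, both fixed, so `γ` is that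
  -- arrow. Thus no arrow joins the vertex to another one.
  have hin : ∀ γ, Q.t γ = Q.s α → γ = α ∨ γ = β := by
    intro γ hγ
    have h1 := hout (Q.f γ) (by rw [hQ.s_f, hγ])
    rcases h1 with h1 | h1
    · exact .inl (Q.f.injective (h1.trans hα.symm))
    · exact .inr (Q.f.injective (h1.trans hβ.symm))
  have key : ∀ x y, Relation.EqvGen (fun x y => ∃ α : Q.A, Q.s α = x ∧ Q.t α = y) x y →
      (x = Q.s α ↔ y = Q.s α) := by
    intro x y h
    induction h with
    | rel x y h =>
      obtain ⟨γ, rfl, rfl⟩ := h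
      constructor
      · intro h
        rcases hout γ h with rfl | rfl
        · exact htα
        · exact htβ
      · intro h
        rcases hin γ h with rfl | rfl
        · rfl
        · exact hs.symm
    | refl x => rfl
    | symm x y _ ih => exact ih.symm
    | trans x y z _ _ ih ih' => exact ih.trans ih'
  have : Subsingleton Q.V := ⟨fun x y => by
    rw [(key _ x (hQ.connected _ x)).1 rfl, (key _ y (hQ.connected _ y)).1 rfl]⟩
  have := Finite.card_le_one_iff_subsingleton.2 this
  omega

/-- The arrows with the same source as a given arrow. -/
theorem exists_other (hQ : Q.IsTriangulationQuiver) (α : Q.A) :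
    ∃ β, β ≠ α ∧ ∀ γ, Q.s γ = Q.s α ↔ γ = α ∨ γ = β := by
  obtain ⟨a, b, hab, h⟩ := Set.ncard_eq_two.1 (hQ.two_outgoing (Q.s α))
  have h' : ∀ γ, Q.s γ = Q.s α ↔ γ = a ∨ γ = b := fun γ => by
    have : γ ∈ {γ | Q.s γ = Q.s α} ↔ γ ∈ ({a, b} : Set Q.A) := by rw [h]
    simpa using this
  rcases (h' α).1 rfl with rfl | rfl
  · exact ⟨b, hab.symm, h'⟩
  · exact ⟨a, hab, fun γ => (h' γ).trans or_comm⟩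

theorem exists_arrow (hQ : Q.IsTriangulationQuiver) (v : Q.V) : ∃ α, Q.s α = v := by
  have h : ({α : Q.A | Q.s α = v}).Nonempty := by
    by_contra h
    have h2 := hQ.two_outgoing v
    rw [Set.not_nonempty_iff_eq_empty.1 h, Set.ncard_empty] at h2
    exact absurd h2 (by norm_num)
  exact h

/-- A triangulation quiver with at least three vertices is obtained from a gluing of triangles. -/
theorem exists_gluing (hQ : Q.IsTriangulationQuiver) (hcard : 3 ≤ Nat.card Q.V) :
    ∃ (G : TriangleGluing) (φ : Q.V ≃ G.E) (ψ : G.F × Fin 3 ≃ {α : Q.A // Q.f α ≠ α}),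
      (∀ s, φ (Q.s (ψ s)) = G.edge s) ∧ ∀ T i, (ψ (T, i + 1) : Q.A) = Q.f (ψ (T, i)) := by
  have := hQ.finite_vertices
  have := hQ.finite_arrows
  -- Cells are indexed by types in `Type`, so the vertices of `Q`, from any universe, are replaced
  -- by `Fin n`.
  obtain ⟨n, ⟨φ⟩⟩ := Finite.exists_equiv_fin Q.V
  let g : Equiv.Perm {α : Q.A // Q.f α ≠ α} := Q.f.subtypePerm fun α => by simp
  have hg : ∀ a, (g a : Q.A) = Q.f a := fun a => rfl
  obtain ⟨m, ψ, hψ⟩ := g.exists_orbit_equiv (fun a => Subtype.ext (hQ.f_cubed a))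
    fun a h => a.2 (congrArg Subtype.val h)
  have hψ' : ∀ T i, (ψ (T, i + 1) : Q.A) = Q.f (ψ (T, i)) := fun T i => by rw [hψ, hg]
  have hsurj : ∀ v, ∃ s, Q.s (ψ s) = v := by
    intro v
    obtain ⟨α, rfl⟩ := hQ.exists_arrow v
    obtain ⟨β, hne, hβ⟩ := hQ.exists_other α
    by_cases hα : Q.f α = α
    · by_cases hβf : Q.f β = β
      · exact (hQ.not_two_fixed hcard hne ((hβ β).2 (.inr rfl)) hβf hα).elim
      · exact ⟨ψ.symm ⟨β, hβf⟩, by rw [ψ.apply_symm_apply]; exact (hβ β).2 (.inr rfl)⟩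
    · exact ⟨ψ.symm ⟨α, hα⟩, by rw [ψ.apply_symm_apply]⟩
  -- The partner of a side is the other arrow with the same source, or the side itself if that arrow
  -- is fixed.
  have hbar : ∀ s, ∃ s', ∀ s'', Q.s (ψ s) = Q.s (ψ s'') ↔ s'' = s ∨ s'' = s' := by
    intro s
    obtain ⟨β, hne, hβ⟩ := hQ.exists_other (ψ s)
    have h1 : ∀ s'', (ψ s'' : Q.A) = ψ s ↔ s'' = s := fun s'' => by
      rw [Subtype.coe_inj, ψ.apply_eq_iff_eq]
    by_cases hβf : Q.f β = β
    · refine ⟨s, fun s'' => ?_⟩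
      rw [eq_comm, hβ, h1]
      have : (ψ s'' : Q.A) ≠ β := fun h => (ψ s'').2 (h ▸ hβf)
      simp [this]
    · refine ⟨ψ.symm ⟨β, hβf⟩, fun s'' => ?_⟩
      rw [eq_comm, hβ, h1, Equiv.eq_symm_apply, Subtype.ext_iff]
  choose bar hbar using hbar
  have hFin : Nonempty (Fin m) := by
    obtain ⟨v⟩ := hQ.nonempty
    obtain ⟨s, -⟩ := hsurj v
    exact ⟨s.1⟩
  have hconn : ∀ v w, Relation.EqvGen (fun x y => ∃ α : Q.A, Q.s α = x ∧ Q.t α = y) v w →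
      Relation.EqvGen (fun a b => ∃ T i j, φ (Q.s (ψ (T, i))) = a ∧ φ (Q.s (ψ (T, j))) = b)
        (φ v) (φ w) := by
    intro v w h
    induction h with
    | rel x y h =>
      obtain ⟨α, rfl, rfl⟩ := h
      by_cases hα : Q.f α = α
      · rw [← hQ.s_f, hα]
        exact .refl _
      · obtain ⟨⟨T, i⟩, hs⟩ := ψ.surjective ⟨α, hα⟩
        refine .rel _ _ ⟨T, i, i + 1, ?_, ?_⟩
        · rw [hs]
        · rw [hψ', hs, hQ.s_f]
    | refl x => exact .refl _
    | symm x y _ ih => exact .symm _ _ ih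
    | trans x y z _ _ ih ih' => exact .trans _ _ _ ih ih'
  refine ⟨{
    F := Fin m
    E := Fin n
    edge := fun s => φ (Q.s (ψ s))
    edge_surjective := fun e => by
      obtain ⟨s, hs⟩ := hsurj (φ.symm e)
      exact ⟨s, (congrArg φ hs).trans (φ.apply_symm_apply e)⟩
    bar := bar
    bar_bar := fun s => by
      have h1 := (hbar s (bar s)).2 (.inr rfl)
      rcases (hbar (bar s) s).1 h1.symm with h | h
      · rw [← h, ← h]
      · exact h.symm
    edge_eq_iff := fun s s' => by rw [φ.apply_eq_iff_eq, hbar]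
    connected := fun e e' => by
      have := hconn _ _ (hQ.connected (φ.symm e) (φ.symm e'))
      rwa [φ.apply_symm_apply, φ.apply_symm_apply] at this }, φ, ψ, fun s => rfl, hψ'⟩

/-- A triangulation quiver with at least three vertices is the quiver of a directed triangulated
surface. -/
theorem exists_surface (hQ : Q.IsTriangulationQuiver) (hcard : 3 ≤ Nat.card Q.V) :
    ∃ D : DirectedTriangulatedSurface.{0}, Nonempty (Q.Iso D.quiver) := by
  classical
  obtain ⟨G, φ, ψ, hs, hf⟩ := hQ.exists_gluing hcard
  have hE : 3 ≤ Nat.card G.E := by rwa [← Nat.card_congr φ]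
  -- The other arrow at the source of a fixed arrow is not fixed; its side has no partner.
  have hfree : ∀ α : {α : Q.A // Q.f α = α}, G.IsFree (φ (Q.s α)) := by
    rintro ⟨α, hα⟩
    obtain ⟨β, hne, hβ⟩ := hQ.exists_other α
    have hβα := (hβ β).2 (.inr rfl)
    have hβf : Q.f β ≠ β := fun h => hQ.not_two_fixed hcard hne hβα h hα
    obtain ⟨s, hψs⟩ := ψ.surjective ⟨β, hβf⟩
    have hψs' : (ψ s : Q.A) = β := congrArg Subtype.val hψs
    refine ⟨s, by rw [← hs, hψs', hβα], ?_⟩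
    have h1 : G.edge s = G.edge (G.bar s) := (G.edge_eq_iff _ _).2 (.inr rfl)
    rw [← hs, ← hs, φ.apply_eq_iff_eq, hψs', hβα] at h1
    rcases (hβ _).1 h1.symm with h2 | h2
    · exact absurd (h2 ▸ hα : Q.f (ψ (G.bar s)) = ψ (G.bar s)) (ψ (G.bar s)).2
    · exact ψ.injective (Subtype.ext (h2.trans hψs'.symm))
  let β : {α : Q.A // Q.f α = α} ≃ {e : G.E // (G.directedSurface hE).IsBoundaryEdge e} :=
    Equiv.ofBijective (fun α => ⟨φ (Q.s α), (G.isBoundaryEdge_iff hE _).2 (hfree α)⟩) (by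
      constructor
      · rintro ⟨α, hα⟩ ⟨α', hα'⟩ h
        have h1 : Q.s α = Q.s α' := φ.injective (congrArg Subtype.val h)
        by_contra hne
        exact hQ.not_two_fixed hcard (fun h => hne (Subtype.ext h)) h1 hα hα'
      · rintro ⟨e, he⟩
        obtain ⟨s, rfl, hb⟩ := (G.isBoundaryEdge_iff hE e).1 he
        obtain ⟨δ, hne, hδ⟩ := hQ.exists_other (ψ s)
        have hδs := (hδ δ).2 (.inr rfl)
        have hδf : Q.f δ = δ := by
          by_contra hδf
          obtain ⟨s', hψs⟩ := ψ.surjective ⟨δ, hδf⟩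
          have hψs' : (ψ s' : Q.A) = δ := congrArg Subtype.val hψs
          have h1 : G.edge s = G.edge s' := by rw [← hs, ← hs, hψs', hδs]
          rw [G.edge_eq_iff, hb, or_self] at h1
          exact hne (by rw [← hψs', h1])
        exact ⟨⟨δ, hδf⟩, Subtype.ext ((congrArg φ hδs).trans (hs s))⟩)
  have hβ : ∀ e, φ (Q.s (β.symm e)) = e.1 := fun e => congrArg Subtype.val (β.apply_symm_apply e)
  let η : (G.directedSurface hE).quiver.A ≃ Q.A :=
    ((Equiv.sumComm _ _).trans (Equiv.sumCongr β.symm ψ)).trans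
      (Equiv.sumCompl fun α => Q.f α = α)
  have hη1 : ∀ s, η (.inl s) = ψ s := fun s => rfl
  have hnext : ∀ i : Fin 3, finRotate 3 i = i + 1 := by decide
  have hηs : ∀ a, φ (Q.s (η a)) = (G.directedSurface hE).quiver.s a := by
    rintro (s | e)
    · exact hs s
    · exact hβ e
  have hηf : ∀ a, Q.f (η a) = η ((G.directedSurface hE).quiver.f a) := by
    rintro (⟨T, i⟩ | e)
    · have : (G.directedSurface hE).quiver.f (.inl (T, i)) = .inl (T, i + 1) := by
        rw [← hnext]
        rfl
      rw [this, hη1, hη1]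
      exact (hf T i).symm
    · exact (β.symm e).2
  -- On both quivers the target is the source of the image under the permutation, so compatibility
  -- with targets follows from that with sources and permutations.
  have hst : ∀ a, (G.directedSurface hE).quiver.t a =
      (G.directedSurface hE).quiver.s ((G.directedSurface hE).quiver.f a) := by
    rintro (s | e) <;> rfl
  refine ⟨G.directedSurface hE, ⟨{ onV := φ, onA := η.symm, map_s := ?_, map_t := ?_, map_f := ?_ }⟩⟩
  · intro α
    obtain ⟨a, rfl⟩ := η.surjective α
    rw [η.symm_apply_apply]
    exact hηs a
  · intro α
    obtain ⟨a, rfl⟩ := η.surjective α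
    rw [η.symm_apply_apply, ← hQ.s_f, hηf]
    exact (hηs _).trans (hst a).symm
  · intro α
    obtain ⟨a, rfl⟩ := η.surjective α
    rw [hηf, η.symm_apply_apply, η.symm_apply_apply]

end QuiverPerm.IsTriangulationQuiver

/-! ### The main theorem -/

theorem theorem4p11 (Q : QuiverPerm.{u, v}) (hQ : Q.IsTriangulationQuiver)
    (hcard : 3 ≤ Nat.card Q.V) :
    (∃ D : DirectedTriangulatedSurface.{0}, Nonempty (Q.Iso D.quiver)) ∧
    (Q.HasFixedLoop ↔
      ∃ D : DirectedTriangulatedSurface.{0}, Nonempty (Q.Iso D.quiver) ∧ D.boundary.Nonempty) ∧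
    (∀ D : DirectedTriangulatedSurface.{w}, Nonempty (Q.Iso D.quiver) →
      (Q.HasFixedLoop ↔ D.boundary.Nonempty)) := by
  refine ⟨hQ.exists_surface hcard, ⟨fun h => ?_, ?_⟩, ?_⟩
  · obtain ⟨D, ⟨φ⟩⟩ := hQ.exists_surface hcard
    exact ⟨D, ⟨φ⟩, (φ.hasFixedLoop_iff_boundary_nonempty hQ).1 h⟩
  · rintro ⟨D, ⟨φ⟩, hb⟩
    exact (φ.hasFixedLoop_iff_boundary_nonempty hQ).2 hb
  · rintro D ⟨φ⟩
    exact φ.hasFixedLoop_iff_boundary_nonempty hQ
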